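/- **Setting.** All functions are complex-analytic on their (open) domains of definition. Let $u_t=\mathbf F(u_\alpha,\dots,u_\beta)$, $\alpha\le\beta$, be a scalar differential-difference (lattice) equation for $u=u(n,t)$, with $u_l=u(n+l,t)$ regarded as independent variables, $u=u_0$, $\mathcal S(u_l)=u_{l+1}$ and $D_t(u_l)=\mathcal S^l(\mathbf F)$. Let $M(u,\lambda)$, $\mathcal U(u_a,\dots,u_b,\lambda)$, $a\le b$, be a $d\times d$ matrix Darboux–Lax representation of it: $M$ is invertible for $u$ in a connected open set $\mathcal D\subset\mathbb C$ and $\lambda$ in an open set containing given points $c_1,\dots,c_m$, and $D_t(M)=\mathcal S(\mathcal U)M-M\,\mathcal U$. (As functions of the variables $u_l\in\mathcal D$, $\mathbf F$ and $\mathcal U$ are defined on open dense sets.) Let $$G=\prod_{p=1}^m \mathrm{GL}_d\big(\mathbb C[\lambda]/((\lambda-c_p)^{k_p})\big),$$ let $w=(w^{pq}_{ij})$ be the coordinates on $G$ given by the entries of the matrices $W^{p,q}$ in $g^p=\sum_{q<k_p}(\lambda-c_p)^qW^{p,q}$, and let $\rho$ send an invertible matrix-function of $\lambda$ to the tuple of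 its truncated Taylor expansions at $c_1,\dots,c_m$. On functions of $w$ and finitely many $u_l$, the operators $\mathcal S$ and $D_t$ are extended by $\mathcal S(g)=\rho(M(u,\lambda))\,g$ and $D_t(g)=\mathcal U(u_a,\dots,u_b,\lambda)\,g$ (Taylor expanded and truncated). Define groups of matrix-functions of $\lambda$: $\mathbf H_0=\{\mathbf 1\}$, $\mathbf H_1$ is generated by all $M(\tilde u,\lambda)M(u,\lambda)^{-1}$, and $\mathbf H_{n+1}$ ($n\ge1$) is generated by $\mathbf H_n$ and all $M(u,\lambda)\,h\,M(u,\lambda)^{-1}$, $h\in\mathbf H_n$, where $u,\tilde u\in\mathcal D$; $\mathbf H_n$ acts on $G$ and $G/H$ from the left through $\rho$. **Hypotheses.** Let $H\subset G$ be a closed connected complex Lie subgroup of codimension $r>0$, and let $z$ be an $\mathbf H_{r-1}$-left-invariant function on an open dense subset of $G/H$ (equivalently, an $H$-right-invariant one on $G$). Put $z_j=\mathcal S^j(z)$, $j\in\mathbb Z$. Assume that $z_0,\dots,z_{r-1}$ form a system of local coordinates almost everywhere on $G/H$ (their differentials are linearly independent on an open dense subset), and that $\partial z_r/\partial u$ is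 not identically zero. **Conclusions.** 1. $z_0,\dots,z_{r-1}$ do not depend on the $u_l$ and are functions on (subsets of) $G/H$. 2. Around every point $(g,(u_l))$ such that $z_0,\dots,z_{r-1}$ are local coordinates at $gH$ one has $z_r=F(z_0,\dots,z_{r-1},u)$ and $D_t(z)=Q(z_0,\dots,z_{r-1},u_a,\dots,u_b)$ with analytic $F$, $Q$ (provided that $z_r$, respectively $\mathcal U$, is defined there); and where also $\partial z_r/\partial u\ne0$, the equation $z_r=F(z_0,\dots,z_{r-1},u)$ can be solved as $u=f(z_0,\dots,z_r)$ with $f$ analytic. 3. Put $$P=Q\big(v_0,\dots,v_{r-1},f(v_a,\dots,v_{a+r}),\dots,f(v_b,\dots,v_{b+r})\big)$$ (a function of $v_a,\dots,v_{b+r}$ when $a\le0$ and $b\ge-1$, as one may assume). Then $u=f(v_0,\dots,v_r)$ is a Miura-type transformation from $v_t=P$ to $u_t=\mathbf F(u_\alpha,\dots,u_\beta)$, i.e. $$\sum_{i=0}^r\frac{\partial f(v_0,\dots,v_r)}{\partial v_i}\,\mathcal S^i(P)=\mathbf F\big(f(v_\alpha,\dots,v_{\alpha+r}),\dots,f(v_\beta,\dots,v_{\beta+r})\big)$$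 identically in the variables $v_j$. Precisely: let $F,Q,f$ be analytic functions on open sets, and let $\xi=(g,(u_l))$ be a point such that for all integers $j$ with $|j|\le|\alpha|+|\beta|+|a|+|b|+r$ the following holds around the $j$-th shift $\mathcal S^j\xi$ of $\xi$: $z_0,\dots,z_{r-1}$ are local coordinates, $z_r,\mathbf F,\mathcal U$ are defined, $z_r=F(z_0,\dots,z_{r-1},u)$, $D_t(z)=Q(z_0,\dots,z_{r-1},u_a,\dots,u_b)$, and $f$ solves $z_r=F(z_0,\dots,z_{r-1},u)$ for $u$. Then all functions in the identity are defined and the identity holds for all $(v_j)$ in a neighbourhood of $(z_j(\xi))_{j\in\mathbb Z}$. 4. For every $R\in\mathbb N$, the points $\xi$ for which there are $F,Q,f$ as required in 3 at the shifts $\mathcal S^j\xi$, $|j|\le R$, are dense in the set of all points $(g,(u_l))$ with $u_l\in\mathcal D$. (The domains of $F,Q,f$ are open but need not be connected.) -/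

import Mathlib

open Polynomial Topology Matrix

noncomputable section

namespace Miura

/-! ### Lattice variables, lattice functions and Miura-type transformations -/

/-- Values of the lattice variables `u_p, …, u_q`. -/
abbrev Win (p q : ℤ) : Type := Set.Icc p q → ℂ

/-- The part `(u_p, …, u_q)` of a sequence `(u_l)_{l ∈ ℤ}`. -/
def win (p q : ℤ) (u : ℤ → ℂ) : Win p q := fun l => u l

/-- The sequence shifted by `j` steps: `u_l` is replaced by `u_{l+j}`. -/
def shiftSeq (j : ℤ) (u : ℤ → ℂ) : ℤ → ℂ := fun l => u (l + j)

/-- A complex-analytic function together with its (open) domain of definition.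
The values of `toFun` outside `dom` have no meaning. -/
structure AnalyticFn (V : Type) [NormedAddCommGroup V] [NormedSpace ℂ V] where
  toFun : V → ℂ
  dom : Set V
  isOpen_dom : IsOpen dom
  analytic : AnalyticOnNhd ℂ toFun dom

/-- A function of the lattice variables `u_p, …, u_q`. -/
abbrev LatticeFn (p q : ℤ) : Type := AnalyticFn (Win p q)

section LatticeFn

variable {p q : ℤ}

/-- The value at a sequence; it uses `u_p, …, u_q` only. -/
def LatticeFn.eval (f : LatticeFn p q) (u : ℤ → ℂ) : ℂ := f.toFun (win p q u)

def LatticeFn.DefinedAt (f : LatticeFn p q) (u : ℤ → ℂ) : Prop := win p q u ∈ f.dom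

/-- `D_t(f) = ∑_l S^l(F) ∂f/∂v_l`, the total derivative of `f = f(v_p, …, v_q)` by virtue of
the lattice equation `v_t = F(v_{p'}, …, v_{q'})`. -/
def LatticeFn.totalDeriv {p' q' : ℤ} (F : LatticeFn p' q') (f : LatticeFn p q) (v : ℤ → ℂ) : ℂ :=
  ∑ l ∈ Finset.Icc p q,
    F.eval (shiftSeq l v) * deriv (fun x : ℂ => f.eval (Function.update v l x)) (v l)

/-- `u = f(v_p, …, v_q)` is a Miura-type transformation from `v_t = F'(v_{p'}, …, v_{q'})` to
`u_t = F(u_α, …, u_β)` over the set `𝒱` of values of the variables `v_l`: on `𝒱` every function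
involved is defined, and
`D_t(f) = F(S^α(f), …, S^β(f))` identically in `v`. -/
def IsMiuraOn {p' q' α β : ℤ} (F' : LatticeFn p' q') (F : LatticeFn α β) (f : LatticeFn p q)
    (𝒱 : Set (ℤ → ℂ)) : Prop :=
  ∀ v ∈ 𝒱,
    f.DefinedAt v ∧
    (∀ l ∈ Set.Icc p q, F'.DefinedAt (shiftSeq l v)) ∧
    (∀ i ∈ Set.Icc α β, f.DefinedAt (shiftSeq i v)) ∧
    F.DefinedAt (fun i => f.eval (shiftSeq i v)) ∧
    F'.totalDeriv f v = F.eval (fun i => f.eval (shiftSeq i v))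

end LatticeFn

/-! ### The modified equation -/

section Modified

variable {r : ℕ} {a b : ℤ}

/-- Restriction of variables `v_s, …, v_t` to a smaller window shifted by `j`:
`(v_{p+j}, …, v_{q+j})`. -/
def subWin (p q j s t : ℤ) (h : ∀ l ∈ Set.Icc p q, l + j ∈ Set.Icc s t) :
    Win s t →L[ℂ] Win p q :=
  ContinuousLinearMap.pi fun l => ContinuousLinearMap.proj ⟨l.1 + j, h l.1 l.2⟩

theorem sub_head (a b : ℤ) (r : ℕ) : ∀ l ∈ Set.Icc (0 : ℤ) (r - 1),
    l + 0 ∈ Set.Icc (min a 0) (max (b + r) (r - 1)) := by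
  intro l hl
  simp only [Set.mem_Icc] at *
  omega

theorem sub_f (a b : ℤ) (r : ℕ) (j : Set.Icc a b) : ∀ l ∈ Set.Icc (0 : ℤ) r,
    l + j.1 ∈ Set.Icc (min a 0) (max (b + r) (r - 1)) := by
  intro l hl
  have hj := j.2
  simp only [Set.mem_Icc] at hj hl ⊢
  omega

/-- The arguments `(v_0, …, v_{r-1}, f(v_a, …, v_{a+r}), …, f(v_b, …, v_{b+r}))`. -/
def modArgs (f : LatticeFn 0 r) (v : Win (min a 0) (max (b + r) (r - 1))) :
    Win 0 (r - 1) × Win a b :=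
  (subWin 0 (r - 1) 0 _ _ (sub_head a b r) v,
    fun j => f.toFun (subWin 0 r j.1 _ _ (sub_f a b r j) v))

/-- The values of `v` for which all `f(v_j, …, v_{j+r})`, `a ≤ j ≤ b`, are defined. -/
def modDom (a b : ℤ) (f : LatticeFn 0 r) : Set (Win (min a 0) (max (b + r) (r - 1))) :=
  {v | ∀ j : Set.Icc a b, subWin 0 r j.1 _ _ (sub_f a b r j) v ∈ f.dom}

theorem isOpen_modDom (f : LatticeFn 0 r) : IsOpen (modDom a b f) := by
  have h : modDom a b f = ⋂ j : Set.Icc a b,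
      (subWin 0 r j.1 _ _ (sub_f a b r j)) ⁻¹' f.dom := by
    ext v; simp [modDom]
  rw [h]
  exact isOpen_iInter_of_finite fun j => f.isOpen_dom.preimage (ContinuousLinearMap.continuous _)

theorem analyticOnNhd_modArgs (f : LatticeFn 0 r) :
    AnalyticOnNhd ℂ (modArgs (a := a) (b := b) f) (modDom a b f) := by
  intro v hv
  refine AnalyticAt.prod (ContinuousLinearMap.analyticAt _ _) ?_
  rw [analyticAt_pi_iff]
  intro j
  exact (f.analytic _ (hv j)).comp (ContinuousLinearMap.analyticAt _ _)

/-- The function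
`P = Q(v_0, …, v_{r-1}, f(v_a, …, v_{a+r}), …, f(v_b, …, v_{b+r}))`.
It depends on `v_a, …, v_{b+r}` and on `v_0, …, v_{r-1}`; the latter are among the former as soon
as `a ≤ 0` and `-1 ≤ b`. -/
def modified (f : LatticeFn 0 r) (Q : AnalyticFn (Win 0 (r - 1) × Win a b)) :
    LatticeFn (min a 0) (max (b + r) (r - 1)) where
  toFun v := Q.toFun (modArgs f v)
  dom := modDom a b f ∩ modArgs f ⁻¹' Q.dom
  isOpen_dom :=
    (analyticOnNhd_modArgs f).continuousOn.isOpen_inter_preimage (isOpen_modDom f) Q.isOpen_dom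
  analytic := fun v hv => (Q.analytic _ hv.2).comp (analyticOnNhd_modArgs f v hv.1)

end Modified

/-! ### Darboux–Lax representations -/

/-- A `d × d` matrix Darboux–Lax representation of the form `M = M(u, λ)`,
`U = U(u_a, …, u_b, λ)` for the scalar lattice equation `u_t = F(u_α, …, u_β)`.

`M` is analytic and invertible for `u` in a connected open set `uDom` and `λ` in an open set
`lamDom` (its values elsewhere have no meaning); `U` is analytic for `λ ∈ lamDom` and
`(u_a, …, u_b)` in an open set.  The domains of `F` and of `U` are dense in the set of all
`u`-values. -/
structure DarbouxLax (d : ℕ) {α β : ℤ} (F : LatticeFn α β) (a b : ℤ) where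
  uDom : Set ℂ
  isOpen_uDom : IsOpen uDom
  isConnected_uDom : IsConnected uDom
  lamDom : Set ℂ
  isOpen_lamDom : IsOpen lamDom
  M : ℂ → ℂ → GL (Fin d) ℂ
  analytic_M : ∀ i j, AnalyticOnNhd ℂ
    (fun x : ℂ × ℂ => (M x.1 x.2 : Matrix (Fin d) (Fin d) ℂ) i j) (uDom ×ˢ lamDom)
  U : Win a b → ℂ → Matrix (Fin d) (Fin d) ℂ
  domU : Set (Win a b)
  isOpen_domU : IsOpen domU
  analytic_U : ∀ i j, AnalyticOnNhd ℂ (fun x : Win a b × ℂ => U x.1 x.2 i j) (domU ×ˢ lamDom)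
  dense_domF : {x : Win α β | ∀ l, x l ∈ uDom} ⊆ closure F.dom
  dense_domU : {x : Win a b | ∀ l, x l ∈ uDom} ⊆ closure domU
  /-- `D_t(M) = S(U) M - M U`, where `D_t(M) = F ∂M/∂u` since `M` depends on `u = u_0` only. -/
  zero_curvature : ∀ u : ℤ → ℂ, (∀ l, u l ∈ uDom) → F.DefinedAt u →
    win a b u ∈ domU → win a b (shiftSeq 1 u) ∈ domU → ∀ lam ∈ lamDom,
    (Matrix.of fun i j => F.eval u *
        deriv (fun s : ℂ => (M s lam : Matrix (Fin d) (Fin d) ℂ) i j) (u 0)) =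
      U (win a b (shiftSeq 1 u)) lam * (M (u 0) lam : Matrix (Fin d) (Fin d) ℂ) -
        (M (u 0) lam : Matrix (Fin d) (Fin d) ℂ) * U (win a b u) lam

/-- The subgroups `H_0 ⊂ H_1 ⊂ …` of the group of `GL_d(ℂ)`-valued functions of `λ`. -/
def DarbouxLax.hgroup {d : ℕ} {α β : ℤ} {F : LatticeFn α β} {a b : ℤ} (D : DarbouxLax d F a b) :
    ℕ → Subgroup (ℂ → GL (Fin d) ℂ)
  | 0 => ⊥
  | 1 => Subgroup.closure {h | ∃ u ∈ D.uDom, ∃ u' ∈ D.uDom, h = D.M u' * (D.M u)⁻¹}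
  | n + 2 => Subgroup.closure
      ((D.hgroup (n + 1) : Set (ℂ → GL (Fin d) ℂ)) ∪
        {g | ∃ h ∈ D.hgroup (n + 1), ∃ u ∈ D.uDom, g = D.M u * h * (D.M u)⁻¹})

/-! ### The group `G` -/

/-- The algebra `ℂ[λ]/((λ - c)^k)`. -/
abbrev JetRing (c : ℂ) (k : ℕ) : Type := ℂ[X] ⧸ Ideal.span {(X - C c) ^ k}

/-- The coefficient of `(λ - c)^q` in an element of `ℂ[λ]/((λ - c)^k)`, `q < k`. -/
def jetCoeff {c : ℂ} {k : ℕ} (q : Fin k) (x : JetRing c k) : ℂ :=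
  Quotient.liftOn' x (fun P => (taylor c P).coeff q) (by
    intro P P' h
    have h' : P - P' ∈ Ideal.span {(X - C c) ^ k} :=
      (Submodule.quotientRel_def _).1 h
    obtain ⟨R, hR⟩ := Ideal.mem_span_singleton.1 h'
    have h2 : taylor c (P - P') = X ^ k * taylor c R := by
      rw [hR, taylor_mul, taylor_pow]
      congr 1
      simp
    have h3 : (taylor c (P - P')).coeff q = 0 := by
      rw [h2, coeff_X_pow_mul']
      simp
    rw [map_sub, coeff_sub, sub_eq_zero] at h3
    exact h3)

/-- The truncated Taylor polynomial `∑_{q<k} f^{(q)}(c)/q! (λ - c)^q`. -/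
def taylorPoly (c : ℂ) (k : ℕ) (f : ℂ → ℂ) : ℂ[X] :=
  ∑ q ∈ Finset.range k, C (iteratedDeriv q f c / q.factorial) * (X - C c) ^ q

/-- The class in `Mat_d(ℂ[λ]/((λ - c)^k))` of a matrix-valued function of `λ`, through its Taylor
expansion at `λ = c`. -/
def jetMatrix {d : ℕ} (c : ℂ) (k : ℕ) (A : ℂ → Matrix (Fin d) (Fin d) ℂ) :
    Matrix (Fin d) (Fin d) (JetRing c k) :=
  Matrix.of fun i j => Ideal.Quotient.mk _ (taylorPoly c k fun lam => A lam i j)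

theorem eval_taylorPoly (c : ℂ) (k : ℕ) (hk : 0 < k) (f : ℂ → ℂ) :
    (taylorPoly c k f).eval c = f c := by
  rw [taylorPoly, eval_finsetSum, Finset.sum_eq_single 0]
  · simp
  · intro q _ hq
    simp [hq]
  · simp [hk.ne']

theorem isUnit_jetMatrix {d : ℕ} (c : ℂ) (k : ℕ) (A : ℂ → Matrix (Fin d) (Fin d) ℂ)
    (hA : IsUnit (A c)) : IsUnit (jetMatrix c k A) := by
  rcases Nat.eq_zero_or_pos k with rfl | hk
  · have : Subsingleton (JetRing c 0) := Ideal.Quotient.subsingleton_iff.2 (by simp)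
    exact isUnit_of_subsingleton _
  rw [Matrix.isUnit_iff_isUnit_det]
  set B : Matrix (Fin d) (Fin d) ℂ[X] :=
    Matrix.of fun i j => taylorPoly c k fun lam => A lam i j with hB
  have h1 : jetMatrix c k A =
      (Ideal.Quotient.mk (Ideal.span {(X - C c) ^ k})).mapMatrix B := by
    ext i j; rfl
  have h2 : B.det.eval c = (A c).det := by
    have := RingHom.map_det (evalRingHom c) B
    simp only [coe_evalRingHom] at this
    rw [this]
    congr 1
    ext i j
    simp [hB, eval_taylorPoly c k hk]
  have h3 : B.det.eval c ≠ 0 := by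
    rw [h2]
    exact ((Matrix.isUnit_iff_isUnit_det _).1 hA).ne_zero
  have h4 : IsCoprime ((X - C c) ^ k) B.det := by
    apply IsCoprime.pow_left
    rw [(irreducible_X_sub_C c).coprime_iff_not_dvd, dvd_iff_isRoot]
    exact h3
  rw [h1, ← RingHom.map_det]
  obtain ⟨x, y, hxy⟩ := h4
  refine IsUnit.of_mul_eq_one (Ideal.Quotient.mk _ y) ?_
  rw [← map_mul, ← map_one (Ideal.Quotient.mk (Ideal.span {(X - C c) ^ k})), Ideal.Quotient.eq,
    Ideal.mem_span_singleton]
  exact ⟨-x, by rw [← hxy]; ring⟩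

/-- `G = GL_d(ℂ[λ]/((λ - c_1)^{k_1})) × … × GL_d(ℂ[λ]/((λ - c_m)^{k_m}))`. -/
def LieG (d : ℕ) {m : ℕ} (c : Fin m → ℂ) (k : Fin m → ℕ) : Type :=
  (p : Fin m) → GL (Fin d) (JetRing (c p) (k p))

section Group

variable {d m : ℕ} {c : Fin m → ℂ} {k : Fin m → ℕ}

instance : Group (LieG d c k) :=
  inferInstanceAs (Group ((p : Fin m) → GL (Fin d) (JetRing (c p) (k p))))

/-- The matrix components of an element of `G`. -/
def LieG.mat (g : LieG d c k) (p : Fin m) : Matrix (Fin d) (Fin d) (JetRing (c p) (k p)) :=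
  (g p).val

/-- The space of the coordinates `w^{pq}_{ij}`. -/
abbrev Coord (d : ℕ) {m : ℕ} (k : Fin m → ℕ) : Type :=
  (Σ p : Fin m, Fin (k p) × Fin d × Fin d) → ℂ

/-- The coordinates `w^{pq}_{ij}` of a tuple of matrices `∑_q (λ - c_p)^q W^{p,q}`. -/
def coordMat (A : (p : Fin m) → Matrix (Fin d) (Fin d) (JetRing (c p) (k p))) : Coord d k :=
  fun x => jetCoeff x.2.1 (A x.1 x.2.2.1 x.2.2.2)

/-- The coordinates `w^{pq}_{ij}` on `G`. They embed `G` as an open subset of `Coord d k`. -/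
def coord (g : LieG d c k) : Coord d k := coordMat g.mat

instance : TopologicalSpace (LieG d c k) := TopologicalSpace.induced coord inferInstance

/-- A function on `G` written in the coordinates `w^{pq}_{ij}`. -/
def rep (φ : LieG d c k → ℂ) : Coord d k → ℂ := Function.extend coord φ 0

/-- The homomorphism `ρ` from `GL_d(ℂ)`-valued (analytic) functions of `λ` to `G`, given by the
Taylor expansions at `c_1, …, c_m`. -/
def rho (γ : ℂ → GL (Fin d) ℂ) : LieG d c k := fun p =>
  (isUnit_jetMatrix (c p) (k p) (fun lam => (γ lam : Matrix (Fin d) (Fin d) ℂ))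
    (γ (c p)).isUnit).unit

/-- `H` is a closed connected complex Lie subgroup of `G` of codimension `r`: a closed connected
subgroup that near each of its points is the zero set of an analytic submersion to `ℂ^r`. -/
structure IsClosedConnectedLieSubgroup (H : Subgroup (LieG d c k)) (r : ℕ) : Prop where
  isClosed : IsClosed (H : Set (LieG d c k))
  isConnected : IsConnected (H : Set (LieG d c k))
  submanifold : ∀ h ∈ H, ∃ Φ : Coord d k → (Fin r → ℂ),
    AnalyticAt ℂ Φ (coord h) ∧ Function.Surjective (fderiv ℂ Φ (coord h)) ∧
      ∀ᶠ g in 𝓝 h, (g ∈ H ↔ Φ (coord g) = 0)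

/-- `z`, given on the subset `Y` of `G/H`, is an analytic function on an open dense subset. -/
structure IsFunctionOn {H : Subgroup (LieG d c k)} (z : LieG d c k ⧸ H → ℂ)
    (Y : Set (LieG d c k ⧸ H)) : Prop where
  isOpen : IsOpen Y
  dense : Dense Y
  analytic : ∀ g : LieG d c k, (g : LieG d c k ⧸ H) ∈ Y →
    AnalyticAt ℂ (rep fun g' : LieG d c k => z (g' : LieG d c k ⧸ H)) (coord g)

end Group

/-! ### The operators `S` and `D_t` on functions of `w^{pq}_{ij}` and `u_l` -/

section Operators

variable {d m : ℕ} {c : Fin m → ℂ} {k : Fin m → ℕ}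
variable {α β : ℤ} {F : LatticeFn α β} {a b : ℤ} (D : DarbouxLax d F a b)

/-- Points with coordinates `w^{pq}_{ij}` and `u_l`, `l ∈ ℤ`. -/
abbrev Pt (d : ℕ) {m : ℕ} (c : Fin m → ℂ) (k : Fin m → ℕ) : Type := LieG d c k × (ℤ → ℂ)

/-- The points at which all `u_l` belong to the domain of the variable `u`. -/
def admissible (c : Fin m → ℂ) (k : Fin m → ℕ) : Set (Pt d c k) := {ξ | ∀ l, ξ.2 l ∈ D.uDom}

/-- The transformation of points `g ↦ ρ(M(u_0, λ)) g`, `u_l ↦ u_{l+1}` that induces `S`; its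
inverse is `g ↦ ρ(M(u_{-1}, λ))⁻¹ g`, `u_l ↦ u_{l-1}`. -/
def shiftPt : Equiv.Perm (Pt d c k) where
  toFun ξ := (rho (D.M (ξ.2 0)) * ξ.1, shiftSeq 1 ξ.2)
  invFun ξ := ((rho (D.M (ξ.2 (-1))))⁻¹ * ξ.1, shiftSeq (-1) ξ.2)
  left_inv := by
    rintro ⟨g, u⟩
    refine Prod.ext ?_ ?_
    · simp [shiftSeq]
    · funext l; simp [shiftSeq]
  right_inv := by
    rintro ⟨g, u⟩
    refine Prod.ext ?_ ?_
    · simp [shiftSeq]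
    · funext l; simp [shiftSeq]

/-- The operator `S^j`, `j ∈ ℤ`. -/
def shiftFn (j : ℤ) (φ : Pt d c k → ℂ) : Pt d c k → ℂ := fun ξ => φ ((shiftPt D ^ j) ξ)

/-- `D_t(φ) = ∑ ∂φ/∂w^{pq}_{ij} D_t(w^{pq}_{ij}) + ∑_l ∂φ/∂u_l D_t(u_l)`, where
`D_t(w^{pq}_{ij})` are the coordinates of `U(u_a, …, u_b, λ) g` and `D_t(u_l) = S^l(F)`. -/
def totalDt (φ : Pt d c k → ℂ) : Pt d c k → ℂ := fun ξ =>
  fderiv ℂ (rep fun g => φ (g, ξ.2)) (coord ξ.1)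
      (coordMat fun p => jetMatrix (c p) (k p) (D.U (win a b ξ.2)) * ξ.1.mat p) +
    ∑ᶠ l : ℤ, deriv (fun s : ℂ => φ (ξ.1, Function.update ξ.2 l s)) (ξ.2 l) *
      F.eval (shiftSeq l ξ.2)

variable {H : Subgroup (LieG d c k)}

/-- A function on (a subset `Y` of) `G/H` that is invariant under the left action of `H_n`. -/
def LeftInvariant (n : ℕ) (z : LieG d c k ⧸ H → ℂ) (Y : Set (LieG d c k ⧸ H)) : Prop :=
  ∀ h ∈ D.hgroup n, ∀ x ∈ Y, (rho h : LieG d c k) • x ∈ Y → z ((rho h : LieG d c k) • x) = z x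

/-- `z` as an `H`-right-invariant function of `w^{pq}_{ij}`. -/
def pull (z : LieG d c k ⧸ H → ℂ) : Pt d c k → ℂ := fun ξ => z (ξ.1 : LieG d c k ⧸ H)

/-- `z_j = S^j(z)`, `j ∈ ℤ`. -/
def zz (z : LieG d c k ⧸ H → ℂ) (j : ℤ) : Pt d c k → ℂ := shiftFn D j (pull z)

/-- All the values `z_j`, `j ∈ ℤ`, at a point. -/
def zSeq (z : LieG d c k ⧸ H → ℂ) (ξ : Pt d c k) : ℤ → ℂ := fun j => zz D z j ξ

/-- `z_j` is defined at the point `ξ`. -/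
def ZDefinedAt (Y : Set (LieG d c k ⧸ H)) (j : ℤ) (ξ : Pt d c k) : Prop :=
  (((shiftPt D ^ j) ξ).1 : LieG d c k ⧸ H) ∈ Y

/-- `z_0, …, z_{r-1}` are defined at `ξ = (g, u)`, and their differentials as functions on `G` are
linearly independent at `g`. For an `H_{r-1}`-left-invariant `z` these functions do not depend on
`u`. When `H` has codimension `r`, this says that they are local coordinates on `G/H` around
`gH`. -/
def LocalCoordsAt (z : LieG d c k ⧸ H → ℂ) (Y : Set (LieG d c k ⧸ H)) (r : ℕ)
    (ξ : Pt d c k) : Prop :=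
  (∀ j : Fin r, ZDefinedAt D Y (j : ℕ) ξ) ∧
    LinearIndependent ℂ fun j : Fin r =>
      fderiv ℂ (rep fun g => zz D z (j : ℕ) (g, ξ.2)) (coord ξ.1)

/-- `z, S(z), …, S^{r-1}(z)` form a system of local coordinates almost everywhere on `G/H`. -/
def LocalCoordsAE (z : LieG d c k ⧸ H → ℂ) (Y : Set (LieG d c k ⧸ H)) (r : ℕ) : Prop :=
  ∃ 𝒴 : Set (LieG d c k ⧸ H), IsOpen 𝒴 ∧ Dense 𝒴 ∧
    ∀ g : LieG d c k, (g : LieG d c k ⧸ H) ∈ 𝒴 →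
      ∃ u : ℤ → ℂ, (∀ l, u l ∈ D.uDom) ∧ LocalCoordsAt D z Y r (g, u)

/-- The partial derivative `∂/∂u` of `S^r(z)`, `u = u_0`. -/
def dzdu (z : LieG d c k ⧸ H → ℂ) (r : ℕ) (ξ : Pt d c k) : ℂ :=
  deriv (fun s : ℂ => zz D z r (ξ.1, Function.update ξ.2 0 s)) (ξ.2 0)

variable {r : ℕ}

/-- Around `ξ` one has `S^r(z) = Fz(z_0, …, z_{r-1}, u)`. -/
def ShiftGivenBy (z : LieG d c k ⧸ H → ℂ) (Fz : AnalyticFn (Win 0 (r - 1) × ℂ))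
    (ξ : Pt d c k) : Prop :=
  ∀ᶠ η in 𝓝 ξ, (win 0 (r - 1) (zSeq D z η), η.2 0) ∈ Fz.dom ∧
    zz D z r η = Fz.toFun (win 0 (r - 1) (zSeq D z η), η.2 0)

/-- Around `ξ` one has `D_t(z) = Q(z_0, …, z_{r-1}, u_a, …, u_b)`. -/
def DerivGivenBy (z : LieG d c k ⧸ H → ℂ) (Q : AnalyticFn (Win 0 (r - 1) × Win a b))
    (ξ : Pt d c k) : Prop :=
  ∀ᶠ η in 𝓝 ξ, (win 0 (r - 1) (zSeq D z η), win a b η.2) ∈ Q.dom ∧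
    totalDt D (pull z) η = Q.toFun (win 0 (r - 1) (zSeq D z η), win a b η.2)

/-- Around the values of `(z_0, …, z_{r-1}, u)` at `ξ`, the function `f` solves the equation
`z_r = Fz(z_0, …, z_{r-1}, u)` for `u`: one has `f(z_0, …, z_{r-1}, Fz(z_0, …, z_{r-1}, u)) = u`. -/
def SolvesAt (z : LieG d c k ⧸ H → ℂ) (Fz : AnalyticFn (Win 0 (r - 1) × ℂ)) (f : LatticeFn 0 r)
    (ξ : Pt d c k) : Prop :=
  ∀ᶠ x in 𝓝 (zSeq D z ξ, ξ.2 0),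
    f.DefinedAt (Function.update x.1 r (Fz.toFun (win 0 (r - 1) x.1, x.2))) ∧
      f.eval (Function.update x.1 r (Fz.toFun (win 0 (r - 1) x.1, x.2))) = x.2

/-- The local expressions `Fz`, `Q`, `f` are valid around the point `ξ`, at which `z_0, …, z_{r-1}`
are local coordinates, and the lattice equation and its representation are defined there. -/
structure ExpressionsAt (z : LieG d c k ⧸ H → ℂ) (Y : Set (LieG d c k ⧸ H))
    (Fz : AnalyticFn (Win 0 (r - 1) × ℂ)) (Q : AnalyticFn (Win 0 (r - 1) × Win a b))
    (f : LatticeFn 0 r) (ξ : Pt d c k) : Prop where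
  localCoords : LocalCoordsAt D z Y r ξ
  zDefined : ZDefinedAt D Y r ξ
  eqnDefined : F.DefinedAt ξ.2
  domU : win a b ξ.2 ∈ D.domU
  shift : ShiftGivenBy D z Fz ξ
  deriv : DerivGivenBy D z Q ξ
  solves : SolvesAt D z Fz f ξ

end Operators

end Miura

end

/-!
In the coordinates `w`, the group `G` is an open subset of a finite-dimensional algebra, the left
and right multiplications are linear, and `S^j` is the transformation
`(g, u) ↦ (ρ(M(u_{j-1}) ⋯ M(u_0)) g, u_{· + j})` for `j ≥ 0`.

*Independence of `u`.* For two sequences `u`, `u'` of values the quotient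
`M(u'_{j-1}) ⋯ M(u'_0) (M(u_{j-1}) ⋯ M(u_0))⁻¹` belongs to `H_j` (`prodM_mul_inv_mem_hgroup`). So
for `j < r` the `H_{r-1}`-invariance of `z` makes `z_j` a function on `G/H` (`zz_eq_of_mk_eq`).

*Local expressions.* Let `K` be the tangent space of `H` at `1`. An `H`-right-invariant analytic
function has at `g` a differential that vanishes on `gK`, and `K` has codimension `r`
(`IsTangent`). Where `z_0, …, z_{r-1}` have independent differentials, the common kernel of these
is therefore exactly `gK`, and any other `H`-right-invariant function is constant along the fibres
of the submersion `(z_0, …, z_{r-1})`: it factors through it analytically, also in the presence of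
parameters (`exists_eq_comp_submersion`, `LocalCoordsAt.exists_analyticFn`). Both `z_r` and
`D_t(z)` are `H`-right-invariant and depend on `u`, respectively `u_a, …, u_b`, as parameters; this
gives `F` and `Q`, and the inverse function theorem gives `f`.

*The Miura-type transformation.* The relation `D_t(M) = S(U) M - M U` says that `D_t` commutes with
the shift of points, whence `D_t(z_j) = S^j(D_t(z)) = S^j(P)` at `v = (z_j)`. Applying `D_t` to
`f(z_0, …, z_r) = u` yields the required identity at all values `v_j = z_j(ξ)`
(`sum_totalDt_mul_deriv`, `exists_isMiuraOn`). Every sequence close to `(z_j(ξ))` agrees on the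
finite range of indices in question with the sequence of values at some point: `z_0, …, z_{r-1}`
can be prescribed by the choice of `g`, and the further `z_j` one by one by the choice of the `u_l`
(`exists_lift`).

*Density.* `G × 𝒟` is connected, so an analytic function of `(g, u_0)` that is nonzero at one point
is nonzero on an open dense set. The condition `∂z_r/∂u ≠ 0` is brought into this form by expressing
it through the vector `g⁻¹ ρ(M)⁻¹ ρ(∂M/∂u) g`, which must not lie in `K`
(`dzdu_ne_zero`, `generic_logVelM_notMem`). Generically, moreover, the values of the `z_j` for
distinct `j` are distinct (`generic_zz_ne`), so the local expressions around finitely many shifts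
of a point, which have `z` among their arguments, can be glued to functions with disconnected
domains (`exists_expressionsAt`).
-/

noncomputable section

namespace Miura

/-! ### The coordinates on the matrix jet algebra -/

section JetRing

variable {c : ℂ} {k : ℕ}

theorem jetCoeff_mk (q : Fin k) (P : ℂ[X]) :
    jetCoeff q (Ideal.Quotient.mk (Ideal.span {(X - C c) ^ k}) P) = (taylor c P).coeff q := rfl

theorem jetCoeff_add (q : Fin k) (x y : JetRing c k) :
    jetCoeff q (x + y) = jetCoeff q x + jetCoeff q y := by
  obtain ⟨P, rfl⟩ := Ideal.Quotient.mk_surjective x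
  obtain ⟨R, rfl⟩ := Ideal.Quotient.mk_surjective y
  rw [← map_add, jetCoeff_mk, jetCoeff_mk, jetCoeff_mk, map_add, coeff_add]

theorem jetCoeff_smul (q : Fin k) (s : ℂ) (x : JetRing c k) :
    jetCoeff q (s • x) = s * jetCoeff q x := by
  obtain ⟨P, rfl⟩ := Ideal.Quotient.mk_surjective x
  have h : s • Ideal.Quotient.mk (Ideal.span {(X - C c) ^ k}) P
      = Ideal.Quotient.mk (Ideal.span {(X - C c) ^ k}) (s • P) := rfl
  rw [h, jetCoeff_mk, jetCoeff_mk, map_smul, coeff_smul, smul_eq_mul]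

/-- The coefficients of `(λ - c)^q`, `q < k`, determine an element of `ℂ[λ]/((λ - c)^k)`. -/
theorem jet_ext {x y : JetRing c k} (h : ∀ q, jetCoeff q x = jetCoeff q y) : x = y := by
  obtain ⟨P, rfl⟩ := Ideal.Quotient.mk_surjective x
  obtain ⟨R, rfl⟩ := Ideal.Quotient.mk_surjective y
  rw [Ideal.Quotient.eq, Ideal.mem_span_singleton]
  have h1 : X ^ k ∣ taylor c (P - R) := by
    rw [X_pow_dvd_iff]
    intro q hq
    have := h ⟨q, hq⟩
    rw [jetCoeff_mk, jetCoeff_mk] at this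
    rw [map_sub, coeff_sub, this, sub_self]
  obtain ⟨S, hS⟩ := h1
  refine ⟨taylor (-c) S, taylor_injective c ?_⟩
  rw [hS, taylor_mul, taylor_pow, taylor_taylor]
  simp

theorem jetCoeff_taylorPoly (q : Fin k) (f : ℂ → ℂ) :
    jetCoeff q (Ideal.Quotient.mk (Ideal.span {(X - C c) ^ k}) (taylorPoly c k f))
      = iteratedDeriv q f c / (q : ℕ).factorial := by
  rw [jetCoeff_mk, taylorPoly, map_sum]
  simp only [taylor_mul, taylor_pow, taylor_C, map_sub, taylor_X, add_sub_cancel_right,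
    finsetSum_coeff, coeff_C_mul, coeff_X_pow]
  rw [Finset.sum_eq_single (q : ℕ)]
  · simp
  · intro b _ hb
    simp [hb.symm]
  · intro h
    simp at h

theorem jetCoeff_surjective (x : Fin k → ℂ) : ∃ y : JetRing c k, ∀ q, jetCoeff q y = x q := by
  refine ⟨Ideal.Quotient.mk _ (∑ q : Fin k, C (x q) * (X - C c) ^ (q : ℕ)), fun q => ?_⟩
  rw [jetCoeff_mk, map_sum]
  simp only [taylor_mul, taylor_pow, taylor_C, map_sub, taylor_X, add_sub_cancel_right,
    finsetSum_coeff, coeff_C_mul, coeff_X_pow]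
  rw [Finset.sum_eq_single q]
  · simp
  · intro b _ hb
    simp [Fin.ext_iff.not.1 hb.symm]
  · simp

/-- The Leibniz rule: Taylor expansion is multiplicative. -/
theorem mk_taylorPoly_mul {f g : ℂ → ℂ} (hf : AnalyticAt ℂ f c) (hg : AnalyticAt ℂ g c) :
    Ideal.Quotient.mk (Ideal.span {(X - C c) ^ k}) (taylorPoly c k (fun x => f x * g x)) =
      Ideal.Quotient.mk _ (taylorPoly c k f) * Ideal.Quotient.mk _ (taylorPoly c k g) := by
  apply jet_ext
  intro q
  have key : ∀ (φ : ℂ → ℂ) (j : ℕ), j ≤ q → (taylor c (taylorPoly c k φ)).coeff j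
      = iteratedDeriv j φ c / j.factorial := fun φ j hj => by
    have := jetCoeff_taylorPoly (c := c) (k := k) ⟨j, hj.trans_lt q.2⟩ φ
    rwa [jetCoeff_mk] at this
  rw [jetCoeff_taylorPoly, ← map_mul, jetCoeff_mk, taylor_mul, coeff_mul,
    Finset.Nat.sum_antidiagonal_eq_sum_range_succ_mk,
    iteratedDeriv_fun_mul hf.contDiffAt hg.contDiffAt, Finset.sum_div]
  refine Finset.sum_congr rfl fun i hi => ?_
  have hi' : i ≤ q := by simpa [Nat.lt_succ_iff] using hi
  rw [key f i hi', key g (q - i) (Nat.sub_le _ _), Nat.cast_choose ℂ hi']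
  have h1 : ((i.factorial : ℕ) : ℂ) ≠ 0 := by exact_mod_cast i.factorial_ne_zero
  have h2 : (((q - i : ℕ).factorial : ℕ) : ℂ) ≠ 0 := by
    exact_mod_cast (q - i : ℕ).factorial_ne_zero
  have h3 : (((q : ℕ).factorial : ℕ) : ℂ) ≠ 0 := by exact_mod_cast (q : ℕ).factorial_ne_zero
  field_simp

theorem mk_taylorPoly_sum {ι : Type*} (s : Finset ι) {f : ι → ℂ → ℂ}
    (hf : ∀ i ∈ s, AnalyticAt ℂ (f i) c) :
    Ideal.Quotient.mk (Ideal.span {(X - C c) ^ k}) (taylorPoly c k (fun x => ∑ i ∈ s, f i x)) =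
      ∑ i ∈ s, Ideal.Quotient.mk _ (taylorPoly c k (f i)) := by
  rw [← map_sum]
  apply jet_ext
  intro q
  rw [jetCoeff_taylorPoly, jetCoeff_mk, map_sum, finsetSum_coeff,
    iteratedDeriv_fun_sum fun i hi => (hf i hi).contDiffAt, Finset.sum_div]
  refine Finset.sum_congr rfl fun i _ => ?_
  rw [← jetCoeff_taylorPoly (c := c), jetCoeff_mk]

end JetRing

section Coordinates

variable {d m : ℕ} {c : Fin m → ℂ} {k : Fin m → ℕ}

/-- The algebra `∏_p Mat_d(ℂ[λ]/((λ - c_p)^{k_p}))`, whose group of units is `G`. -/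
abbrev JetAlg (d : ℕ) {m : ℕ} (c : Fin m → ℂ) (k : Fin m → ℕ) : Type :=
  (p : Fin m) → Matrix (Fin d) (Fin d) (JetRing (c p) (k p))

/-- The coordinates `w^{pq}_{ij}` as a linear isomorphism. -/
def coordEquiv (d : ℕ) {m : ℕ} (c : Fin m → ℂ) (k : Fin m → ℕ) :
    JetAlg d c k ≃ₗ[ℂ] Coord d k :=
  LinearEquiv.ofBijective
    { toFun := coordMat
      map_add' := fun A B => by
        funext x; simp [coordMat, jetCoeff_add]
      map_smul' := fun s A => by
        funext x; simp [coordMat, jetCoeff_smul] }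
    ⟨fun A B h => by
      funext p; ext i j
      exact jet_ext fun q => congrFun h ⟨p, q, i, j⟩,
    fun w => by
      choose y hy using fun (p : Fin m) (i j : Fin d) =>
        jetCoeff_surjective (c := c p) (k := k p) fun q => w ⟨p, q, i, j⟩
      refine ⟨fun p => Matrix.of fun i j => y p i j, ?_⟩
      funext ⟨p, q, i, j⟩
      exact hy p i j q⟩

/-- The multiplication of the algebra `∏_p Mat_d(ℂ[λ]/((λ - c_p)^{k_p}))` in the coordinates
`w^{pq}_{ij}`, as a continuous bilinear map. -/
def mulV (d : ℕ) {m : ℕ} (c : Fin m → ℂ) (k : Fin m → ℕ) :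
    Coord d k →L[ℂ] Coord d k →L[ℂ] Coord d k :=
  LinearMap.toContinuousBilinearMap
    (((LinearMap.mul ℂ (JetAlg d c k)).compr₂ (coordEquiv d c k).toLinearMap).compl₁₂
      (coordEquiv d c k).symm.toLinearMap (coordEquiv d c k).symm.toLinearMap)

theorem mulV_coordMat (A B : JetAlg d c k) :
    mulV d c k (coordMat A) (coordMat B) = coordMat (A * B) := by
  have : mulV d c k (coordEquiv d c k A) (coordEquiv d c k B) = coordEquiv d c k (A * B) := by
    simp [mulV]
  exact this

theorem coordMat_surjective (w : Coord d k) : ∃ A : JetAlg d c k, coordMat A = w :=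
  (coordEquiv d c k).surjective w

theorem coordMat_injective : Function.Injective (coordMat : JetAlg d c k → Coord d k) :=
  (coordEquiv d c k).injective

theorem mulV_assoc (w₁ w₂ w₃ : Coord d k) :
    mulV d c k (mulV d c k w₁ w₂) w₃ = mulV d c k w₁ (mulV d c k w₂ w₃) := by
  obtain ⟨A, rfl⟩ := coordMat_surjective (c := c) w₁
  obtain ⟨B, rfl⟩ := coordMat_surjective (c := c) w₂
  obtain ⟨E, rfl⟩ := coordMat_surjective (c := c) w₃
  simp only [mulV_coordMat, mul_assoc]

theorem coord_mul (g h : LieG d c k) : coord (g * h) = mulV d c k (coord g) (coord h) := by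
  rw [coord, coord, coord, mulV_coordMat]; rfl

theorem coord_one_mulV (w : Coord d k) : mulV d c k (coord (1 : LieG d c k)) w = w := by
  obtain ⟨A, rfl⟩ := coordMat_surjective (c := c) w
  have : (1 : LieG d c k).mat = (1 : JetAlg d c k) := rfl
  rw [coord, mulV_coordMat, this, one_mul]

theorem mulV_coord_one (w : Coord d k) : mulV d c k w (coord (1 : LieG d c k)) = w := by
  obtain ⟨A, rfl⟩ := coordMat_surjective (c := c) w
  have : (1 : LieG d c k).mat = (1 : JetAlg d c k) := rfl
  rw [coord, mulV_coordMat, this, mul_one]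

theorem coord_injective : Function.Injective (coord : LieG d c k → Coord d k) := by
  intro g h hgh
  have := coordMat_injective hgh
  funext p
  exact Units.ext (congrFun this p)

theorem coord_inv_mulV (g : LieG d c k) (w : Coord d k) :
    mulV d c k (coord g⁻¹) (mulV d c k (coord g) w) = w := by
  rw [← mulV_assoc, ← coord_mul, inv_mul_cancel, coord_one_mulV]

theorem coord_mulV_inv (g : LieG d c k) (w : Coord d k) :
    mulV d c k (coord g) (mulV d c k (coord g⁻¹) w) = w := by
  rw [← mulV_assoc, ← coord_mul, mul_inv_cancel, coord_one_mulV]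

/-- The elements of `G` are the points of `Coord d k` whose left multiplication is invertible. -/
theorem mem_range_coord_iff (w : Coord d k) :
    w ∈ Set.range (coord : LieG d c k → Coord d k) ↔ IsUnit (mulV d c k w) := by
  constructor
  · rintro ⟨g, rfl⟩
    exact ⟨⟨mulV d c k (coord g), mulV d c k (coord g⁻¹),
      by ext1 w; exact coord_mulV_inv g w, by ext1 w; exact coord_inv_mulV g w⟩, rfl⟩
  · rintro ⟨L, hL⟩
    obtain ⟨A, rfl⟩ := coordMat_surjective (c := c) w
    obtain ⟨B, hB⟩ := coordMat_surjective (c := c) ((L⁻¹).val (coordMat (1 : JetAlg d c k)))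
    have h1 : A * B = 1 := by
      apply coordMat_injective
      rw [← mulV_coordMat, hB, ← hL]
      exact congrArg (fun T : Coord d k →L[ℂ] Coord d k => T (coordMat (1 : JetAlg d c k)))
        L.mul_inv
    -- left multiplication by `A` is injective, and it takes `B * A` and `1` to the same element
    have h2 : B * A = 1 := by
      apply coordMat_injective
      have h3 : mulV d c k (coordMat A) (coordMat (B * A)) = mulV d c k (coordMat A)
          (coordMat (1 : JetAlg d c k)) := by
        rw [mulV_coordMat, mulV_coordMat, ← mul_assoc, h1, one_mul, mul_one]
      rw [← hL] at h3
      have h4 := congrArg (L⁻¹).val h3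
      have h5 : ∀ x, (L⁻¹).val (L.val x) = x := fun x =>
        congrArg (fun T : Coord d k →L[ℂ] Coord d k => T x) L.inv_mul
      rwa [h5, h5] at h4
    exact ⟨fun p => ⟨A p, B p, congrFun h1 p, congrFun h2 p⟩, rfl⟩

theorem isOpen_range_coord : IsOpen (Set.range (coord : LieG d c k → Coord d k)) := by
  have : Set.range (coord : LieG d c k → Coord d k) = mulV d c k ⁻¹' {L | IsUnit L} := by
    ext w; exact mem_range_coord_iff w
  rw [this]
  exact Units.isOpen.preimage (mulV d c k).continuous

theorem isOpenEmbedding_coord : IsOpenEmbedding (coord : LieG d c k → Coord d k) :=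
  ⟨⟨⟨rfl⟩, coord_injective⟩, isOpen_range_coord⟩

theorem continuous_coord : Continuous (coord : LieG d c k → Coord d k) :=
  isOpenEmbedding_coord.continuous

theorem coord_inv (g : LieG d c k) :
    coord g⁻¹ = Ring.inverse (mulV d c k (coord g)) (coord (1 : LieG d c k)) := by
  have h : Ring.inverse (mulV d c k (coord g)) = mulV d c k (coord g⁻¹) := by
    have := Ring.inverse_unit (⟨mulV d c k (coord g), mulV d c k (coord g⁻¹),
      by ext1 w; exact coord_mulV_inv g w, by ext1 w; exact coord_inv_mulV g w⟩ :
      (Coord d k →L[ℂ] Coord d k)ˣ)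
    exact this
  rw [h, mulV_coord_one]

/-- The inversion of `G` in coordinates. -/
def invV (d : ℕ) {m : ℕ} (c : Fin m → ℂ) (k : Fin m → ℕ) (w : Coord d k) : Coord d k :=
  Ring.inverse (mulV d c k w) (coord (1 : LieG d c k))

theorem analyticAt_invV (g : LieG d c k) : AnalyticAt ℂ (invV d c k) (coord g) := by
  obtain ⟨L, hL⟩ := (mem_range_coord_iff (c := c) (coord g)).1 ⟨g, rfl⟩
  have h1 : AnalyticAt ℂ (fun w => Ring.inverse (mulV d c k w)) (coord g) := by
    refine AnalyticAt.fun_comp (g := Ring.inverse) ?_ ((mulV d c k).analyticAt _)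
    rw [← hL]
    exact analyticAt_inverse L
  exact ((ContinuousLinearMap.apply ℂ (Coord d k)
    (coord (1 : LieG d c k))).analyticAt _).fun_comp h1

instance : IsTopologicalGroup (LieG d c k) where
  continuous_mul := by
    rw [isOpenEmbedding_coord.isInducing.continuous_iff]
    have : (coord ∘ fun p : LieG d c k × LieG d c k => p.1 * p.2)
        = fun p => mulV d c k (coord p.1) (coord p.2) := by
      funext p; exact coord_mul _ _
    rw [this]
    have h1 := continuous_coord (d := d) (c := c) (k := k)
    fun_prop
  continuous_inv := by
    rw [isOpenEmbedding_coord.isInducing.continuous_iff, continuous_iff_continuousAt]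
    intro g
    have : (coord ∘ fun g : LieG d c k => g⁻¹) = fun g => invV d c k (coord g) := by
      funext g; exact coord_inv g
    rw [this]
    exact (analyticAt_invV g).continuousAt.comp continuous_coord.continuousAt

theorem rep_coord (φ : LieG d c k → ℂ) (g : LieG d c k) : rep φ (coord g) = φ g :=
  coord_injective.extend_apply _ _ _

theorem eventually_nhds_coord {g : LieG d c k} {P : Coord d k → Prop} :
    (∀ᶠ w in 𝓝 (coord g), P w) ↔ ∀ᶠ g' in 𝓝 g, P (coord g') := by
  rw [← isOpenEmbedding_coord.map_nhds_eq g, Filter.eventually_map]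

theorem rep_congr {φ ψ : LieG d c k → ℂ} {g : LieG d c k} (h : φ =ᶠ[𝓝 g] ψ) :
    rep φ =ᶠ[𝓝 (coord g)] rep ψ := by
  refine eventually_nhds_coord.2 ?_
  filter_upwards [h] with g' hg'
  rw [rep_coord, rep_coord, hg']

end Coordinates

/-! ### Connectedness of the group -/

section Connected

variable {d m : ℕ} {c : Fin m → ℂ} {k : Fin m → ℕ}

theorem mem_range_coord_iff_det (w : Coord d k) :
    w ∈ Set.range (coord : LieG d c k → Coord d k) ↔
      LinearMap.det (mulV d c k w).toLinearMap ≠ 0 := by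
  rw [mem_range_coord_iff, ← isUnit_iff_ne_zero, ← LinearMap.isUnit_iff_isUnit_det,
    ← MulEquiv.isUnit_map (Module.End.toContinuousLinearMap (Coord d k))]
  rfl

/-- On a complex line, all but finitely many points belong to an open set given by the
non-vanishing of a determinant, so any two points of `G` are joined inside such a line. -/
theorem isPreconnected_range_coord :
    IsPreconnected (Set.range (coord : LieG d c k → Coord d k)) := by
  refine isPreconnected_of_forall_pair fun w₀ h₀ w₁ h₁ => ?_
  let b := Module.finBasis ℂ (Coord d k)
  set A : Matrix _ _ ℂ := LinearMap.toMatrix b b (mulV d c k w₀).toLinearMap with hA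
  set B : Matrix _ _ ℂ := LinearMap.toMatrix b b (mulV d c k (w₁ - w₀)).toLinearMap with hB
  set p : ℂ[X] := (A.map ⇑(C : ℂ →+* ℂ[X]) + (X : ℂ[X]) • B.map ⇑(C : ℂ →+* ℂ[X])).det with hp
  have hev : ∀ s : ℂ, p.eval s = LinearMap.det (mulV d c k (w₀ + s • (w₁ - w₀))).toLinearMap := by
    intro s
    rw [← LinearMap.det_toMatrix b, hp]
    have := RingHom.map_det (evalRingHom s)
      (A.map ⇑(C : ℂ →+* ℂ[X]) + (X : ℂ[X]) • B.map ⇑(C : ℂ →+* ℂ[X]))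
    rw [coe_evalRingHom] at this
    rw [this]
    congr 1
    ext i j
    simp [hA, hB, LinearMap.toMatrix_apply]
  have hmem : ∀ s : ℂ, w₀ + s • (w₁ - w₀) ∈ Set.range (coord : LieG d c k → Coord d k) ↔
      p.eval s ≠ 0 := fun s => by rw [mem_range_coord_iff_det, hev]
  have hp0 : p.eval 0 ≠ 0 := by rw [← hmem]; simpa using h₀
  have hp1 : p.eval 1 ≠ 0 := by rw [← hmem]; simpa using h₁
  have hpne : p ≠ 0 := by rintro h; simp [h] at hp0
  have hfin : {s : ℂ | p.eval s = 0}.Finite :=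
    (p.roots.toFinset.finite_toSet).subset fun s hs => by simpa [hpne] using hs
  have hconn : IsPathConnected {s : ℂ | p.eval s = 0}ᶜ :=
    Set.Countable.isPathConnected_compl_of_one_lt_rank
      (by rw [Complex.rank_real_complex]; exact Nat.one_lt_ofNat) hfin.countable
  refine ⟨(fun s : ℂ => w₀ + s • (w₁ - w₀)) '' {s : ℂ | p.eval s = 0}ᶜ, ?_, ⟨0, hp0, by simp⟩,
    ⟨1, hp1, by simp⟩, ?_⟩
  · rintro _ ⟨s, hs, rfl⟩
    exact (hmem s).2 hs
  · exact hconn.isConnected.isPreconnected.image _ (by fun_prop)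

end Connected

/-! ### Taylor coefficients of functions depending analytically on parameters -/

section Parameters

variable {E : Type*} [NormedAddCommGroup E] [NormedSpace ℂ E]

/-- The derivative in a constant direction, as an operator on functions. -/
def dirDeriv (v : E) (f : E → ℂ) : E → ℂ := fun y => fderiv ℂ f y v

theorem analyticAt_dirDeriv {v : E} {f : E → ℂ} {y : E} (hf : AnalyticAt ℂ f y) :
    AnalyticAt ℂ (dirDeriv v f) y :=
  ((ContinuousLinearMap.apply ℂ ℂ v).analyticAt _).fun_comp hf.fderiv

theorem analyticAt_dirDeriv_iterate {v : E} {f : E → ℂ} {y : E} (hf : AnalyticAt ℂ f y) (n : ℕ) :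
    AnalyticAt ℂ ((dirDeriv v)^[n] f) y := by
  induction n with
  | zero => exact hf
  | succ n ih => rw [Function.iterate_succ_apply']; exact analyticAt_dirDeriv ih

theorem dirDeriv_congr {v : E} {f g : E → ℂ} {y : E} (h : f =ᶠ[𝓝 y] g) :
    dirDeriv v f y = dirDeriv v g y := by rw [dirDeriv, dirDeriv, h.fderiv_eq]

theorem dirDeriv_comm {v w : E} {f : E → ℂ} {y : E} (hf : AnalyticAt ℂ f y) :
    dirDeriv v (dirDeriv w f) y = dirDeriv w (dirDeriv v f) y := by
  have key : ∀ a b : E, dirDeriv a (dirDeriv b f) y = fderiv ℂ (fderiv ℂ f) y a b := by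
    intro a b
    have h1 : HasFDerivAt (fun x => fderiv ℂ f x) (fderiv ℂ (fderiv ℂ f) y) y :=
      hf.fderiv.differentiableAt.hasFDerivAt
    have h2 := h1.clm_apply (hasFDerivAt_const b y)
    have h3 : dirDeriv b f = fun x => fderiv ℂ f x b := rfl
    rw [dirDeriv, h3, h2.fderiv]
    simp
  rw [key, key]
  exact hf.contDiffAt.isSymmSndFDerivAt (n := ⊤) (by simp) v w

theorem dirDeriv_iterate_comm {v w : E} {f : E → ℂ} (n : ℕ) {y : E} (hf : AnalyticAt ℂ f y) :
    dirDeriv v ((dirDeriv w)^[n] f) y = (dirDeriv w)^[n] (dirDeriv v f) y := by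
  induction n generalizing y with
  | zero => rfl
  | succ n ih =>
    rw [Function.iterate_succ_apply', Function.iterate_succ_apply',
      dirDeriv_comm (analyticAt_dirDeriv_iterate hf n)]
    refine dirDeriv_congr ?_
    filter_upwards [hf.eventually_analyticAt] with x hx
    exact ih hx

theorem deriv_snd_eq_dirDeriv {f : E × ℂ → ℂ} {x : E} {s : ℂ} (hf : AnalyticAt ℂ f (x, s)) :
    deriv (fun t => f (x, t)) s = dirDeriv (0, 1) f (x, s) := by
  have h1 : HasDerivAt (fun t : ℂ => (x, t)) ((0 : E), (1 : ℂ)) s :=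
    (hasDerivAt_const s x).prodMk (hasDerivAt_id s)
  exact (hf.differentiableAt.hasFDerivAt.comp_hasDerivAt s h1).deriv

theorem deriv_fst_eq_dirDeriv {f : ℂ × ℂ → ℂ} {x s : ℂ} (hf : AnalyticAt ℂ f (x, s)) :
    HasDerivAt (fun t => f (t, s)) (dirDeriv (1, 0) f (x, s)) x := by
  have h1 : HasDerivAt (fun t : ℂ => (t, s)) ((1 : ℂ), (0 : ℂ)) x :=
    (hasDerivAt_id x).prodMk (hasDerivAt_const x s)
  exact hf.differentiableAt.hasFDerivAt.comp_hasDerivAt x h1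

theorem iteratedDeriv_snd_eq_dirDeriv {f : E × ℂ → ℂ} (n : ℕ) {x : E} {s : ℂ}
    (hf : AnalyticAt ℂ f (x, s)) :
    iteratedDeriv n (fun t => f (x, t)) s = (dirDeriv (0, 1))^[n] f (x, s) := by
  induction n generalizing s with
  | zero => simp
  | succ n ih =>
    rw [iteratedDeriv_succ, Function.iterate_succ_apply',
      ← deriv_snd_eq_dirDeriv (analyticAt_dirDeriv_iterate hf n)]
    refine Filter.EventuallyEq.deriv_eq ?_
    have h1 : Filter.Tendsto (fun t : ℂ => (x, t)) (𝓝 s) (𝓝 (x, s)) := by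
      have : Continuous fun t : ℂ => (x, t) := by fun_prop
      exact this.tendsto s
    filter_upwards [h1.eventually hf.eventually_analyticAt] with t ht
    exact ih ht

theorem analyticAt_iteratedDeriv_snd {f : E × ℂ → ℂ} (n : ℕ) {x : E} {s : ℂ}
    (hf : AnalyticAt ℂ f (x, s)) :
    AnalyticAt ℂ (fun y => iteratedDeriv n (fun t => f (y, t)) s) x := by
  have h1 : AnalyticAt ℂ (fun y : E => (dirDeriv (0, 1))^[n] f (y, s)) x :=
    AnalyticAt.fun_comp (g := (dirDeriv (0, 1))^[n] f) (f := fun y => (y, s))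
      (analyticAt_dirDeriv_iterate hf n) (by fun_prop)
  refine h1.congr ?_
  have h2 : Filter.Tendsto (fun y : E => (y, s)) (𝓝 x) (𝓝 (x, s)) := by
    have : Continuous fun y : E => (y, s) := by fun_prop
    exact this.tendsto x
  filter_upwards [h2.eventually hf.eventually_analyticAt] with y hy
  exact (iteratedDeriv_snd_eq_dirDeriv n hy).symm

/-- The derivative in the parameter commutes with the iterated derivative in `λ`. -/
theorem hasDerivAt_iteratedDeriv_snd {f : ℂ × ℂ → ℂ} (n : ℕ) {x s : ℂ}
    (hf : AnalyticAt ℂ f (x, s)) :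
    HasDerivAt (fun y => iteratedDeriv n (fun t => f (y, t)) s)
      (iteratedDeriv n (fun t => deriv (fun y => f (y, t)) x) s) x := by
  have h2 : Filter.Tendsto (fun y : ℂ => (y, s)) (𝓝 x) (𝓝 (x, s)) := by
    have : Continuous fun y : ℂ => (y, s) := by fun_prop
    exact this.tendsto x
  have h3 : Filter.Tendsto (fun t : ℂ => (x, t)) (𝓝 s) (𝓝 (x, s)) := by
    have : Continuous fun t : ℂ => (x, t) := by fun_prop
    exact this.tendsto s
  have e1 : iteratedDeriv n (fun t => deriv (fun y => f (y, t)) x) s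
      = dirDeriv (1, 0) ((dirDeriv (0, 1))^[n] f) (x, s) := by
    rw [dirDeriv_iterate_comm n hf,
      ← iteratedDeriv_snd_eq_dirDeriv n (analyticAt_dirDeriv hf)]
    refine (Filter.EventuallyEq.iteratedDeriv ?_ n).eq_of_nhds
    filter_upwards [h3.eventually hf.eventually_analyticAt] with t ht
    exact (deriv_fst_eq_dirDeriv ht).deriv
  rw [e1]
  refine (deriv_fst_eq_dirDeriv (analyticAt_dirDeriv_iterate hf n)).congr_of_eventuallyEq ?_
  filter_upwards [h2.eventually hf.eventually_analyticAt] with y hy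
  exact iteratedDeriv_snd_eq_dirDeriv n hy

end Parameters

/-! ### Taylor expansions of matrix functions of `λ` in coordinates -/

section Jets

variable {d m : ℕ} {c : Fin m → ℂ} {k : Fin m → ℕ}

/-- A matrix function of `λ` is analytic at the points `c_p`. -/
def MatAnalytic (c : Fin m → ℂ) (A : ℂ → Matrix (Fin d) (Fin d) ℂ) : Prop :=
  ∀ p i j, AnalyticAt ℂ (fun lam => A lam i j) (c p)

/-- The coordinates of the tuple of truncated Taylor expansions at the points `c_p`. -/
def jetV (c : Fin m → ℂ) (k : Fin m → ℕ) (A : ℂ → Matrix (Fin d) (Fin d) ℂ) : Coord d k :=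
  coordMat fun p => jetMatrix (c p) (k p) A

theorem jetV_apply (A : ℂ → Matrix (Fin d) (Fin d) ℂ) (x : Σ p : Fin m, Fin (k p) × Fin d × Fin d) :
    jetV c k A x =
      iteratedDeriv x.2.1 (fun lam => A lam x.2.2.1 x.2.2.2) (c x.1) / (x.2.1 : ℕ).factorial :=
  jetCoeff_taylorPoly x.2.1 _

theorem coord_rho (γ : ℂ → GL (Fin d) ℂ) :
    coord (rho γ : LieG d c k) = jetV c k fun lam => (γ lam : Matrix (Fin d) (Fin d) ℂ) := rfl

theorem jetV_mul {A B : ℂ → Matrix (Fin d) (Fin d) ℂ} (hA : MatAnalytic c A)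
    (hB : MatAnalytic c B) :
    jetV c k (fun lam => A lam * B lam) = mulV d c k (jetV c k A) (jetV c k B) := by
  rw [jetV, jetV, jetV, mulV_coordMat]
  congr 1
  funext p
  ext i j
  simp only [jetMatrix, Matrix.of_apply, Matrix.mul_apply, Pi.mul_apply]
  rw [mk_taylorPoly_sum _ fun l _ => (hA p i l).fun_mul (hB p l j)]
  exact Finset.sum_congr rfl fun l _ => mk_taylorPoly_mul (hA p i l) (hB p l j)

theorem jetV_congr {A B : ℂ → Matrix (Fin d) (Fin d) ℂ} (h : ∀ p, A =ᶠ[𝓝 (c p)] B) :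
    jetV c k A = jetV c k B := by
  funext x
  rw [jetV_apply, jetV_apply]
  congr 1
  refine (Filter.EventuallyEq.iteratedDeriv ?_ _).eq_of_nhds
  filter_upwards [h x.1] with lam hlam
  rw [hlam]

theorem jetV_sub {A B : ℂ → Matrix (Fin d) (Fin d) ℂ} (hA : MatAnalytic c A)
    (hB : MatAnalytic c B) : jetV c k (fun lam => A lam - B lam) = jetV c k A - jetV c k B := by
  funext x
  simp only [Pi.sub_apply, jetV_apply, Matrix.sub_apply]
  rw [iteratedDeriv_fun_sub (hA _ _ _).contDiffAt (hB _ _ _).contDiffAt, sub_div]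

theorem jetV_smul (s : ℂ) (A : ℂ → Matrix (Fin d) (Fin d) ℂ) :
    jetV c k (fun lam => s • A lam) = s • jetV c k A := by
  funext x
  simp only [Pi.smul_apply, jetV_apply, Matrix.smul_apply, smul_eq_mul]
  rw [iteratedDeriv_const_mul_field, mul_div_assoc]

theorem MatAnalytic.mul {A B : ℂ → Matrix (Fin d) (Fin d) ℂ} (hA : MatAnalytic c A)
    (hB : MatAnalytic c B) : MatAnalytic c fun lam => A lam * B lam := by
  intro p i j
  simp only [Matrix.mul_apply]
  exact Finset.analyticAt_fun_sum _ fun l _ => (hA p i l).fun_mul (hB p l j)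

theorem analyticAt_det {E : Type*} [NormedAddCommGroup E] [NormedSpace ℂ E]
    {ι : Type*} [Fintype ι] [DecidableEq ι] {A : E → Matrix ι ι ℂ}
    {x : E} (hA : ∀ i j, AnalyticAt ℂ (fun y => A y i j) x) :
    AnalyticAt ℂ (fun y => (A y).det) x := by
  simp only [Matrix.det_apply]
  refine Finset.analyticAt_fun_sum _ fun σ _ => ?_
  have h := Finset.analyticAt_fun_prod (𝕜 := ℂ) (c := x) (Finset.univ : Finset ι)
    (f := fun i y => A y (σ i) i) fun i _ => hA _ _
  rcases Int.units_eq_one_or (Equiv.Perm.sign σ) with hs | hs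
  · simpa [hs] using h
  · simpa [hs] using h.fun_neg

theorem MatAnalytic.inv {γ : ℂ → GL (Fin d) ℂ}
    (h : MatAnalytic c fun lam => (γ lam : Matrix (Fin d) (Fin d) ℂ)) :
    MatAnalytic c fun lam => (((γ lam)⁻¹ : GL (Fin d) ℂ) : Matrix (Fin d) (Fin d) ℂ) := by
  intro p i j
  simp only [Matrix.coe_units_inv, Matrix.inv_def, Matrix.smul_apply, Ring.inverse_eq_inv',
    smul_eq_mul, Matrix.adjugate_apply]
  refine AnalyticAt.fun_mul (AnalyticAt.fun_inv (analyticAt_det (h p)) ?_) (analyticAt_det ?_)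
  · exact ((Matrix.isUnit_iff_isUnit_det _).1 (γ (c p)).isUnit).ne_zero
  · intro a b
    by_cases hab : a = j
    · subst hab
      simp only [Matrix.updateRow_self]
      exact analyticAt_const
    · simp only [Matrix.updateRow_ne hab]
      exact h p a b

theorem rho_mul {γ δ : ℂ → GL (Fin d) ℂ}
    (hγ : MatAnalytic c fun lam => (γ lam : Matrix (Fin d) (Fin d) ℂ))
    (hδ : MatAnalytic c fun lam => (δ lam : Matrix (Fin d) (Fin d) ℂ)) :
    (rho (γ * δ) : LieG d c k) = rho γ * rho δ := by
  apply coord_injective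
  rw [coord_mul, coord_rho, coord_rho, coord_rho, ← jetV_mul hγ hδ]
  rfl

theorem rho_one : (rho (1 : ℂ → GL (Fin d) ℂ) : LieG d c k) = 1 := by
  have hone : MatAnalytic c fun lam =>
      (((1 : ℂ → GL (Fin d) ℂ) lam : GL (Fin d) ℂ) : Matrix (Fin d) (Fin d) ℂ) :=
    fun p i j => analyticAt_const
  have := rho_mul (k := k) hone hone
  rw [mul_one] at this
  exact (mul_eq_left.1 this.symm)

end Jets

/-! ### Functions constant along the fibres of a submersion -/

section Submersion

variable {V T P : Type*} [NormedAddCommGroup V] [NormedSpace ℂ V] [FiniteDimensional ℂ V]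
  [NormedAddCommGroup T] [NormedSpace ℂ T]
  [NormedAddCommGroup P] [NormedSpace ℂ P]

/-- Straightening of an analytic submersion: a local chart whose first component is the
submersion. -/
theorem exists_straightening {Z : V → T} {w₀ : V} (hZ : AnalyticAt ℂ Z w₀)
    (hs : Function.Surjective (fderiv ℂ Z w₀)) :
    ∃ (K : Submodule ℂ V) (e : OpenPartialHomeomorph V (T × K)), w₀ ∈ e.source ∧
      e w₀ = (Z w₀, 0) ∧ (∀ w, (e w).1 = Z w) ∧ AnalyticAt ℂ e.symm (Z w₀, 0) := by
  have := FiniteDimensional.complete ℂ V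
  set L := fderiv ℂ Z w₀ with hL
  obtain ⟨π, hπ⟩ := LinearMap.exists_leftInverse_of_injective (L.toLinearMap.ker).subtype
    (Submodule.ker_subtype _)
  have hπ' : ∀ x : L.toLinearMap.ker, π x = x := fun x => LinearMap.congr_fun hπ x
  -- the chart is `(Z, π)` with `π` a linear projection to the kernel of the differential
  let i₀ : V →ₗ[ℂ] T × L.toLinearMap.ker := L.toLinearMap.prod π
  have hbij : Function.Bijective i₀ := by
    constructor
    · rw [injective_iff_map_eq_zero]
      intro x hx
      have hx1 : L x = 0 := congrArg Prod.fst hx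
      have hx2 : π x = 0 := congrArg Prod.snd hx
      have := hπ' ⟨x, hx1⟩
      rw [hx2] at this
      exact (congrArg Subtype.val this).symm
    · rintro ⟨t, x⟩
      obtain ⟨y, hy⟩ := hs t
      refine ⟨y + (x - π y : L.toLinearMap.ker), Prod.ext ?_ ?_⟩
      · have : L ((x - π y : L.toLinearMap.ker) : V) = 0 := (x - π y : L.toLinearMap.ker).2
        change L (y + _) = t
        rw [map_add, this, add_zero, hy]
      · change π (y + _) = x
        rw [map_add, hπ', add_sub_cancel]
  let i : V ≃L[ℂ] T × L.toLinearMap.ker :=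
    (LinearEquiv.ofBijective i₀ hbij).toContinuousLinearEquiv
  let πc : V →L[ℂ] L.toLinearMap.ker := LinearMap.toContinuousLinearMap π
  let E : V → T × L.toLinearMap.ker := fun w => (Z w, πc (w - w₀))
  have hE : AnalyticAt ℂ E w₀ :=
    hZ.prod ((πc.analyticAt _).fun_comp (analyticAt_id.fun_sub analyticAt_const))
  have hd : HasFDerivAt E (i : V →L[ℂ] T × L.toLinearMap.ker) w₀ := by
    have h1 : HasFDerivAt (fun w => πc (w - w₀)) (πc.comp (ContinuousLinearMap.id ℂ V)) w₀ :=
      πc.hasFDerivAt.comp w₀ ((hasFDerivAt_id w₀).sub_const w₀)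
    exact hZ.differentiableAt.hasFDerivAt.prodMk h1
  have hstrict : HasStrictFDerivAt E (i : V →L[ℂ] T × L.toLinearMap.ker) w₀ := by
    have := hE.hasStrictFDerivAt
    rwa [hd.fderiv] at this
  have h0 : E w₀ = (Z w₀, 0) := by simp [E]
  refine ⟨L.toLinearMap.ker, hstrict.toOpenPartialHomeomorph E,
    hstrict.mem_toOpenPartialHomeomorph_source, h0, fun w => rfl, ?_⟩
  rw [← h0]
  exact (hstrict.toOpenPartialHomeomorph E).analyticAt_symm'
    hstrict.mem_toOpenPartialHomeomorph_source hE hd.fderiv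

/-- A submersion has continuous local sections. -/
theorem exists_local_section {Z : V → T} {w₀ : V} (hZ : AnalyticAt ℂ Z w₀)
    (hs : Function.Surjective (fderiv ℂ Z w₀)) :
    ∃ σ : T → V, Filter.Tendsto σ (𝓝 (Z w₀)) (𝓝 w₀) ∧ σ (Z w₀) = w₀ ∧
      ∀ᶠ t in 𝓝 (Z w₀), Z (σ t) = t := by
  obtain ⟨K, e, he, h0, h1, h2⟩ := exists_straightening hZ hs
  have hsy : e.symm (Z w₀, 0) = w₀ := by rw [← h0, e.left_inv he]
  have hc : Filter.Tendsto (fun t : T => (t, (0 : K))) (𝓝 (Z w₀)) (𝓝 (Z w₀, 0)) := by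
    have : Continuous fun t : T => (t, (0 : K)) := by fun_prop
    exact this.tendsto _
  refine ⟨fun t => e.symm (t, 0), ?_, hsy, ?_⟩
  · have := h2.continuousAt.tendsto.comp hc
    rwa [hsy] at this
  · have ht : (Z w₀, (0 : K)) ∈ e.target := by rw [← h0]; exact e.map_source he
    filter_upwards [hc.eventually (e.open_target.mem_nhds ht)] with t h
    rw [← h1, e.right_inv h]

/-- Every vector tangent to a fibre of a submersion is the velocity of a curve in that fibre. -/
theorem exists_curve_in_fibre [CompleteSpace T] [FiniteDimensional ℂ T] {Z : V → T} {w₀ : V}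
    (hZ : AnalyticAt ℂ Z w₀) (hs : Function.Surjective (fderiv ℂ Z w₀)) {x : V}
    (hx : fderiv ℂ Z w₀ x = 0) :
    ∃ χ : ℂ → V, χ 0 = w₀ ∧ HasDerivAt χ x 0 ∧ ∀ᶠ t in 𝓝 0, Z (χ t) = Z w₀ := by
  have := FiniteDimensional.complete ℂ V
  have hst := hZ.hasStrictFDerivAt
  have hr : (fderiv ℂ Z w₀).range = ⊤ := LinearMap.range_eq_top.2 hs
  let y : (fderiv ℂ Z w₀).ker := ⟨x, hx⟩
  have hlin : HasDerivAt (fun t : ℂ => t • y) y 0 := by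
    simpa using (hasDerivAt_id (0 : ℂ)).smul_const y
  refine ⟨fun t => hst.implicitFunction Z _ hr (Z w₀) (t • y), ?_, ?_, ?_⟩
  · simp
  · have h1 := (hst.to_implicitFunction hr).hasFDerivAt
    rw [← zero_smul ℂ y] at h1
    exact h1.comp_hasDerivAt (0 : ℂ) hlin
  · have h1 : Filter.Tendsto (fun t : ℂ => (Z w₀, t • y)) (𝓝 0) (𝓝 (Z w₀, 0)) := by
      have : Continuous fun t : ℂ => (Z w₀, t • y) := by fun_prop
      simpa using this.tendsto 0
    exact h1.eventually (hst.map_implicitFunction_eq hr)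

/-- A function, depending on parameters, whose differential vanishes along the fibres of a
submersion `Z` is locally an analytic function of `Z` and the parameters. -/
theorem exists_eq_comp_submersion [CompleteSpace T] {Z : V → T} {w₀ : V} {p₀ : P} {φ : V × P → ℂ}
    (hZ : AnalyticAt ℂ Z w₀) (hs : Function.Surjective (fderiv ℂ Z w₀))
    (hφ : AnalyticAt ℂ φ (w₀, p₀))
    (hker : ∀ᶠ x in 𝓝 (w₀, p₀), ∀ v, fderiv ℂ Z x.1 v = 0 → fderiv ℂ φ x (v, 0) = 0) :
    ∃ ψ : T × P → ℂ, AnalyticAt ℂ ψ (Z w₀, p₀) ∧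
      ∀ᶠ x in 𝓝 (w₀, p₀), φ x = ψ (Z x.1, x.2) := by
  obtain ⟨K, e, he, h0, h1, h2⟩ := exists_straightening hZ hs
  have hsy : e.symm (Z w₀, 0) = w₀ := by rw [← h0, e.left_inv he]
  have htgt : (Z w₀, (0 : K)) ∈ e.target := by rw [← h0]; exact e.map_source he
  refine ⟨fun y => φ (e.symm (y.1, 0), y.2), ?_, ?_⟩
  · have hin : AnalyticAt ℂ (fun y : T × P => (y.1, (0 : K))) (Z w₀, p₀) :=
      analyticAt_fst.prod analyticAt_const
    have h3 : AnalyticAt ℂ (fun y : T × P => e.symm (y.1, (0 : K))) (Z w₀, p₀) :=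
      AnalyticAt.fun_comp (g := e.symm) (f := fun y : T × P => (y.1, (0 : K))) h2 hin
    refine AnalyticAt.fun_comp (g := φ) (f := fun y : T × P => (e.symm (y.1, (0 : K)), y.2))
      ?_ (h3.prod analyticAt_snd)
    simpa only [hsy] using hφ
  -- in the chart `e`, the differential of `φ` vanishes along the second factor
  have hc1 : Filter.Tendsto (fun y : (T × K) × P => (e.symm y.1, y.2))
      (𝓝 ((Z w₀, 0), p₀)) (𝓝 (w₀, p₀)) := by
    have : ContinuousAt (fun y : (T × K) × P => (e.symm y.1, y.2)) ((Z w₀, 0), p₀) := by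
      refine ContinuousAt.prodMk ?_ continuousAt_snd
      exact ContinuousAt.comp (f := Prod.fst) (g := e.symm) h2.continuousAt continuousAt_fst
    have h := this.tendsto
    simpa only [hsy] using h
  have hfst : Filter.Tendsto (fun y : (T × K) × P => y.1) (𝓝 ((Z w₀, 0), p₀))
      (𝓝 (Z w₀, 0)) := continuousAt_fst
  have hev : ∀ᶠ y : (T × K) × P in 𝓝 ((Z w₀, 0), p₀),
      HasFDerivAt (fun x : K => φ (e.symm (y.1.1, x), y.2)) (0 : K →L[ℂ] ℂ) y.1.2 := by
    have hZev : ∀ᶠ x : V × P in 𝓝 (w₀, p₀), AnalyticAt ℂ Z x.1 :=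
      (continuousAt_fst (p := (w₀, p₀))).eventually hZ.eventually_analyticAt
    filter_upwards [hfst.eventually h2.eventually_analyticAt,
      hc1.eventually hφ.eventually_analyticAt, hc1.eventually hker, hc1.eventually hZev,
      hfst.eventually (e.open_target.mem_nhds htgt)] with y ha hb hk hz ht
    obtain ⟨⟨t, x⟩, p⟩ := y
    simp only at ha hb hk hz ht
    have d1 : HasFDerivAt (fun x : K => (t, x)) (ContinuousLinearMap.inr ℂ T K) x :=
      (hasFDerivAt_const t x).prodMk (hasFDerivAt_id x)
    have d2 : HasFDerivAt (fun x : K => e.symm (t, x))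
        ((fderiv ℂ e.symm (t, x)).comp (ContinuousLinearMap.inr ℂ T K)) x :=
      ha.differentiableAt.hasFDerivAt.comp x d1
    have d3 := hb.differentiableAt.hasFDerivAt.comp x (d2.prodMk (hasFDerivAt_const p x))
    refine d3.congr_fderiv ?_
    ext1 v
    refine hk _ ?_
    have d4 := hz.differentiableAt.hasFDerivAt.comp x d2
    have d5 : HasFDerivAt (Z ∘ fun x : K => e.symm (t, x)) (0 : K →L[ℂ] T) x := by
      refine (hasFDerivAt_const t x).congr_of_eventuallyEq ?_
      have : Filter.Tendsto (fun x : K => (t, x)) (𝓝 x) (𝓝 (t, x)) := d1.continuousAt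
      filter_upwards [this.eventually (e.open_target.mem_nhds ht)] with x' hx'
      simp only [Function.comp]
      rw [← h1, e.right_inv hx']
    exact DFunLike.congr_fun (d4.unique d5) v
  -- balls in a product are products of balls, so the second coordinate can be moved to `0`
  obtain ⟨ε, hε, hball⟩ := Metric.eventually_nhds_iff_ball.1 hev
  have hc2 : Filter.Tendsto (fun x : V × P => (e x.1, x.2)) (𝓝 (w₀, p₀))
      (𝓝 ((Z w₀, 0), p₀)) := by
    have : ContinuousAt (fun x : V × P => (e x.1, x.2)) (w₀, p₀) := by
      refine ContinuousAt.prodMk ?_ continuousAt_snd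
      exact ContinuousAt.comp (f := Prod.fst) (g := e) (e.continuousAt he) continuousAt_fst
    have h := this.tendsto
    simpa only [h0] using h
  filter_upwards [hc2.eventually (Metric.ball_mem_nhds _ hε),
    (continuousAt_fst (p := (w₀, p₀))).eventually (e.open_source.mem_nhds he)] with x hx hsrc
  have hmem : ∀ v ∈ Metric.ball (0 : K) ε,
      HasFDerivAt (fun v : K => φ (e.symm (Z x.1, v), x.2)) (0 : K →L[ℂ] ℂ) v := by
    intro v hv
    refine hball ((Z x.1, v), x.2) ?_
    rw [Prod.dist_eq, Prod.dist_eq, h1] at hx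
    rw [Metric.mem_ball, Prod.dist_eq, Prod.dist_eq]
    simp only [max_lt_iff] at hx ⊢
    exact ⟨⟨hx.1.1, hv⟩, hx.2⟩
  have hx2 : (e x.1).2 ∈ Metric.ball (0 : K) ε := by
    rw [Prod.dist_eq, Prod.dist_eq] at hx
    simp only [max_lt_iff] at hx
    exact hx.1.2
  have hconst := (Metric.isOpen_ball (x := (0 : K)) (ε := ε)).is_const_of_fderiv_eq_zero
    (𝕜 := ℂ) (f := fun v : K => φ (e.symm (Z x.1, v), x.2))
    (convex_ball (0 : K) ε).isPreconnected
    (fun v hv => (hmem v hv).differentiableAt.differentiableWithinAt)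
    (fun v hv => (hmem v hv).fderiv)
    hx2 (Metric.mem_ball_self hε)
  have hsrc' : x.1 ∈ e.source := hsrc
  rw [← hconst, ← h1]
  change φ x = φ (e.symm (e x.1), x.2)
  rw [e.left_inv hsrc']

end Submersion

/-- Linearly independent functionals take arbitrary values simultaneously. -/
theorem surjective_of_linearIndependent {V : Type*} [NormedAddCommGroup V] [NormedSpace ℂ V]
    {ι : Type*} [Finite ι] {ℓ : ι → V →L[ℂ] ℂ}
    (h : LinearIndependent ℂ ℓ) : Function.Surjective fun (x : V) (j : ι) => ℓ j x := by
  cases nonempty_fintype ι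
  let L : V →ₗ[ℂ] ι → ℂ := LinearMap.pi fun j => (ℓ j).toLinearMap
  change Function.Surjective L
  rw [← LinearMap.range_eq_top]
  by_contra hne
  obtain ⟨f, hf, hle⟩ := Submodule.exists_le_ker_of_lt_top _ (lt_top_iff_ne_top.2 hne)
  classical
  refine hf ?_
  have h1 : ∑ j, f (Pi.single j 1) • ℓ j = 0 := by
    ext1 x
    have hx : f (L x) = 0 := hle ⟨x, rfl⟩
    have hdec : L x = ∑ j, ℓ j x • (Pi.single j 1 : ι → ℂ) := by
      funext i
      simp [L, Finset.sum_apply, Pi.single_apply]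
    rw [hdec, map_sum] at hx
    simp only [map_smul, smul_eq_mul] at hx
    simp only [_root_.sum_apply, _root_.smul_apply, smul_eq_mul, _root_.zero_apply]
    rw [← hx]
    exact Finset.sum_congr rfl fun j _ => mul_comm _ _
  have h2 := Fintype.linearIndependent_iff.1 h _ h1
  refine LinearMap.pi_ext' fun j => ?_
  ext1
  simpa using h2 j


/-! ### The tangent spaces of the cosets -/

section Tangent

variable {d m : ℕ} {c : Fin m → ℂ} {k : Fin m → ℕ}

/-- `K` has codimension `r`, and the differential at `g` of every `H`-right-invariant function
vanishes on `g K`: these are the properties of the Lie algebra of `H` that matter here. -/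
structure IsTangent (H : Subgroup (LieG d c k)) (r : ℕ) (K : Submodule ℂ (Coord d k)) : Prop where
  finrank_add : Module.finrank ℂ K + r = Module.finrank ℂ (Coord d k)
  fderiv_eq_zero : ∀ (φ : LieG d c k → ℂ), (∀ g, ∀ h ∈ H, φ (g * h) = φ g) → ∀ g : LieG d c k,
    DifferentiableAt ℂ (rep φ) (coord g) → ∀ x ∈ K,
      fderiv ℂ (rep φ) (coord g) (mulV d c k (coord g) x) = 0

theorem IsClosedConnectedLieSubgroup.exists_isTangent {H : Subgroup (LieG d c k)} {r : ℕ}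
    (hH : IsClosedConnectedLieSubgroup H r) : ∃ K, IsTangent H r K := by
  obtain ⟨Φ, hΦ, hs, hev⟩ := hH.submanifold 1 H.one_mem
  refine ⟨(fderiv ℂ Φ (coord (1 : LieG d c k))).toLinearMap.ker, ?_, ?_⟩
  · have h1 := LinearMap.finrank_range_add_finrank_ker
      (fderiv ℂ Φ (coord (1 : LieG d c k))).toLinearMap
    rw [LinearMap.range_eq_top.2 hs, finrank_top, Module.finrank_fin_fun] at h1
    omega
  intro φ hφ g hd x hx
  obtain ⟨χ, hχ0, hχd, hχ⟩ := exists_curve_in_fibre hΦ hs hx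
  have hΦ1 : Φ (coord (1 : LieG d c k)) = 0 := hev.self_of_nhds.1 H.one_mem
  -- for small parameters the values of the curve `χ` belong to `H`
  have hmem : ∀ᶠ t in 𝓝 0, ∃ h ∈ H, χ t = coord h := by
    have h1 : Filter.Tendsto χ (𝓝 0) (𝓝 (coord (1 : LieG d c k))) := by
      have := hχd.continuousAt.tendsto
      rwa [hχ0] at this
    have h2 : ∀ᶠ w in 𝓝 (coord (1 : LieG d c k)), ∃ h : LieG d c k, w = coord h ∧
        (h ∈ H ↔ Φ w = 0) :=
      eventually_nhds_coord.2 (hev.mono fun h hh => ⟨h, rfl, hh⟩)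
    filter_upwards [h1.eventually h2, hχ] with t ht1 ht2
    obtain ⟨h, hh1, hh2⟩ := ht1
    exact ⟨h, hh2.2 (ht2.trans hΦ1), hh1⟩
  have hconst : HasDerivAt (fun t => rep φ (mulV d c k (coord g) (χ t))) 0 0 := by
    refine (hasDerivAt_const (0 : ℂ) (φ g)).congr_of_eventuallyEq ?_
    filter_upwards [hmem] with y hy
    obtain ⟨h, hh, he⟩ := hy
    rw [he, ← coord_mul, rep_coord, hφ g h hh]
  have hd' : HasFDerivAt (rep φ) (fderiv ℂ (rep φ) (coord g))
      (mulV d c k (coord g) (χ 0)) := by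
    rw [hχ0, mulV_coord_one]; exact hd.hasFDerivAt
  have h3 : HasDerivAt (fun t => mulV d c k (coord g) (χ t)) (mulV d c k (coord g) x) 0 :=
    (mulV d c k (coord g)).hasFDerivAt.comp_hasDerivAt 0 hχd
  exact (hd'.comp_hasDerivAt (0 : ℂ) h3).unique hconst

/-- If `r` independent functionals vanish on `g K`, then `g K` is their common kernel. -/
theorem IsTangent.mem_of_forall_eq_zero {H : Subgroup (LieG d c k)} {r : ℕ}
    {K : Submodule ℂ (Coord d k)} (hK : IsTangent H r K) (g : LieG d c k) {ι : Type*} [Fintype ι]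
    (hι : Fintype.card ι = r) {L : Coord d k →ₗ[ℂ] ι → ℂ} (hs : Function.Surjective L)
    (hL : ∀ x ∈ K, L (mulV d c k (coord g) x) = 0) {v : Coord d k} (hv : L v = 0) :
    ∃ x ∈ K, mulV d c k (coord g) x = v := by
  have hinj : Function.Injective (mulV d c k (coord g)).toLinearMap := by
    intro x y hxy
    have := congrArg (mulV d c k (coord g⁻¹)) hxy
    simpa only [ContinuousLinearMap.coe_coe, coord_inv_mulV] using this
  have h1 := LinearMap.finrank_range_add_finrank_ker L
  rw [LinearMap.range_eq_top.2 hs, finrank_top, Module.finrank_fintype_fun_eq_card, hι] at h1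
  have h2 : K.map (mulV d c k (coord g)).toLinearMap ≤ L.ker := by
    rintro _ ⟨x, hx, rfl⟩
    exact hL x hx
  have h3 := Submodule.eq_of_le_of_finrank_eq h2 (by
    rw [← (Submodule.equivMapOfInjective _ hinj K).finrank_eq]
    have := hK.finrank_add
    omega)
  have h4 : v ∈ K.map (mulV d c k (coord g)).toLinearMap := by rw [h3]; exact hv
  obtain ⟨x, hx, hxv⟩ := h4
  exact ⟨x, hx, hxv⟩

end Tangent

/-! ### The shift and the groups `H_n` -/

section Shift

variable {d m : ℕ} {c : Fin m → ℂ} {k : Fin m → ℕ}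
variable {α β : ℤ} {F : LatticeFn α β} {a b : ℤ} (D : DarbouxLax d F a b)

theorem DarbouxLax.matAnalytic_M (hc : ∀ p, c p ∈ D.lamDom) {s : ℂ} (hs : s ∈ D.uDom) :
    MatAnalytic c fun lam => (D.M s lam : Matrix (Fin d) (Fin d) ℂ) := fun p i j =>
  AnalyticAt.fun_comp (f := fun lam : ℂ => (s, lam)) (D.analytic_M i j (s, c p) ⟨hs, hc p⟩)
    (analyticAt_const.prod analyticAt_id)

theorem DarbouxLax.matAnalytic_U (hc : ∀ p, c p ∈ D.lamDom) {x : Win a b} (hx : x ∈ D.domU) :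
    MatAnalytic c (D.U x) := fun p i j =>
  AnalyticAt.fun_comp (f := fun lam : ℂ => (x, lam)) (D.analytic_U i j (x, c p) ⟨hx, hc p⟩)
    (analyticAt_const.prod analyticAt_id)

theorem matAnalytic_one :
    MatAnalytic c fun lam =>
      (((1 : ℂ → GL (Fin d) ℂ) lam : GL (Fin d) ℂ) : Matrix (Fin d) (Fin d) ℂ) :=
  fun _ _ _ => analyticAt_const

/-- The group of the `GL_d(ℂ)`-valued functions of `λ` that are analytic at the points `c_p`. On it
`ρ` is multiplicative. -/
def analyticLoops (d : ℕ) {m : ℕ} (c : Fin m → ℂ) : Subgroup (ℂ → GL (Fin d) ℂ) where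
  carrier := {γ | MatAnalytic c fun lam => (γ lam : Matrix (Fin d) (Fin d) ℂ)}
  mul_mem' := fun hγ hδ => MatAnalytic.mul hγ hδ
  one_mem' := matAnalytic_one
  inv_mem' := fun hγ => MatAnalytic.inv hγ

theorem DarbouxLax.M_mem_analyticLoops (hc : ∀ p, c p ∈ D.lamDom) {s : ℂ} (hs : s ∈ D.uDom) :
    D.M s ∈ analyticLoops d c := D.matAnalytic_M hc hs

theorem DarbouxLax.hgroup_mono : Monotone D.hgroup := by
  refine monotone_nat_of_le_succ fun n => ?_
  rcases n with _ | n
  · rw [DarbouxLax.hgroup]; exact bot_le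
  · rw [DarbouxLax.hgroup]
    exact fun h hh => Subgroup.subset_closure (Or.inl hh)

/-- The product `M(u_{n-1}, λ) ⋯ M(u_0, λ)`, through which `S^n` acts on `G`. -/
def prodM (u : ℤ → ℂ) : ℕ → ℂ → GL (Fin d) ℂ
  | 0 => 1
  | n + 1 => D.M (u n) * prodM u n

/-- Changing the lattice variables in `M(u_{n-1}, λ) ⋯ M(u_0, λ)` amounts to multiplication by an
element of `H_n` on the left. -/
theorem prodM_mul_inv_mem_hgroup {u v : ℤ → ℂ} (n : ℕ) (hu : ∀ i : ℕ, i < n → u i ∈ D.uDom)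
    (hv : ∀ i : ℕ, i < n → v i ∈ D.uDom) : prodM D v n * (prodM D u n)⁻¹ ∈ D.hgroup n := by
  induction n with
  | zero => simp [prodM]
  | succ n ih =>
    have h := ih (fun i hi => hu i (by omega)) fun i hi => hv i (by omega)
    have e : prodM D v (n + 1) * (prodM D u (n + 1))⁻¹ =
        (D.M (v n) * (prodM D v n * (prodM D u n)⁻¹) * (D.M (v n))⁻¹) *
          (D.M (v n) * (D.M (u n))⁻¹) := by
      simp only [prodM]; group
    rw [e]
    refine mul_mem ?_ ?_
    · rcases n with _ | n
      · simp [prodM]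
      · rw [DarbouxLax.hgroup]
        exact Subgroup.subset_closure
          (Or.inr ⟨_, h, _, hv _ (Nat.lt_succ_self _), rfl⟩)
    · refine D.hgroup_mono (show 1 ≤ n + 1 by omega) ?_
      rw [DarbouxLax.hgroup]
      exact Subgroup.subset_closure
        ⟨_, hu n (Nat.lt_succ_self n), _, hv n (Nat.lt_succ_self n), rfl⟩

theorem shiftSeq_zero (u : ℤ → ℂ) : shiftSeq 0 u = u := by funext l; simp [shiftSeq]

theorem shiftSeq_shiftSeq (i j : ℤ) (u : ℤ → ℂ) :
    shiftSeq i (shiftSeq j u) = shiftSeq (i + j) u := by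
  funext l; simp [shiftSeq, add_assoc]

theorem shiftPt_zpow_add (i j : ℤ) (ξ : Pt d c k) :
    (shiftPt D ^ (i + j)) ξ = (shiftPt D ^ i) ((shiftPt D ^ j) ξ) := by
  rw [_root_.zpow_add]; rfl

theorem shiftPt_zpow_one_add (j : ℤ) (ξ : Pt d c k) :
    (shiftPt D ^ (1 + j)) ξ = shiftPt D ((shiftPt D ^ j) ξ) := by
  rw [_root_.zpow_add, zpow_one]; rfl

theorem shiftPt_zpow_snd (j : ℤ) (ξ : Pt d c k) :
    ((shiftPt D ^ j) ξ).2 = shiftSeq j ξ.2 := by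
  induction j with
  | zero => simp [shiftSeq_zero]
  | succ n ih =>
    rw [add_comm, shiftPt_zpow_one_add]
    change shiftSeq 1 ((shiftPt D ^ (n : ℤ)) ξ).2 = _
    rw [ih, shiftSeq_shiftSeq]
  | pred n ih =>
    rw [sub_eq_neg_add, shiftPt_zpow_add, _root_.zpow_neg_one]
    change shiftSeq (-1) ((shiftPt D ^ (-(n : ℤ))) ξ).2 = _
    rw [ih, shiftSeq_shiftSeq]

/-- The element of `G` by which `S^j` multiplies: the product of `ρ(M(u_l, λ))` along the shifts. -/
def trans (j : ℤ) (u : ℤ → ℂ) : LieG d c k := ((shiftPt D ^ j) ((1, u) : Pt d c k)).1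

theorem shiftPt_zpow_fst (j : ℤ) (g : LieG d c k) (u : ℤ → ℂ) :
    ((shiftPt D ^ j) (g, u)).1 = trans D j u * g := by
  induction j with
  | zero => simp [trans]
  | succ n ih =>
    rw [trans, add_comm, shiftPt_zpow_one_add, shiftPt_zpow_one_add]
    change rho (D.M (((shiftPt D ^ (n : ℤ)) (g, u)).2 0)) * ((shiftPt D ^ (n : ℤ)) (g, u)).1 =
      rho (D.M (((shiftPt D ^ (n : ℤ)) ((1, u) : Pt d c k)).2 0)) * trans D n u * g
    rw [ih, shiftPt_zpow_snd, shiftPt_zpow_snd, mul_assoc]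
  | pred n ih =>
    rw [trans, sub_eq_neg_add, shiftPt_zpow_add, shiftPt_zpow_add, _root_.zpow_neg_one]
    change (rho (D.M (((shiftPt D ^ (-(n : ℤ))) (g, u)).2 (-1))))⁻¹ *
        ((shiftPt D ^ (-(n : ℤ))) (g, u)).1 =
      (rho (D.M (((shiftPt D ^ (-(n : ℤ))) ((1, u) : Pt d c k)).2 (-1))))⁻¹ *
        trans D (-n) u * g
    rw [ih, shiftPt_zpow_snd, shiftPt_zpow_snd, mul_assoc]

theorem shiftPt_zpow (j : ℤ) (ξ : Pt d c k) :
    (shiftPt D ^ j) ξ = (trans D j ξ.2 * ξ.1, shiftSeq j ξ.2) :=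
  Prod.ext (shiftPt_zpow_fst D j ξ.1 ξ.2) (shiftPt_zpow_snd D j ξ)

theorem trans_one_add (j : ℤ) (u : ℤ → ℂ) :
    (trans D (1 + j) u : LieG d c k) = rho (D.M (u j)) * trans D j u := by
  rw [trans, shiftPt_zpow_one_add]
  change rho (D.M (((shiftPt D ^ j) ((1, u) : Pt d c k)).2 0)) * trans D j u = _
  rw [shiftPt_zpow_snd]
  simp [shiftSeq]

theorem trans_add_one (j : ℤ) (u : ℤ → ℂ) :
    (trans D (j + 1) u : LieG d c k) = trans D j (shiftSeq 1 u) * rho (D.M (u 0)) := by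
  rw [trans, shiftPt_zpow_add, zpow_one]
  change ((shiftPt D ^ j) ((rho (D.M (u 0)) * 1, shiftSeq 1 u) : Pt d c k)).1 = _
  rw [mul_one, shiftPt_zpow_fst]

theorem trans_zero (u : ℤ → ℂ) : (trans D 0 u : LieG d c k) = 1 := rfl

theorem trans_natCast (hc : ∀ p, c p ∈ D.lamDom) {u : ℤ → ℂ} (n : ℕ)
    (hu : ∀ i : ℕ, i < n → u i ∈ D.uDom) :
    (trans D n u : LieG d c k) = rho (prodM D u n) ∧ prodM D u n ∈ analyticLoops d c := by
  induction n with
  | zero => exact ⟨rho_one.symm, one_mem _⟩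
  | succ n ih =>
    obtain ⟨h1, h2⟩ := ih fun i hi => hu i (by omega)
    have h3 := D.M_mem_analyticLoops hc (hu n (Nat.lt_succ_self n))
    refine ⟨?_, mul_mem h3 h2⟩
    rw [Nat.cast_succ, add_comm, trans_one_add, h1, prodM, rho_mul h3 h2]

/-- For `n ≥ 0` the multiplier `trans D n u` depends on `u_0, …, u_{n-1}` only. -/
theorem trans_congr {u v : ℤ → ℂ} (n : ℕ) (h : ∀ i : ℕ, i < n → u i = v i) :
    (trans D n u : LieG d c k) = trans D n v := by
  induction n with
  | zero => rfl
  | succ n ih =>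
    rw [Nat.cast_succ, add_comm, trans_one_add, trans_one_add,
      ih fun i hi => h i (by omega), h n (Nat.lt_succ_self n)]

variable {H : Subgroup (LieG d c k)} {z : LieG d c k ⧸ H → ℂ} {Y : Set (LieG d c k ⧸ H)} {r : ℕ}

theorem zz_apply (j : ℤ) (g : LieG d c k) (u : ℤ → ℂ) :
    zz D z j (g, u) = z ((trans D j u * g : LieG d c k) : LieG d c k ⧸ H) := by
  rw [zz, shiftFn, shiftPt_zpow]; rfl

theorem zDefinedAt_iff (j : ℤ) (g : LieG d c k) (u : ℤ → ℂ) :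
    ZDefinedAt D Y j (g, u) ↔ ((trans D j u * g : LieG d c k) : LieG d c k ⧸ H) ∈ Y := by
  rw [ZDefinedAt, shiftPt_zpow]

theorem zz_zpow (i j : ℤ) (ξ : Pt d c k) : zz D z i ((shiftPt D ^ j) ξ) = zz D z (i + j) ξ := by
  rw [zz, zz, shiftFn, shiftFn, shiftPt_zpow_add]

theorem zSeq_zpow (j : ℤ) (ξ : Pt d c k) :
    zSeq D z ((shiftPt D ^ j) ξ) = shiftSeq j (zSeq D z ξ) := by
  funext i
  exact zz_zpow D i j ξ

theorem zDefinedAt_zpow (i j : ℤ) (ξ : Pt d c k) :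
    ZDefinedAt D Y i ((shiftPt D ^ j) ξ) ↔ ZDefinedAt D Y (i + j) ξ := by
  rw [ZDefinedAt, ZDefinedAt, shiftPt_zpow_add]

theorem mk_mul_eq_of_mem (g : LieG d c k) {h : LieG d c k} (hh : h ∈ H) :
    ((g * h : LieG d c k) : LieG d c k ⧸ H) = g :=
  QuotientGroup.mk_mul_of_mem g hh

/-- `z, …, S^{r-1}(z)` do not depend on the lattice variables: this is where the invariance of `z`
under `H_{r-1}` enters. -/
theorem zz_eq_of_mk_eq (hc : ∀ p, c p ∈ D.lamDom) (hinv : LeftInvariant D (r - 1) z Y) (j : ℕ)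
    (hj : j < r) {g g' : LieG d c k} {u u' : ℤ → ℂ} (hg : (g : LieG d c k ⧸ H) = g')
    (hu : ∀ i : ℕ, i < j → u i ∈ D.uDom) (hu' : ∀ i : ℕ, i < j → u' i ∈ D.uDom)
    (h : ZDefinedAt D Y j (g, u)) (h' : ZDefinedAt D Y j (g', u')) :
    zz D z j (g, u) = zz D z j (g', u') := by
  rw [zDefinedAt_iff] at h h'
  obtain ⟨e1, m1⟩ := trans_natCast (k := k) D hc j hu
  obtain ⟨e2, m2⟩ := trans_natCast (k := k) D hc j hu'
  have hm := D.hgroup_mono (show j ≤ r - 1 by omega) (prodM_mul_inv_mem_hgroup D j hu hu')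
  have hr : (rho (prodM D u' j * (prodM D u j)⁻¹) : LieG d c k) •
      ((trans D j u * g : LieG d c k) : LieG d c k ⧸ H) =
        ((trans D j u' * g' : LieG d c k) : LieG d c k ⧸ H) := by
    have h1 : (rho (prodM D u' j * (prodM D u j)⁻¹) : LieG d c k) * trans D j u
        = trans D j u' := by
      rw [e1, e2, ← rho_mul (mul_mem m2 (inv_mem m1)) m1, inv_mul_cancel_right]
    have h2 : (rho (prodM D u' j * (prodM D u j)⁻¹) : LieG d c k) •
        ((trans D j u * g : LieG d c k) : LieG d c k ⧸ H) =
        ((rho (prodM D u' j * (prodM D u j)⁻¹) * (trans D j u * g) : LieG d c k) :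
          LieG d c k ⧸ H) := rfl
    rw [h2, ← mul_assoc, h1]
    change (trans D j u' : LieG d c k) • (g : LieG d c k ⧸ H) =
      (trans D j u' : LieG d c k) • (g' : LieG d c k ⧸ H)
    rw [hg]
  rw [zz_apply, zz_apply, ← hr]
  exact (hinv _ hm _ h (by rw [hr]; exact h')).symm

theorem admissible_zpow {ξ : Pt d c k} (hξ : ξ ∈ admissible D c k) (j : ℤ) :
    (shiftPt D ^ j) ξ ∈ admissible D c k := by
  intro l
  rw [shiftPt_zpow_snd]
  exact hξ (l + j)

/-! ### Continuity of the shift -/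

theorem analyticAt_jetV_M (hc : ∀ p, c p ∈ D.lamDom) {s : ℂ} (hs : s ∈ D.uDom) :
    AnalyticAt ℂ (fun s => jetV c k fun lam => (D.M s lam : Matrix (Fin d) (Fin d) ℂ)) s := by
  rw [analyticAt_pi_iff]
  rintro ⟨p, q, i, j⟩
  simp only [jetV_apply]
  exact (analyticAt_iteratedDeriv_snd q (D.analytic_M i j (s, c p) ⟨hs, hc p⟩)).fun_div
    analyticAt_const (by exact_mod_cast (q : ℕ).factorial_ne_zero)

theorem analyticAt_jetV_U (hc : ∀ p, c p ∈ D.lamDom) {x : Win a b} (hx : x ∈ D.domU) :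
    AnalyticAt ℂ (fun x => jetV c k (D.U x)) x := by
  rw [analyticAt_pi_iff]
  rintro ⟨p, q, i, j⟩
  simp only [jetV_apply]
  exact (analyticAt_iteratedDeriv_snd q (D.analytic_U i j (x, c p) ⟨hx, hc p⟩)).fun_div
    analyticAt_const (by exact_mod_cast (q : ℕ).factorial_ne_zero)

/-- The derivative of `M` in `u`, as a function of `λ`. -/
def derivM (s : ℂ) : ℂ → Matrix (Fin d) (Fin d) ℂ := fun lam =>
  Matrix.of fun i j => deriv (fun s : ℂ => (D.M s lam : Matrix (Fin d) (Fin d) ℂ) i j) s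

theorem hasDerivAt_jetV_M (hc : ∀ p, c p ∈ D.lamDom) {s : ℂ} (hs : s ∈ D.uDom) :
    HasDerivAt (fun s => jetV c k fun lam => (D.M s lam : Matrix (Fin d) (Fin d) ℂ))
      (jetV c k (derivM D s)) s := by
  rw [hasDerivAt_pi]
  rintro ⟨p, q, i, j⟩
  simp only [jetV_apply]
  exact (hasDerivAt_iteratedDeriv_snd q (D.analytic_M i j (s, c p) ⟨hs, hc p⟩)).div_const _

theorem continuousAt_rho_M (hc : ∀ p, c p ∈ D.lamDom) {s : ℂ} (hs : s ∈ D.uDom) :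
    ContinuousAt (fun s => (rho (D.M s) : LieG d c k)) s := by
  rw [isOpenEmbedding_coord.isInducing.continuousAt_iff]
  exact (analyticAt_jetV_M D hc hs).continuousAt

theorem continuous_shiftSeq (j : ℤ) : Continuous (shiftSeq j) :=
  continuous_pi fun l => continuous_apply (l + j)

theorem continuousAt_shiftPt (hc : ∀ p, c p ∈ D.lamDom) {ξ : Pt d c k} (hξ : ξ.2 0 ∈ D.uDom) :
    ContinuousAt (shiftPt D) ξ := by
  have h0 : ContinuousAt (fun ξ : Pt d c k => ξ.2 0) ξ :=
    ((continuous_apply 0).comp continuous_snd).continuousAt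
  have h1 : ContinuousAt (fun ξ : Pt d c k => (rho (D.M (ξ.2 0)) : LieG d c k)) ξ :=
    ContinuousAt.comp (f := fun ξ : Pt d c k => ξ.2 0) (continuousAt_rho_M D hc hξ) h0
  exact (h1.mul continuousAt_fst).prodMk
    ((continuous_shiftSeq 1).comp continuous_snd).continuousAt

theorem continuousAt_shiftPt_inv (hc : ∀ p, c p ∈ D.lamDom) {ξ : Pt d c k}
    (hξ : ξ.2 (-1) ∈ D.uDom) : ContinuousAt ((shiftPt D)⁻¹ : Equiv.Perm (Pt d c k)) ξ := by
  have h0 : ContinuousAt (fun ξ : Pt d c k => ξ.2 (-1)) ξ :=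
    ((continuous_apply (-1)).comp continuous_snd).continuousAt
  have h1 : ContinuousAt (fun ξ : Pt d c k => (rho (D.M (ξ.2 (-1))) : LieG d c k)) ξ :=
    ContinuousAt.comp (f := fun ξ : Pt d c k => ξ.2 (-1)) (continuousAt_rho_M D hc hξ) h0
  exact (h1.inv.mul continuousAt_fst).prodMk
    ((continuous_shiftSeq (-1)).comp continuous_snd).continuousAt

theorem continuousAt_shiftPt_zpow (hc : ∀ p, c p ∈ D.lamDom) {ξ : Pt d c k}
    (hξ : ξ ∈ admissible D c k) (j : ℤ) :
    ContinuousAt (shiftPt D ^ j : Equiv.Perm (Pt d c k)) ξ := by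
  induction j with
  | zero => exact continuousAt_id
  | succ n ih =>
    have e : (shiftPt D ^ ((n : ℤ) + 1) : Equiv.Perm (Pt d c k)) =
        fun η : Pt d c k => shiftPt D ((shiftPt D ^ (n : ℤ)) η) := by
      funext η
      rw [add_comm, shiftPt_zpow_one_add]
    have h0 : ((shiftPt D ^ (n : ℤ)) ξ).2 0 ∈ D.uDom := admissible_zpow D hξ n 0
    rw [e]
    exact ContinuousAt.comp' (continuousAt_shiftPt D hc h0) ih
  | pred n ih =>
    have e : (shiftPt D ^ (-(n : ℤ) - 1) : Equiv.Perm (Pt d c k)) =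
        fun η : Pt d c k => (shiftPt D)⁻¹ ((shiftPt D ^ (-(n : ℤ))) η) := by
      funext η
      rw [sub_eq_neg_add, shiftPt_zpow_add, _root_.zpow_neg_one]
    have h0 : ((shiftPt D ^ (-(n : ℤ))) ξ).2 (-1) ∈ D.uDom := admissible_zpow D hξ (-n) (-1)
    rw [e]
    exact ContinuousAt.comp' (continuousAt_shiftPt_inv D hc h0) ih

theorem continuous_mk : Continuous (fun g : LieG d c k => (g : LieG d c k ⧸ H)) :=
  continuous_quotient_mk'

theorem eventually_zDefinedAt (hc : ∀ p, c p ∈ D.lamDom) (hY : IsOpen Y) {ξ : Pt d c k}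
    (hξ : ξ ∈ admissible D c k) {j : ℤ} (h : ZDefinedAt D Y j ξ) :
    ∀ᶠ η in 𝓝 ξ, ZDefinedAt D Y j η := by
  have h1 : ContinuousAt (fun η => (((shiftPt D ^ j) η).1 : LieG d c k ⧸ H)) ξ :=
    (continuous_mk.comp continuous_fst).continuousAt.comp (continuousAt_shiftPt_zpow D hc hξ j)
  exact h1.eventually (hY.mem_nhds h)

theorem eventually_mem_uDom {ξ : Pt d c k} (hξ : ξ ∈ admissible D c k) (S : Set ℤ)
    (hS : S.Finite) : ∀ᶠ η in 𝓝 ξ, ∀ l ∈ S, η.2 l ∈ D.uDom := by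
  rw [Filter.eventually_all_finite hS]
  intro l _
  have : ContinuousAt (fun η : Pt d c k => η.2 l) ξ :=
    ((continuous_apply l).comp continuous_snd).continuousAt
  exact this.eventually (D.isOpen_uDom.mem_nhds (hξ l))

end Shift

/-! ### Local coordinates on `G/H` -/

/-- A function, as an analytic function on the set of points at which it is analytic. -/
def AnalyticFn.ofFun {V : Type} [NormedAddCommGroup V] [NormedSpace ℂ V]
    (f : V → ℂ) : AnalyticFn V where
  toFun := f
  dom := {x | AnalyticAt ℂ f x}
  isOpen_dom := isOpen_analyticAt ℂ f
  analytic := fun _ hx => hx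

section LocalCoords

variable {d m : ℕ} {c : Fin m → ℂ} {k : Fin m → ℕ}
variable {α β : ℤ} {F : LatticeFn α β} {a b : ℤ} (D : DarbouxLax d F a b)
variable {H : Subgroup (LieG d c k)} {z : LieG d c k ⧸ H → ℂ} {Y : Set (LieG d c k ⧸ H)} {r : ℕ}

theorem rep_mul_left (φ : LieG d c k → ℂ) (B g : LieG d c k) :
    rep (fun g' => φ (B * g')) =ᶠ[𝓝 (coord g)] fun w => rep φ (mulV d c k (coord B) w) := by
  refine eventually_nhds_coord.2 (Filter.Eventually.of_forall fun g' => ?_)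
  simp only
  rw [rep_coord, ← coord_mul, rep_coord]

theorem rep_zz_eventuallyEq (j : ℤ) (g : LieG d c k) (u : ℤ → ℂ) :
    rep (fun g' => zz D z j (g', u)) =ᶠ[𝓝 (coord g)]
      fun w => rep (fun g' : LieG d c k => z (g' : LieG d c k ⧸ H))
        (mulV d c k (coord (trans D j u : LieG d c k)) w) := by
  have := rep_mul_left (fun g' : LieG d c k => z (g' : LieG d c k ⧸ H)) (trans D j u) g
  simpa only [zz_apply] using this

theorem analyticAt_rep_zz (hz : IsFunctionOn z Y) {j : ℤ} {g : LieG d c k} {u : ℤ → ℂ}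
    (h : ZDefinedAt D Y j (g, u)) :
    AnalyticAt ℂ (rep fun g' => zz D z j (g', u)) (coord g) := by
  rw [zDefinedAt_iff] at h
  refine AnalyticAt.congr ?_ (rep_zz_eventuallyEq D j g u).symm
  refine AnalyticAt.fun_comp (g := rep fun g' : LieG d c k => z (g' : LieG d c k ⧸ H))
    ?_ (ContinuousLinearMap.analyticAt _ _)
  rw [← coord_mul]
  exact hz.analytic _ h

theorem zz_mul_of_mem (j : ℤ) (u : ℤ → ℂ) (g : LieG d c k) {h : LieG d c k} (hh : h ∈ H) :
    zz D z j (g * h, u) = zz D z j (g, u) := by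
  rw [zz_apply, zz_apply, ← mul_assoc, mk_mul_eq_of_mem _ hh]

/-- The tuple `(z_0, …, z_{r-1})` as a function of the coordinates `w^{pq}_{ij}`. -/
def zVec (z : LieG d c k ⧸ H → ℂ) (r : ℕ) (u : ℤ → ℂ) : Coord d k → Win 0 (r - 1) :=
  fun w l => rep (fun g => zz D z l (g, u)) w

theorem zVec_coord (u : ℤ → ℂ) (g : LieG d c k) :
    zVec D z r u (coord g) = win 0 (r - 1) (zSeq D z (g, u)) := by
  funext l
  exact rep_coord _ _

/-- The indices `0, …, r - 1`, as natural numbers and as integers. -/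
def finEquivIcc (r : ℕ) : Fin r ≃ Set.Icc (0 : ℤ) (r - 1) where
  toFun j := ⟨(j : ℕ), by have := j.2; constructor <;> omega⟩
  invFun l := ⟨l.1.toNat, by have := l.2.1; have := l.2.2; omega⟩
  left_inv j := by simp
  right_inv l := by
    have := l.2.1
    ext
    simp only
    omega

theorem LocalCoordsAt.zDefinedAt {g : LieG d c k} {u : ℤ → ℂ}
    (h : LocalCoordsAt D z Y r (g, u)) (l : Set.Icc (0 : ℤ) (r - 1)) :
    ZDefinedAt D Y l (g, u) := by
  have := h.1 ((finEquivIcc r).symm l)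
  have e : ((((finEquivIcc r).symm l : Fin r) : ℕ) : ℤ) = l :=
    congrArg Subtype.val ((finEquivIcc r).apply_symm_apply l)
  rwa [e] at this

theorem LocalCoordsAt.analyticAt (hz : IsFunctionOn z Y) {g : LieG d c k} {u : ℤ → ℂ}
    (h : LocalCoordsAt D z Y r (g, u)) : AnalyticAt ℂ (zVec D z r u) (coord g) := by
  rw [analyticAt_pi_iff]
  exact fun l => analyticAt_rep_zz D hz (h.zDefinedAt D l)

theorem LocalCoordsAt.fderiv_apply (hz : IsFunctionOn z Y) {g : LieG d c k} {u : ℤ → ℂ}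
    (h : LocalCoordsAt D z Y r (g, u)) (v : Coord d k) (l : Set.Icc (0 : ℤ) (r - 1)) :
    fderiv ℂ (zVec D z r u) (coord g) v l =
      fderiv ℂ (rep fun g' => zz D z l (g', u)) (coord g) v := by
  have h1 : HasFDerivAt (zVec D z r u) (ContinuousLinearMap.pi fun l : Set.Icc (0 : ℤ) (r - 1) =>
      fderiv ℂ (rep fun g' => zz D z l (g', u)) (coord g)) (coord g) :=
    hasFDerivAt_pi.2 fun l =>
      (analyticAt_rep_zz D hz (h.zDefinedAt D l)).differentiableAt.hasFDerivAt
  rw [h1.fderiv]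
  rfl

theorem LocalCoordsAt.surjective (hz : IsFunctionOn z Y) {g : LieG d c k} {u : ℤ → ℂ}
    (h : LocalCoordsAt D z Y r (g, u)) :
    Function.Surjective (fderiv ℂ (zVec D z r u) (coord g)) := by
  intro y
  obtain ⟨x, hx⟩ := surjective_of_linearIndependent h.2 fun j => y (finEquivIcc r j)
  refine ⟨x, funext fun l => ?_⟩
  rw [h.fderiv_apply D hz]
  have := congrFun hx ((finEquivIcc r).symm l)
  simp only at this
  rw [Equiv.apply_symm_apply] at this
  rw [← this]
  have e : ((((finEquivIcc r).symm l : Fin r) : ℕ) : ℤ) = l :=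
    congrArg Subtype.val ((finEquivIcc r).apply_symm_apply l)
  rw [e]

/-- Where `z_0, …, z_{r-1}` are local coordinates on `G/H`, their common level sets are tangent to
the cosets. -/
theorem LocalCoordsAt.mem_tangent (hz : IsFunctionOn z Y) {K : Submodule ℂ (Coord d k)}
    (hK : IsTangent H r K) {g : LieG d c k} {u : ℤ → ℂ} (h : LocalCoordsAt D z Y r (g, u))
    {v : Coord d k} (hv : fderiv ℂ (zVec D z r u) (coord g) v = 0) :
    ∃ x ∈ K, mulV d c k (coord g) x = v := by
  refine hK.mem_of_forall_eq_zero g (L := (fderiv ℂ (zVec D z r u) (coord g)).toLinearMap)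
    (by simp) (h.surjective D hz) (fun x hx => ?_) hv
  funext l
  change fderiv ℂ (zVec D z r u) (coord g) _ l = 0
  rw [h.fderiv_apply D hz]
  exact hK.fderiv_eq_zero _ (fun g h hh => zz_mul_of_mem D l u g hh) g
    (analyticAt_rep_zz D hz (h.zDefinedAt D l)).differentiableAt x hx

theorem LocalCoordsAt.eventually (hz : IsFunctionOn z Y) {g : LieG d c k} {u : ℤ → ℂ}
    (h : LocalCoordsAt D z Y r (g, u)) : ∀ᶠ g' in 𝓝 g, LocalCoordsAt D z Y r (g', u) := by
  have h1 : ∀ᶠ g' in 𝓝 g, ∀ j : Fin r, ZDefinedAt D Y (j : ℕ) (g', u) := by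
    rw [Filter.eventually_all]
    intro j
    have hj := h.1 j
    simp only [zDefinedAt_iff] at hj ⊢
    have hcont : Continuous fun g' : LieG d c k =>
        ((trans D (j : ℕ) u * g' : LieG d c k) : LieG d c k ⧸ H) :=
      continuous_mk.comp (continuous_const.mul continuous_id)
    exact hcont.continuousAt.eventually (hz.isOpen.mem_nhds hj)
  have h2 : ContinuousAt (fun w (j : Fin r) =>
      fderiv ℂ (rep fun g => zz D z (j : ℕ) (g, u)) w) (coord g) :=
    continuousAt_pi.2 fun j => (analyticAt_rep_zz D hz (h.1 j)).fderiv.continuousAt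
  have h3 := eventually_nhds_coord.1
    (h2.eventually (isOpen_setOfPred_linearIndependent.mem_nhds h.2))
  filter_upwards [h1, h3] with g' h1 h3
  exact ⟨h1, h3⟩

/-- An `H`-right-invariant analytic function, depending on parameters, is locally an analytic
function of `z_0, …, z_{r-1}` and the parameters. -/
theorem LocalCoordsAt.exists_analyticFn (hz : IsFunctionOn z Y) {K : Submodule ℂ (Coord d k)}
    (hK : IsTangent H r K) {g : LieG d c k} {u : ℤ → ℂ} (h : LocalCoordsAt D z Y r (g, u))
    {P : Type} [NormedAddCommGroup P] [NormedSpace ℂ P] {p : P} {Φ : P → LieG d c k → ℂ}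
    (hΦ : ∀ p g, ∀ h ∈ H, Φ p (g * h) = Φ p g)
    (ha : AnalyticAt ℂ (fun x : Coord d k × P => rep (Φ x.2) x.1) (coord g, p)) :
    ∃ ψ : AnalyticFn (Win 0 (r - 1) × P), ∀ᶠ x in 𝓝 (g, p),
      (zVec D z r u (coord x.1), x.2) ∈ ψ.dom ∧
        Φ x.2 x.1 = ψ.toFun (zVec D z r u (coord x.1), x.2) := by
  have hmap : Filter.map (fun x : LieG d c k × P => (coord x.1, x.2)) (𝓝 (g, p)) =
      𝓝 (coord g, p) :=
    (isOpenEmbedding_coord.prodMap (IsOpenEmbedding.id)).map_nhds_eq (g, p)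
  have hker : ∀ᶠ x in 𝓝 (coord g, p), ∀ v, fderiv ℂ (zVec D z r u) x.1 v = 0 →
      fderiv ℂ (fun x : Coord d k × P => rep (Φ x.2) x.1) x (v, 0) = 0 := by
    have h1 : ∀ᶠ x in 𝓝 (coord g, p), ∃ g', x.1 = coord g' ∧ LocalCoordsAt D z Y r (g', u) := by
      have h2 : ∀ᶠ w in 𝓝 (coord g), ∃ g', w = coord g' ∧ LocalCoordsAt D z Y r (g', u) :=
        eventually_nhds_coord.2 ((h.eventually D hz).mono fun g' hg' => ⟨g', rfl, hg'⟩)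
      exact (continuousAt_fst (p := (coord g, p))).eventually h2
    filter_upwards [h1, ha.eventually_analyticAt] with x hx hax v hv
    obtain ⟨w, p'⟩ := x
    obtain ⟨g', rfl, hg'⟩ := hx
    obtain ⟨y, hy, rfl⟩ := hg'.mem_tangent D hz hK hv
    have d1 : HasFDerivAt (fun w : Coord d k => (w, p')) (ContinuousLinearMap.inl ℂ _ P)
        (coord g') := (hasFDerivAt_id _).prodMk (hasFDerivAt_const _ _)
    have d2 := hax.differentiableAt.hasFDerivAt.comp (coord g') d1
    have d3 := hK.fderiv_eq_zero (Φ p') (hΦ p') g' d2.differentiableAt y hy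
    have d4 : HasFDerivAt (rep (Φ p')) _ (coord g') := d2
    rw [d4.fderiv] at d3
    exact d3
  obtain ⟨ψ, hψ, hev⟩ := exists_eq_comp_submersion (h.analyticAt D hz) (h.surjective D hz) ha hker
  refine ⟨AnalyticFn.ofFun ψ, ?_⟩
  have hcont : Filter.Tendsto (fun x : Coord d k × P => (zVec D z r u x.1, x.2))
      (𝓝 (coord g, p)) (𝓝 (zVec D z r u (coord g), p)) :=
    ContinuousAt.prodMk (ContinuousAt.comp (f := Prod.fst) (g := zVec D z r u)
      (h.analyticAt D hz).continuousAt continuousAt_fst) continuousAt_snd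
  have hdom := hcont.eventually hψ.eventually_analyticAt
  have hboth := hdom.and hev
  rw [← hmap, Filter.eventually_map] at hboth
  filter_upwards [hboth] with x hx
  refine ⟨hx.1, ?_⟩
  have := hx.2
  simp only [rep_coord] at this
  exact this

/-- Near an admissible point the functions `z_0, …, z_{r-1}` do not depend on the `u_l`. -/
theorem LocalCoordsAt.eventually_win_zSeq (hc : ∀ p, c p ∈ D.lamDom) (hz : IsFunctionOn z Y)
    (hinv : LeftInvariant D (r - 1) z Y) {ξ : Pt d c k} (hξ : ξ ∈ admissible D c k)
    (h : LocalCoordsAt D z Y r ξ) :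
    ∀ᶠ η in 𝓝 ξ, win 0 (r - 1) (zSeq D z η) = zVec D z r ξ.2 (coord η.1) := by
  have h1 : ∀ᶠ η in 𝓝 ξ, ∀ l : Set.Icc (0 : ℤ) (r - 1), ZDefinedAt D Y l η := by
    rw [Filter.eventually_all]
    exact fun l => eventually_zDefinedAt D hc hz.isOpen hξ (LocalCoordsAt.zDefinedAt D h l)
  have h2 : ∀ᶠ η in 𝓝 ξ, ∀ l : Set.Icc (0 : ℤ) (r - 1), ZDefinedAt D Y l (η.1, ξ.2) := by
    have hc2 : Filter.Tendsto (fun η : Pt d c k => (η.1, ξ.2)) (𝓝 ξ) (𝓝 ξ) := by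
      have : Continuous fun η : Pt d c k => (η.1, ξ.2) := by fun_prop
      exact this.tendsto ξ
    exact hc2.eventually h1
  filter_upwards [h1, h2, eventually_mem_uDom D hξ (Set.Ico 0 r) (Set.finite_Ico _ _)]
    with η h1 h2 h3
  funext l
  rw [zVec_coord]
  change zz D z l (η.1, η.2) = zz D z l (η.1, ξ.2)
  have hl := l.2.1
  have hl2 := l.2.2
  obtain ⟨j, hj⟩ : ∃ j : ℕ, (j : ℤ) = l := ⟨l.1.toNat, by omega⟩
  have e1 := h1 l
  have e2 := h2 l
  rw [← hj] at e1 e2 ⊢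
  refine zz_eq_of_mk_eq D hc hinv j (by omega) rfl (fun i hi => h3 i ?_) (fun i _ => hξ i) e1 e2
  constructor <;> omega

end LocalCoords

/-! ### Local expressions for the shift, the total derivative and the Miura map -/

section LocalExpressions

variable {d m : ℕ} {c : Fin m → ℂ} {k : Fin m → ℕ}
variable {α β : ℤ} {F : LatticeFn α β} {a b : ℤ} (D : DarbouxLax d F a b)
variable {H : Subgroup (LieG d c k)} {z : LieG d c k ⧸ H → ℂ} {Y : Set (LieG d c k ⧸ H)} {r : ℕ}

theorem trans_update (n : ℕ) (u : ℤ → ℂ) (s : ℂ) :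
    (trans D (n + 1) (Function.update u 0 s) : LieG d c k) =
      trans D n (shiftSeq 1 u) * rho (D.M s) := by
  rw [trans_add_one, Function.update_self]
  congr 1
  refine trans_congr D n fun i _ => ?_
  rw [shiftSeq, shiftSeq, Function.update_of_ne (by omega)]

theorem tendsto_update (ξ : Pt d c k) :
    Filter.Tendsto (fun η : Pt d c k => (η.1, Function.update ξ.2 0 (η.2 0))) (𝓝 ξ) (𝓝 ξ) := by
  have : Continuous fun η : Pt d c k => (η.1, Function.update ξ.2 0 (η.2 0)) := by
    refine continuous_fst.prodMk (continuous_const.update 0 ?_)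
    exact (continuous_apply 0).comp continuous_snd
  have h := this.tendsto ξ
  simpa only [Function.update_eq_self] using h

theorem continuous_update_snd (g : LieG d c k) (u : ℤ → ℂ) (l : ℤ) :
    Continuous fun s : ℂ => ((g, Function.update u l s) : Pt d c k) :=
  continuous_const.prodMk (continuous_const.update l continuous_id)

/-- `z_r` depends on the lattice variables through `u_0` only. -/
theorem eventually_zz_update (hc : ∀ p, c p ∈ D.lamDom) (hr : 0 < r) (hY : IsOpen Y)
    (hinv : LeftInvariant D (r - 1) z Y) {ξ : Pt d c k} (hξ : ξ ∈ admissible D c k)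
    (h : ZDefinedAt D Y r ξ) :
    ∀ᶠ η in 𝓝 ξ, zz D z r η = zz D z r (η.1, Function.update ξ.2 0 (η.2 0)) := by
  have h1 := eventually_zDefinedAt D hc hY hξ h
  obtain ⟨n, rfl⟩ : ∃ n, r = n + 1 := ⟨r - 1, by omega⟩
  filter_upwards [h1, (tendsto_update ξ).eventually h1,
    eventually_mem_uDom D hξ (Set.Icc 0 (n + 1)) (Set.finite_Icc _ _)] with η h1 h2 h3
  have e : ∀ u : ℤ → ℂ, u 0 = η.2 0 →
      zz D z ((n + 1 : ℕ) : ℤ) (η.1, u) = zz D z n (rho (D.M (η.2 0)) * η.1, shiftSeq 1 u) ∧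
      (ZDefinedAt D Y ((n + 1 : ℕ) : ℤ) (η.1, u) ↔
        ZDefinedAt D Y n (rho (D.M (η.2 0)) * η.1, shiftSeq 1 u)) := by
    intro u hu
    rw [zz_apply, zz_apply, zDefinedAt_iff, zDefinedAt_iff, Nat.cast_succ, trans_add_one, hu,
      mul_assoc]
    exact ⟨rfl, Iff.rfl⟩
  have h4 : ZDefinedAt D Y ((n + 1 : ℕ) : ℤ) (η.1, η.2) := h1
  change zz D z ((n + 1 : ℕ) : ℤ) (η.1, η.2) = _
  rw [(e _ rfl).2] at h4
  rw [(e _ (Function.update_self ..)).2] at h2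
  rw [(e _ rfl).1, (e _ (Function.update_self ..)).1]
  refine zz_eq_of_mk_eq D hc hinv n (by omega) rfl (fun i hi => ?_) (fun i hi => ?_) h4 h2
  · exact h3 (i + 1) ⟨by omega, by omega⟩
  · rw [shiftSeq, Function.update_of_ne (by omega)]
    exact hξ _

theorem analyticAt_rep_zz_update (hc : ∀ p, c p ∈ D.lamDom) (hr : 0 < r) (hz : IsFunctionOn z Y)
    {g : LieG d c k} {u : ℤ → ℂ} (hu : u 0 ∈ D.uDom) (h : ZDefinedAt D Y r (g, u)) :
    AnalyticAt ℂ (fun x : Coord d k × ℂ =>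
      rep (fun g => zz D z r (g, Function.update u 0 x.2)) x.1) (coord g, u 0) := by
  obtain ⟨n, rfl⟩ : ∃ n, r = n + 1 := ⟨r - 1, by omega⟩
  set B : LieG d c k := trans D n (shiftSeq 1 u) with hB
  set zr := rep fun g' : LieG d c k => z (g' : LieG d c k ⧸ H) with hzr
  rw [zDefinedAt_iff, Nat.cast_succ, trans_add_one, mul_assoc] at h
  have h1 : AnalyticAt ℂ (fun x : Coord d k × ℂ => mulV d c k (coord B)
      (mulV d c k (jetV c k fun lam => (D.M x.2 lam : Matrix (Fin d) (Fin d) ℂ)) x.1))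
      (coord g, u 0) := by
    refine (ContinuousLinearMap.analyticAt _ _).fun_comp ?_
    have h2 : AnalyticAt ℂ (fun x : Coord d k × ℂ =>
        jetV c k fun lam => (D.M x.2 lam : Matrix (Fin d) (Fin d) ℂ)) (coord g, u 0) :=
      AnalyticAt.fun_comp (f := fun x : Coord d k × ℂ => x.2)
        (analyticAt_jetV_M D hc hu) analyticAt_snd
    exact ((mulV d c k).analyticAt_bilinear _).comp₂ h2 analyticAt_fst
  have h3 : AnalyticAt ℂ (fun x : Coord d k × ℂ => zr (mulV d c k (coord B)
      (mulV d c k (jetV c k fun lam => (D.M x.2 lam : Matrix (Fin d) (Fin d) ℂ)) x.1)))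
      (coord g, u 0) := by
    refine AnalyticAt.fun_comp (g := zr) ?_ h1
    simp only
    rw [← coord_rho, ← coord_mul, ← coord_mul]
    exact hz.analytic _ h
  refine h3.congr ?_
  have h4 : ∀ᶠ w in 𝓝 (coord g), ∃ g' : LieG d c k, w = coord g' :=
    eventually_nhds_coord.2 (Filter.Eventually.of_forall fun g' => ⟨g', rfl⟩)
  filter_upwards [(continuousAt_fst (p := (coord g, u 0))).eventually h4] with x hx
  obtain ⟨w, s⟩ := x
  obtain ⟨g', rfl⟩ := hx
  simp only
  rw [rep_coord, ← coord_rho, ← coord_mul, ← coord_mul, hzr, rep_coord, zz_apply, Nat.cast_succ,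
    trans_update, mul_assoc]

/-- `z_r = F(z_0, …, z_{r-1}, u)` locally. -/
theorem exists_shiftGivenBy (hc : ∀ p, c p ∈ D.lamDom) (hr : 0 < r) (hz : IsFunctionOn z Y)
    (hinv : LeftInvariant D (r - 1) z Y) {K : Submodule ℂ (Coord d k)} (hK : IsTangent H r K)
    {ξ : Pt d c k} (hξ : ξ ∈ admissible D c k) (hloc : LocalCoordsAt D z Y r ξ)
    (h : ZDefinedAt D Y r ξ) :
    ∃ Fz : AnalyticFn (Win 0 (r - 1) × ℂ), ShiftGivenBy D z Fz ξ := by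
  obtain ⟨ψ, hψ⟩ := LocalCoordsAt.exists_analyticFn D hz hK (g := ξ.1) (u := ξ.2) hloc
    (Φ := fun s g => zz D z r (g, Function.update ξ.2 0 s))
    (fun s g h hh => zz_mul_of_mem D r _ g hh) (analyticAt_rep_zz_update D hc hr hz (hξ 0) h)
  refine ⟨ψ, ?_⟩
  have hc2 : Filter.Tendsto (fun η : Pt d c k => (η.1, η.2 0)) (𝓝 ξ) (𝓝 (ξ.1, ξ.2 0)) := by
    have : Continuous fun η : Pt d c k => (η.1, η.2 0) :=
      continuous_fst.prodMk ((continuous_apply 0).comp continuous_snd)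
    exact this.tendsto ξ
  filter_upwards [hc2.eventually hψ, eventually_zz_update D hc hr hz.isOpen hinv hξ h,
    LocalCoordsAt.eventually_win_zSeq D hc hz hinv hξ hloc] with η h1 h2 h3
  rw [h2, h3]
  exact h1

theorem totalDt_pull (η : Pt d c k) :
    totalDt D (pull z) η = fderiv ℂ (rep fun g : LieG d c k => z (g : LieG d c k ⧸ H)) (coord η.1)
      (mulV d c k (jetV c k (D.U (win a b η.2))) (coord η.1)) := by
  rw [totalDt]
  have h1 : ∀ l : ℤ, deriv (fun s : ℂ => pull z (η.1, Function.update η.2 l s)) (η.2 l) *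
      F.eval (shiftSeq l η.2) = 0 := fun l => by
    have : (fun s : ℂ => pull z (η.1, Function.update η.2 l s)) = fun _ => pull z η := rfl
    rw [this, deriv_const, zero_mul]
  simp only [h1, finsum_zero, add_zero]
  rw [jetV, coord, mulV_coordMat]
  rfl

/-- `D_t(z) = Q(z_0, …, z_{r-1}, u_a, …, u_b)` locally. -/
theorem exists_derivGivenBy (hc : ∀ p, c p ∈ D.lamDom) (hr : 0 < r) (hz : IsFunctionOn z Y)
    (hinv : LeftInvariant D (r - 1) z Y) {K : Submodule ℂ (Coord d k)} (hK : IsTangent H r K)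
    {ξ : Pt d c k} (hξ : ξ ∈ admissible D c k) (hloc : LocalCoordsAt D z Y r ξ)
    (hU : win a b ξ.2 ∈ D.domU) :
    ∃ Q : AnalyticFn (Win 0 (r - 1) × Win a b), DerivGivenBy D z Q ξ := by
  classical
  set zr := rep fun g' : LieG d c k => z (g' : LieG d c k ⧸ H) with hzr
  let Φ : Win a b → LieG d c k → ℂ := fun x g =>
    if (g : LieG d c k ⧸ H) ∈ Y then
      fderiv ℂ zr (coord g) (mulV d c k (jetV c k (D.U x)) (coord g)) else 0
  -- right translations by elements of `H` preserve both `z` and the left multiplication by `U`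
  have hΦ : ∀ x g, ∀ h ∈ H, Φ x (g * h) = Φ x g := by
    intro x g h hh
    by_cases hg : (g : LieG d c k ⧸ H) ∈ Y
    · simp only [Φ, mk_mul_eq_of_mem g hh, hg, if_true]
      have h1 : HasFDerivAt zr (fderiv ℂ zr (coord (g * h))) ((mulV d c k).flip (coord h)
          (coord g)) := by
        rw [ContinuousLinearMap.flip_apply, ← coord_mul]
        exact (hz.analytic _ (by rw [mk_mul_eq_of_mem g hh]; exact hg)).differentiableAt.hasFDerivAt
      have h2 := h1.comp (coord g) ((mulV d c k).flip (coord h)).hasFDerivAt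
      have h3 : HasFDerivAt zr ((fderiv ℂ zr (coord (g * h))).comp
          ((mulV d c k).flip (coord h))) (coord g) := by
        refine h2.congr_of_eventuallyEq ?_
        refine eventually_nhds_coord.2 (Filter.Eventually.of_forall fun g' => ?_)
        rw [Function.comp, ContinuousLinearMap.flip_apply, ← coord_mul, hzr, rep_coord, rep_coord,
          mk_mul_eq_of_mem g' hh]
      rw [h3.fderiv, ContinuousLinearMap.comp_apply, ContinuousLinearMap.flip_apply, mulV_assoc,
        coord_mul]
    · simp only [Φ, mk_mul_eq_of_mem g hh, hg, if_false]
  have hY0 : (ξ.1 : LieG d c k ⧸ H) ∈ Y := hloc.1 ⟨0, hr⟩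
  have hYev : ∀ᶠ g : LieG d c k in 𝓝 ξ.1, (g : LieG d c k ⧸ H) ∈ Y :=
    continuous_mk.continuousAt.eventually (hz.isOpen.mem_nhds hY0)
  have ha : AnalyticAt ℂ (fun x : Coord d k × Win a b => rep (Φ x.2) x.1)
      (coord ξ.1, win a b ξ.2) := by
    have h1 : AnalyticAt ℂ (fun x : Coord d k × Win a b =>
        mulV d c k (jetV c k (D.U x.2)) x.1) (coord ξ.1, win a b ξ.2) := by
      have h2 : AnalyticAt ℂ (fun x : Coord d k × Win a b => jetV c k (D.U x.2))
          (coord ξ.1, win a b ξ.2) :=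
        AnalyticAt.fun_comp (f := fun x : Coord d k × Win a b => x.2)
          (analyticAt_jetV_U D hc hU) analyticAt_snd
      exact ((mulV d c k).analyticAt_bilinear _).comp₂ h2 analyticAt_fst
    have h2 : AnalyticAt ℂ (fun x : Coord d k × Win a b => fderiv ℂ zr x.1)
        (coord ξ.1, win a b ξ.2) :=
      AnalyticAt.fun_comp (f := fun x : Coord d k × Win a b => x.1)
        (hz.analytic _ hY0).fderiv analyticAt_fst
    refine (((ContinuousLinearMap.id ℂ
      (Coord d k →L[ℂ] ℂ)).analyticAt_bilinear _).comp₂ h2 h1).congr ?_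
    have h4 : ∀ᶠ w in 𝓝 (coord ξ.1), ∃ g' : LieG d c k, w = coord g' ∧
        (g' : LieG d c k ⧸ H) ∈ Y :=
      eventually_nhds_coord.2 (hYev.mono fun g' hg' => ⟨g', rfl, hg'⟩)
    filter_upwards [(continuousAt_fst (p := (coord ξ.1, win a b ξ.2))).eventually h4] with x hx
    obtain ⟨w, s⟩ := x
    obtain ⟨g', rfl, hg'⟩ := hx
    simp only [rep_coord, Φ, hg', if_true]
    rfl
  obtain ⟨ψ, hψ⟩ := LocalCoordsAt.exists_analyticFn D hz hK (g := ξ.1) (u := ξ.2) hloc hΦ ha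
  refine ⟨ψ, ?_⟩
  have hc2 : Filter.Tendsto (fun η : Pt d c k => (η.1, win a b η.2)) (𝓝 ξ)
      (𝓝 (ξ.1, win a b ξ.2)) := by
    have : Continuous fun η : Pt d c k => (η.1, win a b η.2) :=
      continuous_fst.prodMk (continuous_pi fun l => (continuous_apply l.1).comp continuous_snd)
    exact this.tendsto ξ
  filter_upwards [hc2.eventually hψ, (continuousAt_fst (p := ξ)).eventually hYev,
    LocalCoordsAt.eventually_win_zSeq D hc hz hinv hξ hloc] with η h1 h2 h3
  rw [h3]
  refine ⟨h1.1, ?_⟩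
  rw [← h1.2, totalDt_pull]
  simp only [Φ, h2, if_true]
  rfl

end LocalExpressions

/-! ### Solving an equation for one variable -/

section Solve

variable {T : Type*} [NormedAddCommGroup T] [NormedSpace ℂ T] [FiniteDimensional ℂ T]

theorem exists_openPartialHomeomorph_prod {φ : T × ℂ → ℂ} {t₀ : T} {s₀ δ : ℂ}
    (hφ : AnalyticAt ℂ φ (t₀, s₀)) (hd : HasDerivAt (fun s => φ (t₀, s)) δ s₀) (hδ : δ ≠ 0) :
    ∃ e : OpenPartialHomeomorph (T × ℂ) (T × ℂ), (∀ x, e x = (x.1, φ x)) ∧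
      (t₀, s₀) ∈ e.source ∧ AnalyticAt ℂ e.symm (t₀, φ (t₀, s₀)) := by
  have := FiniteDimensional.complete ℂ T
  set L : T × ℂ →L[ℂ] ℂ := fderiv ℂ φ (t₀, s₀) with hL
  have hLd : ∀ y : ℂ, L (0, y) = y * δ := by
    intro y
    have h1 : HasDerivAt (fun s : ℂ => (t₀, s)) ((0 : T), (1 : ℂ)) s₀ :=
      (hasDerivAt_const s₀ t₀).prodMk (hasDerivAt_id s₀)
    have h2 := hφ.differentiableAt.hasFDerivAt.comp_hasDerivAt s₀ h1
    have h3 : L (0, 1) = δ := h2.unique hd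
    have h4 : ((0 : T), y) = y • ((0 : T), (1 : ℂ)) := by simp
    rw [h4, map_smul, h3, smul_eq_mul]
  let A : T × ℂ →L[ℂ] T × ℂ := (ContinuousLinearMap.fst ℂ T ℂ).prod L
  have hinj : Function.Injective A.toLinearMap := by
    rw [injective_iff_map_eq_zero]
    rintro ⟨t, y⟩ h
    have h1 : t = 0 := congrArg Prod.fst h
    subst h1
    have h2 : L (0, y) = 0 := congrArg Prod.snd h
    rw [hLd] at h2
    rcases mul_eq_zero.1 h2 with h3 | h3
    · rw [h3]; rfl
    · exact absurd h3 hδ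
  let i : (T × ℂ) ≃L[ℂ] T × ℂ :=
    (LinearEquiv.ofInjectiveEndo A.toLinearMap hinj).toContinuousLinearEquiv
  let E : T × ℂ → T × ℂ := fun x => (x.1, φ x)
  have hE : AnalyticAt ℂ E (t₀, s₀) := analyticAt_fst.prod hφ
  have hEd : HasFDerivAt E (i : T × ℂ →L[ℂ] T × ℂ) (t₀, s₀) :=
    (hasFDerivAt_fst.prodMk hφ.differentiableAt.hasFDerivAt)
  have hstrict : HasStrictFDerivAt E (i : T × ℂ →L[ℂ] T × ℂ) (t₀, s₀) := by
    have := hE.hasStrictFDerivAt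
    rwa [hEd.fderiv] at this
  exact ⟨hstrict.toOpenPartialHomeomorph E, fun x => rfl,
    hstrict.mem_toOpenPartialHomeomorph_source,
    (hstrict.toOpenPartialHomeomorph E).analyticAt_symm'
      hstrict.mem_toOpenPartialHomeomorph_source hE hEd.fderiv⟩

/-- Splitting the variables `v_0, …, v_r` into `(v_0, …, v_{r-1})` and `v_r`. -/
def splitWin (r : ℕ) : Win 0 r →L[ℂ] Win 0 (r - 1) × ℂ :=
  (ContinuousLinearMap.pi fun l : Set.Icc (0 : ℤ) (r - 1) =>
    ContinuousLinearMap.proj (⟨l.1, l.2.1, by have := l.2.2; omega⟩ : Set.Icc (0 : ℤ) r)).prod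
    (ContinuousLinearMap.proj (⟨r, by omega, le_rfl⟩ : Set.Icc (0 : ℤ) r))

theorem splitWin_win (r : ℕ) (v : ℤ → ℂ) : splitWin r (win 0 r v) = (win 0 (r - 1) v, v r) := rfl

theorem win_update_last (r : ℕ) (v : ℤ → ℂ) (y : ℂ) :
    win 0 (r - 1) (Function.update v r y) = win 0 (r - 1) v := by
  funext l
  have := l.2.2
  rw [win, win, Function.update_of_ne (by omega)]

end Solve

section SolveShift

variable {d m : ℕ} {c : Fin m → ℂ} {k : Fin m → ℕ}
variable {α β : ℤ} {F : LatticeFn α β} {a b : ℤ} (D : DarbouxLax d F a b)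
variable {H : Subgroup (LieG d c k)} {z : LieG d c k ⧸ H → ℂ} {Y : Set (LieG d c k ⧸ H)} {r : ℕ}

/-- Where `∂z_r/∂u ≠ 0`, the equation `z_r = F(z_0, …, z_{r-1}, u)` can be solved for `u`. -/
theorem exists_solvesAt (hc : ∀ p, c p ∈ D.lamDom) (hz : IsFunctionOn z Y)
    (hinv : LeftInvariant D (r - 1) z Y) {ξ : Pt d c k} (hξ : ξ ∈ admissible D c k)
    (hloc : LocalCoordsAt D z Y r ξ) (hd : dzdu D z r ξ ≠ 0)
    {Fz : AnalyticFn (Win 0 (r - 1) × ℂ)} (hF : ShiftGivenBy D z Fz ξ) :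
    ∃ f : LatticeFn 0 r, SolvesAt D z Fz f ξ := by
  set t₀ := win 0 (r - 1) (zSeq D z ξ) with ht₀
  have hFa : AnalyticAt ℂ Fz.toFun (t₀, ξ.2 0) := Fz.analytic _ hF.self_of_nhds.1
  have hFd : DifferentiableAt ℂ (fun s => Fz.toFun (t₀, s)) (ξ.2 0) := by
    have h1 : AnalyticAt ℂ (fun s => Fz.toFun (t₀, s)) (ξ.2 0) :=
      AnalyticAt.fun_comp (f := fun s : ℂ => (t₀, s)) hFa (analyticAt_const.prod analyticAt_id)
    exact h1.differentiableAt
  have hδ : deriv (fun s => Fz.toFun (t₀, s)) (ξ.2 0) = dzdu D z r ξ := by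
    rw [dzdu]
    refine Filter.EventuallyEq.deriv_eq ?_
    have hc2 : Filter.Tendsto (fun s : ℂ => ((ξ.1, Function.update ξ.2 0 s) : Pt d c k))
        (𝓝 (ξ.2 0)) (𝓝 ξ) := by
      have h := (continuous_update_snd (d := d) (c := c) (k := k) ξ.1 ξ.2 0).tendsto (ξ.2 0)
      rwa [Function.update_eq_self] at h
    have hw := LocalCoordsAt.eventually_win_zSeq D hc hz hinv hξ hloc
    have h0 := hw.self_of_nhds
    filter_upwards [hc2.eventually hF, hc2.eventually hw] with s h1 h2
    have h3 := h1.2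
    rw [h2, ← h0, Function.update_self] at h3
    exact h3.symm
  obtain ⟨e, he1, he2, he3⟩ := exists_openPartialHomeomorph_prod hFa hFd.hasDerivAt
    (by rw [hδ]; exact hd)
  refine ⟨AnalyticFn.ofFun fun v => (e.symm (splitWin r v)).2, ?_⟩
  have hc3 : Filter.Tendsto (fun x : (ℤ → ℂ) × ℂ => (win 0 (r - 1) x.1, x.2))
      (𝓝 (zSeq D z ξ, ξ.2 0)) (𝓝 (t₀, ξ.2 0)) := by
    have : Continuous fun x : (ℤ → ℂ) × ℂ => (win 0 (r - 1) x.1, x.2) :=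
      (continuous_pi fun l => (continuous_apply l.1).comp continuous_fst).prodMk continuous_snd
    exact this.tendsto _
  have hc4 : Filter.Tendsto e (𝓝 (t₀, ξ.2 0)) (𝓝 (t₀, Fz.toFun (t₀, ξ.2 0))) := by
    have := (e.continuousAt he2).tendsto
    rwa [he1] at this
  filter_upwards [hc3.eventually (e.open_source.mem_nhds he2),
    hc3.eventually (hc4.eventually he3.eventually_analyticAt)] with x h1 h2
  have hsplit : splitWin r (win 0 r (Function.update x.1 r
      (Fz.toFun (win 0 (r - 1) x.1, x.2)))) = e (win 0 (r - 1) x.1, x.2) := by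
    rw [splitWin_win, win_update_last, Function.update_self, he1]
  constructor
  · change AnalyticAt ℂ (fun v => (e.symm (splitWin r v)).2) _
    refine AnalyticAt.fun_comp (g := Prod.snd) analyticAt_snd ?_
    refine AnalyticAt.fun_comp (g := e.symm) ?_ ((splitWin r).analyticAt _)
    rw [hsplit]
    exact h2
  · change (e.symm (splitWin r (win 0 r _))).2 = x.2
    rw [hsplit, e.left_inv h1]

end SolveShift

/-! ### The variables `v_j = z_j` near a point -/

section Lift

variable {d m : ℕ} {c : Fin m → ℂ} {k : Fin m → ℕ}
variable {α β : ℤ} {F : LatticeFn α β} {a b : ℤ} (D : DarbouxLax d F a b)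
variable {H : Subgroup (LieG d c k)} {z : LieG d c k ⧸ H → ℂ} {Y : Set (LieG d c k ⧸ H)} {r : ℕ}

theorem continuous_win (p q : ℤ) : Continuous (win p q) :=
  continuous_pi fun l => continuous_apply l.1

theorem LatticeFn.eval_congr {p q : ℤ} (f : LatticeFn p q) {u v : ℤ → ℂ}
    (h : win p q u = win p q v) : f.eval u = f.eval v := by
  rw [LatticeFn.eval, LatticeFn.eval, h]

theorem LatticeFn.DefinedAt.congr {p q : ℤ} {f : LatticeFn p q} {u v : ℤ → ℂ}
    (hu : f.DefinedAt u) (h : win p q u = win p q v) : f.DefinedAt v := by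
  rwa [LatticeFn.DefinedAt, ← h]

theorem LatticeFn.eventually_definedAt {p q : ℤ} {f : LatticeFn p q} {u : ℤ → ℂ}
    (hu : f.DefinedAt u) : ∀ᶠ v in 𝓝 u, f.DefinedAt v :=
  (continuous_win p q).continuousAt.eventually (f.isOpen_dom.mem_nhds hu)

theorem LatticeFn.continuousAt_eval {p q : ℤ} {f : LatticeFn p q} {u : ℤ → ℂ}
    (hu : f.DefinedAt u) : ContinuousAt f.eval u :=
  ContinuousAt.comp (f := win p q) (f.analytic _ hu).continuousAt
    (continuous_win p q).continuousAt

/-- The sequence `v` with `v_0, …, v_{r-1}` replaced by given values. -/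
def replaceHead (r : ℕ) (v : ℤ → ℂ) (t : Win 0 (r - 1)) : ℤ → ℂ := fun l =>
  if h : l ∈ Set.Icc (0 : ℤ) (r - 1) then t ⟨l, h⟩ else v l

theorem win_replaceHead (v : ℤ → ℂ) (t : Win 0 (r - 1)) :
    win 0 (r - 1) (replaceHead r v t) = t := by
  funext l
  simp only [win, replaceHead]
  rw [dif_pos l.2]

theorem continuous_replaceHead (r : ℕ) (v : ℤ → ℂ) : Continuous (replaceHead r v) := by
  refine continuous_pi fun l => ?_
  by_cases h : l ∈ Set.Icc (0 : ℤ) (r - 1)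
  · simp only [replaceHead, dif_pos h]
    exact continuous_apply _
  · simp only [replaceHead, dif_neg h]
    exact continuous_const

theorem win_ext_last {u v : ℤ → ℂ} (h : win 0 (r - 1) u = win 0 (r - 1) v) (h' : u r = v r) :
    win 0 r u = win 0 r v := by
  funext l
  by_cases hl : (l : ℤ) ≤ r - 1
  · exact congrFun h ⟨l.1, l.2.1, hl⟩
  · have := l.2.2
    have e : (l : ℤ) = r := by omega
    simp only [win, e, h']

theorem replaceHead_win (v : ℤ → ℂ) : replaceHead r v (win 0 (r - 1) v) = v := by
  funext l
  simp [replaceHead, win]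

variable {Fz : AnalyticFn (Win 0 (r - 1) × ℂ)} {f : LatticeFn 0 r}

theorem update_last_zSeq {ξ : Pt d c k} (hF : ShiftGivenBy D z Fz ξ) :
    Function.update (zSeq D z ξ) r (Fz.toFun (win 0 (r - 1) (zSeq D z ξ), ξ.2 0)) =
      zSeq D z ξ := by
  rw [← hF.self_of_nhds.2]
  exact Function.update_eq_self _ _

theorem SolvesAt.definedAt {ξ : Pt d c k} (hF : ShiftGivenBy D z Fz ξ)
    (hf : SolvesAt D z Fz f ξ) :
    f.DefinedAt (zSeq D z ξ) ∧ f.eval (zSeq D z ξ) = ξ.2 0 := by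
  have h := hf.self_of_nhds
  simp only [update_last_zSeq D hF] at h
  exact h

/-- A left inverse `f` of the equation `z_r = F(z_0, …, z_{r-1}, u)` is also a right inverse:
`F(v_0, …, v_{r-1}, f(v_0, …, v_r)) = v_r`. -/
theorem SolvesAt.eventually_right_inverse {ξ : Pt d c k} (hF : ShiftGivenBy D z Fz ξ)
    (hf : SolvesAt D z Fz f ξ) :
    ∀ᶠ v in 𝓝 (zSeq D z ξ), f.DefinedAt v ∧ Fz.toFun (win 0 (r - 1) v, f.eval v) = v r := by
  obtain ⟨hdef, heval⟩ := SolvesAt.definedAt D hF hf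
  set v₀ := zSeq D z ξ with hv₀
  set t₀ := win 0 (r - 1) v₀ with ht₀
  obtain ⟨hdom, hval⟩ := hF.self_of_nhds
  have hval' : v₀ r = Fz.toFun (t₀, ξ.2 0) := hval
  have hFa : AnalyticAt ℂ Fz.toFun (t₀, ξ.2 0) := Fz.analytic _ hdom
  have hFd : DifferentiableAt ℂ (fun s => Fz.toFun (t₀, s)) (ξ.2 0) :=
    (AnalyticAt.fun_comp (f := fun s : ℂ => (t₀, s)) hFa
      (analyticAt_const.prod analyticAt_id)).differentiableAt
  -- differentiating `f(v_0, …, v_{r-1}, F(v_0, …, v_{r-1}, s)) = s` gives `∂F/∂u ≠ 0`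
  have hδ : deriv (fun s => Fz.toFun (t₀, s)) (ξ.2 0) ≠ 0 := by
    intro h0
    have d1 : HasDerivAt (fun s => Fz.toFun (t₀, s)) 0 (ξ.2 0) := by
      rw [← h0]; exact hFd.hasDerivAt
    have d2 : DifferentiableAt ℂ (fun y : ℂ => f.toFun (win 0 r (Function.update v₀ r y)))
        (Fz.toFun (t₀, ξ.2 0)) := by
      have e1 : DifferentiableAt ℂ (fun y : ℂ => win 0 r (Function.update v₀ r y))
          (Fz.toFun (t₀, ξ.2 0)) := by
        rw [differentiableAt_pi]
        intro l
        by_cases hl : (l : ℤ) = r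
        · simp only [win, hl, Function.update_self]
          exact differentiableAt_id
        · simp only [win, Function.update_of_ne hl]
          exact differentiableAt_const _
      refine DifferentiableAt.fun_comp' _ ?_ e1
      rw [← hval', Function.update_eq_self]
      exact (f.analytic _ hdef).differentiableAt
    have d3 := d2.hasDerivAt.comp (ξ.2 0) d1
    rw [mul_zero] at d3
    have d4 : HasDerivAt (fun s : ℂ => s) 0 (ξ.2 0) := by
      refine d3.congr_of_eventuallyEq ?_
      have hc2 : Filter.Tendsto (fun s : ℂ => (v₀, s)) (𝓝 (ξ.2 0)) (𝓝 (v₀, ξ.2 0)) := by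
        have : Continuous fun s : ℂ => (v₀, s) := by fun_prop
        exact this.tendsto _
      filter_upwards [hc2.eventually hf] with s hs
      exact hs.2.symm
    exact one_ne_zero ((hasDerivAt_id (ξ.2 0)).unique d4)
  obtain ⟨e, he1, he2, he3⟩ := exists_openPartialHomeomorph_prod hFa hFd.hasDerivAt hδ
  have hsy : e.symm (t₀, Fz.toFun (t₀, ξ.2 0)) = (t₀, ξ.2 0) := by
    have := e.left_inv he2
    rwa [he1] at this
  have hmem : (t₀, Fz.toFun (t₀, ξ.2 0)) ∈ e.target := by
    have := e.map_source he2
    rwa [he1] at this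
  have hw : Filter.Tendsto (fun v : ℤ → ℂ => (win 0 (r - 1) v, v r)) (𝓝 v₀)
      (𝓝 (t₀, Fz.toFun (t₀, ξ.2 0))) := by
    have : Continuous fun v : ℤ → ℂ => (win 0 (r - 1) v, v r) :=
      (continuous_win 0 (r - 1)).prodMk (continuous_apply (r : ℤ))
    rw [← hval']
    exact this.tendsto v₀
  have hs : Filter.Tendsto (fun v : ℤ → ℂ => (v, (e.symm (win 0 (r - 1) v, v r)).2)) (𝓝 v₀)
      (𝓝 (v₀, ξ.2 0)) := by
    refine Filter.Tendsto.prodMk_nhds Filter.tendsto_id ?_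
    have h1 := (he3.continuousAt.tendsto.comp hw)
    rw [hsy] at h1
    exact (continuous_snd.tendsto _).comp h1
  filter_upwards [hw.eventually (e.open_target.mem_nhds hmem), hs.eventually hf,
    LatticeFn.eventually_definedAt hdef] with v h1 h2 h3
  refine ⟨h3, ?_⟩
  have h4 := e.right_inv h1
  rw [he1] at h4
  generalize e.symm (win 0 (r - 1) v, v r) = x at h2 h4
  have h5 : x.1 = win 0 (r - 1) v := congrArg Prod.fst h4
  have h6 : Fz.toFun (win 0 (r - 1) v, x.2) = v r := by
    rw [← h5]
    exact congrArg Prod.snd h4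
  have h7 := h2.2
  rw [h6, Function.update_eq_self] at h7
  rw [h7, h6]

/-- Near an admissible point, `u = f(z_0, …, z_r)`. -/
theorem SolvesAt.eventually_eval_zSeq (hc : ∀ p, c p ∈ D.lamDom) (hz : IsFunctionOn z Y)
    (hinv : LeftInvariant D (r - 1) z Y) {ξ : Pt d c k} (hξ : ξ ∈ admissible D c k)
    (hloc : LocalCoordsAt D z Y r ξ) (hF : ShiftGivenBy D z Fz ξ) (hf : SolvesAt D z Fz f ξ) :
    ∀ᶠ η in 𝓝 ξ, f.DefinedAt (zSeq D z η) ∧ f.eval (zSeq D z η) = η.2 0 := by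
  have hw := LocalCoordsAt.eventually_win_zSeq D hc hz hinv hξ hloc
  have h1 : Filter.Tendsto (fun η => win 0 (r - 1) (zSeq D z η)) (𝓝 ξ)
      (𝓝 (win 0 (r - 1) (zSeq D z ξ))) := by
    rw [hw.self_of_nhds]
    have h2 : Filter.Tendsto (fun η : Pt d c k => zVec D z r ξ.2 (coord η.1)) (𝓝 ξ)
        (𝓝 (zVec D z r ξ.2 (coord ξ.1))) :=
      (LocalCoordsAt.analyticAt D hz (g := ξ.1) (u := ξ.2) hloc).continuousAt.tendsto.comp
        ((continuous_coord.comp continuous_fst).tendsto ξ)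
    exact h2.congr' (hw.mono fun η hη => hη.symm)
  have h2 : Filter.Tendsto (fun η : Pt d c k =>
      (replaceHead r (zSeq D z ξ) (win 0 (r - 1) (zSeq D z η)), η.2 0)) (𝓝 ξ)
      (𝓝 (zSeq D z ξ, ξ.2 0)) := by
    have h3 := ((continuous_replaceHead r (zSeq D z ξ)).tendsto _).comp h1
    rw [replaceHead_win] at h3
    exact h3.prodMk_nhds (((continuous_apply 0).comp continuous_snd).tendsto ξ)
  filter_upwards [h2.eventually hf, hF] with η h3 h4
  simp only [win_replaceHead] at h3
  have h5 : win 0 r (Function.update (replaceHead r (zSeq D z ξ) (win 0 (r - 1) (zSeq D z η))) r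
      (Fz.toFun (win 0 (r - 1) (zSeq D z η), η.2 0))) = win 0 r (zSeq D z η) := by
    refine win_ext_last ?_ ?_
    · rw [win_update_last, win_replaceHead]
    · rw [Function.update_self, ← h4.2]; rfl
  exact ⟨h3.1.congr h5, by rw [← LatticeFn.eval_congr f h5]; exact h3.2⟩

theorem exists_local_section_group {T : Type*} [NormedAddCommGroup T] [NormedSpace ℂ T]
    {Z : Coord d k → T} {g : LieG d c k} (hZ : AnalyticAt ℂ Z (coord g))
    (hs : Function.Surjective (fderiv ℂ Z (coord g))) :
    ∃ σ : T → LieG d c k, Filter.Tendsto σ (𝓝 (Z (coord g))) (𝓝 g) ∧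
      ∀ᶠ t in 𝓝 (Z (coord g)), Z (coord (σ t)) = t := by
  obtain ⟨σ, h1, -, h3⟩ := exists_local_section hZ hs
  have h4 : ∀ᶠ t in 𝓝 (Z (coord g)), coord (Function.invFun coord (σ t) : LieG d c k) = σ t := by
    filter_upwards [h1.eventually (isOpen_range_coord.mem_nhds ⟨g, rfl⟩)] with t ht
    exact Function.invFun_eq ht
  refine ⟨fun t => Function.invFun coord (σ t), ?_, ?_⟩
  · rw [isOpenEmbedding_coord.isInducing.tendsto_nhds_iff]
    exact h1.congr' (h4.mono fun t ht => ht.symm)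
  · filter_upwards [h3, h4] with t h5 h6
    rw [h6, h5]

/-- Near a point along whose shifts the local expressions are valid, every sequence `v` of values
is realised, within a finite window, as `v_j = z_j`. -/
theorem exists_lift (hc : ∀ p, c p ∈ D.lamDom) (hz : IsFunctionOn z Y)
    (hinv : LeftInvariant D (r - 1) z Y) {Q : AnalyticFn (Win 0 (r - 1) × Win a b)}
    {ξ : Pt d c k} (hξ : ξ ∈ admissible D c k) {N : ℤ} (hN : 0 ≤ N)
    (hexp : ∀ j : ℤ, |j| ≤ N → ExpressionsAt D z Y Fz Q f ((shiftPt D ^ j) ξ)) :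
    ∃ η : (ℤ → ℂ) → Pt d c k, Filter.Tendsto η (𝓝 (zSeq D z ξ)) (𝓝 ξ) ∧
      ∀ᶠ v in 𝓝 (zSeq D z ξ), η v ∈ admissible D c k ∧
        (∀ l : ℤ, -N ≤ l → l ≤ N + r → zz D z l (η v) = v l) ∧
        ∀ l : ℤ, |l| ≤ N → (η v).2 l = f.eval (shiftSeq l v) := by
  set v₀ := zSeq D z ξ with hv₀
  -- The lift of `v` is constructed at the left end of the window, where `z_0, …, z_{r-1}` are
  -- prescribed by a local section `σ`, and is then transported by `S^N`.
  have hN' : |(-N)| ≤ N := by rw [abs_neg, abs_of_nonneg hN]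
  set ξA := (shiftPt D ^ (-N)) ξ with hξA
  have hξA' : ξA ∈ admissible D c k := admissible_zpow D hξ (-N)
  have hlocA : LocalCoordsAt D z Y r (ξA.1, ξA.2) := (hexp (-N) hN').localCoords
  have hwA := LocalCoordsAt.eventually_win_zSeq D hc hz hinv hξA' hlocA
  obtain ⟨σ, hσ1, hσ2⟩ := exists_local_section_group (LocalCoordsAt.analyticAt D hz hlocA)
    (LocalCoordsAt.surjective D hz hlocA)
  have hzA : zVec D z r ξA.2 (coord ξA.1) = win 0 (r - 1) (shiftSeq (-N) v₀) := by
    rw [← hwA.self_of_nhds, hξA, zSeq_zpow]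
  rw [hzA] at hσ1 hσ2
  -- shifting the sequence of values corresponds to shifting the point
  have hsh : ∀ j : ℤ, Filter.Tendsto (shiftSeq j) (𝓝 v₀) (𝓝 (zSeq D z ((shiftPt D ^ j) ξ))) := by
    intro j
    rw [zSeq_zpow]
    exact (continuous_shiftSeq j).tendsto v₀
  -- within the window the lattice variables are prescribed by `u_l = f(v_l, …, v_{l+r})`
  let U : (ℤ → ℂ) → ℤ → ℂ := fun v l => if |l| ≤ N then f.eval (shiftSeq l v) else ξ.2 l
  have hU : Filter.Tendsto U (𝓝 v₀) (𝓝 ξ.2) := by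
    rw [tendsto_pi_nhds]
    intro l
    by_cases hl : |l| ≤ N
    · obtain ⟨h1, h2⟩ := SolvesAt.definedAt D (hexp l hl).shift (hexp l hl).solves
      have h3 := (LatticeFn.continuousAt_eval h1).tendsto.comp (hsh l)
      rw [h2, shiftPt_zpow_snd] at h3
      simp only [U, if_pos hl]
      simpa [shiftSeq, Function.comp_def] using h3
    · simp only [U, if_neg hl]
      exact tendsto_const_nhds
  have hws : Filter.Tendsto (fun v : ℤ → ℂ => win 0 (r - 1) (shiftSeq (-N) v)) (𝓝 v₀)
      (𝓝 (win 0 (r - 1) (shiftSeq (-N) v₀))) :=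
    ((continuous_win 0 (r - 1)).comp (continuous_shiftSeq (-N))).tendsto v₀
  let ηA : (ℤ → ℂ) → Pt d c k := fun v =>
    (σ (win 0 (r - 1) (shiftSeq (-N) v)), shiftSeq (-N) (U v))
  have hηA : Filter.Tendsto ηA (𝓝 v₀) (𝓝 ξA) := by
    have h1 : Filter.Tendsto (fun v => shiftSeq (-N) (U v)) (𝓝 v₀) (𝓝 ξA.2) := by
      rw [hξA, shiftPt_zpow_snd]
      exact ((continuous_shiftSeq (-N)).tendsto _).comp hU
    exact (hσ1.comp hws).prodMk_nhds h1
  have hback : (shiftPt D ^ N) ξA = ξ := by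
    rw [hξA, ← shiftPt_zpow_add, add_neg_cancel, zpow_zero]; rfl
  let η : (ℤ → ℂ) → Pt d c k := fun v => (shiftPt D ^ N) (ηA v)
  have hη : Filter.Tendsto η (𝓝 v₀) (𝓝 ξ) := by
    have h1 := (continuousAt_shiftPt_zpow D hc hξA' N).tendsto.comp hηA
    rwa [hback] at h1
  have hη2 : ∀ v, (η v).2 = U v := fun v => by
    change ((shiftPt D ^ N) (ηA v)).2 = U v
    rw [shiftPt_zpow_snd]
    change shiftSeq N (shiftSeq (-N) (U v)) = U v
    rw [shiftSeq_shiftSeq, add_neg_cancel, shiftSeq_zero]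
  have hηback : ∀ v, (shiftPt D ^ (-N)) (η v) = ηA v := fun v => by
    change (shiftPt D ^ (-N)) ((shiftPt D ^ N) (ηA v)) = ηA v
    rw [← shiftPt_zpow_add, neg_add_cancel, zpow_zero]; rfl
  have hjets : ∀ᶠ v in 𝓝 v₀, ∀ j ∈ Set.Icc (-N) N,
      (zz D z r ((shiftPt D ^ j) (η v)) = Fz.toFun
        (win 0 (r - 1) (zSeq D z ((shiftPt D ^ j) (η v))), ((shiftPt D ^ j) (η v)).2 0)) ∧
      Fz.toFun (win 0 (r - 1) (shiftSeq j v), f.eval (shiftSeq j v)) = v (r + j) := by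
    rw [Filter.eventually_all_finite (Set.finite_Icc _ _)]
    intro j hj
    have hj' : |j| ≤ N := abs_le.2 hj
    have h1 := (continuousAt_shiftPt_zpow D hc hξ j).tendsto.comp hη
    have h2 := SolvesAt.eventually_right_inverse D (hexp j hj').shift (hexp j hj').solves
    filter_upwards [h1.eventually (hexp j hj').shift, (hsh j).eventually h2] with v h3 h4
    exact ⟨h3.2, h4.2⟩
  refine ⟨η, hη, ?_⟩
  filter_upwards [hjets, hws.eventually hσ2, hηA.eventually hwA,
    hη.eventually (eventually_mem_uDom D hξ (Set.Icc (-N) N) (Set.finite_Icc _ _))]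
    with v h1 h2 h3 h4
  refine ⟨?_, ?_, ?_⟩
  · intro l
    by_cases hl : |l| ≤ N
    · exact h4 l (abs_le.1 hl)
    · rw [hη2]
      simp only [U, if_neg hl]
      exact hξ l
  · -- induction along the window: `z_{j+r} = F(z_j, …, z_{j+r-1}, u_j)`
    have key : ∀ n : ℕ, (n : ℤ) ≤ 2 * N + 1 → ∀ l : ℤ, -N ≤ l → l < -N + r + n →
        zz D z l (η v) = v l := by
      intro n
      induction n with
      | zero =>
        intro _ l hl1 hl2
        have h5 : win 0 (r - 1) (zSeq D z (ηA v)) = win 0 (r - 1) (shiftSeq (-N) v) := by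
          rw [h3]; exact h2
        have h6 := congrFun h5 ⟨l + N, by omega, by push_cast at hl2; omega⟩
        simp only [win, zSeq, shiftSeq] at h6
        rw [← hηback, zz_zpow, add_neg_cancel_right] at h6
        exact h6
      | succ n ih =>
        intro hn l hl1 hl2
        push_cast at hn hl2
        have ih' := ih (by omega)
        by_cases hl : l < -N + r + n
        · exact ih' l hl1 hl
        · have hj : l - r ∈ Set.Icc (-N) N := ⟨by omega, by omega⟩
          obtain ⟨h5, h6⟩ := h1 _ hj
          have h7 : win 0 (r - 1) (zSeq D z ((shiftPt D ^ (l - r)) (η v))) =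
              win 0 (r - 1) (shiftSeq (l - r) v) := by
            funext i
            have hi1 := i.2.1
            have hi2 := i.2.2
            simp only [win, zSeq, zz_zpow, shiftSeq]
            exact ih' _ (by omega) (by omega)
          have h8 : ((shiftPt D ^ (l - r)) (η v)).2 0 = f.eval (shiftSeq (l - r) v) := by
            rw [shiftPt_zpow_snd, hη2]
            simp only [shiftSeq, zero_add, U]
            rw [if_pos (abs_le.2 hj)]
          rw [h7, h8, h6, zz_zpow] at h5
          rwa [add_sub_cancel] at h5
    intro l hl1 hl2
    exact key (2 * N + 1).toNat (by omega) l hl1 (by omega)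
  · intro l hl
    rw [hη2]
    simp only [U, if_pos hl]

end Lift

/-! ### The evolution along the lattice equation -/

section Evolution

variable {d m : ℕ} {c : Fin m → ℂ} {k : Fin m → ℕ}
variable {α β : ℤ} {F : LatticeFn α β} {a b : ℤ} (D : DarbouxLax d F a b)
variable {H : Subgroup (LieG d c k)} {z : LieG d c k ⧸ H → ℂ} {Y : Set (LieG d c k ⧸ H)} {r : ℕ}

/-- The equation `D_t(M) = S(U) M - M U` for the Taylor expansions at the points `c_p`. -/
theorem zero_curvature_jetV (hc : ∀ p, c p ∈ D.lamDom) {u : ℤ → ℂ} (hu : ∀ l, u l ∈ D.uDom)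
    (hF : F.DefinedAt u) (h0 : win a b u ∈ D.domU) (h1 : win a b (shiftSeq 1 u) ∈ D.domU) :
    F.eval u • jetV c k (derivM D (u 0)) =
      mulV d c k (jetV c k (D.U (win a b (shiftSeq 1 u)))) (coord (rho (D.M (u 0)) : LieG d c k)) -
        mulV d c k (coord (rho (D.M (u 0)) : LieG d c k)) (jetV c k (D.U (win a b u))) := by
  have hM := D.matAnalytic_M hc (hu 0)
  have hU0 := D.matAnalytic_U hc h0
  have hU1 := D.matAnalytic_U hc h1
  rw [coord_rho, ← jetV_mul hU1 hM, ← jetV_mul hM hU0, ← jetV_sub (hU1.mul hM) (hM.mul hU0),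
    ← jetV_smul]
  refine jetV_congr fun p => ?_
  filter_upwards [D.isOpen_lamDom.mem_nhds (hc p)] with lam hlam
  rw [← D.zero_curvature u hu hF h0 h1 lam hlam]
  rfl

/-- Every tangent vector of `G` is the velocity of a curve in `G`. -/
theorem exists_curve_group (g : LieG d c k) (w : Coord d k) :
    ∃ γ : ℂ → LieG d c k, γ 0 = g ∧ HasDerivAt (fun t => coord (γ t)) w 0 := by
  have h1 : HasDerivAt (fun t : ℂ => coord g + t • w) w 0 := by
    have := ((hasDerivAt_id (0 : ℂ)).smul_const w).const_add (coord g)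
    simpa using this
  refine ⟨fun t => Function.invFun coord (coord g + t • w), ?_, ?_⟩
  · simp only [zero_smul, add_zero]
    exact Function.leftInverse_invFun coord_injective g
  · refine h1.congr_of_eventuallyEq ?_
    have h2 : Filter.Tendsto (fun t : ℂ => coord g + t • w) (𝓝 0) (𝓝 (coord g)) := by
      have := h1.continuousAt.tendsto
      simpa only [zero_smul, add_zero] using this
    filter_upwards [h2.eventually (isOpen_range_coord.mem_nhds ⟨g, rfl⟩)] with t ht
    exact Function.invFun_eq ht

/-- `D_t` commutes with the shift: along a curve with velocity `D_t`, the velocity of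
`S^l` of the group variable is `S^l(U)` times it. -/
theorem hasDerivAt_coord_trans (hc : ∀ p, c p ∈ D.lamDom) {γ : ℂ → LieG d c k}
    {u : ℂ → ℤ → ℂ} (hu : ∀ l, u 0 l ∈ D.uDom)
    (hγ : HasDerivAt (fun t => coord (γ t))
      (mulV d c k (jetV c k (D.U (win a b (u 0)))) (coord (γ 0))) 0) (n : ℕ)
    (hud : ∀ l : ℕ, l < n → HasDerivAt (fun t => u t l) (F.eval (shiftSeq l (u 0))) 0)
    (hF : ∀ l : ℕ, l < n → F.DefinedAt (shiftSeq l (u 0)))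
    (hU : ∀ l : ℕ, l ≤ n → win a b (shiftSeq l (u 0)) ∈ D.domU) :
    HasDerivAt (fun t => coord (trans D n (u t) * γ t))
      (mulV d c k (jetV c k (D.U (win a b (shiftSeq n (u 0)))))
        (coord (trans D n (u 0) * γ 0))) 0 := by
  induction n with
  | zero => simpa [trans_zero, shiftSeq_zero] using hγ
  | succ n ih =>
    have ih' := ih (fun l hl => hud l (by omega)) (fun l hl => hF l (by omega))
      (fun l hl => hU l (by omega))
    have hM : HasDerivAt (fun t => coord (rho (D.M (u t n)) : LieG d c k))
        (F.eval (shiftSeq n (u 0)) • jetV c k (derivM D (u 0 n))) 0 :=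
      HasDerivAt.scomp (h := fun t => u t n) (0 : ℂ) (hasDerivAt_jetV_M D hc (hu n))
        (hud n (Nat.lt_succ_self n))
    have hmul := ((mulV d c k).hasFDerivAt.comp_hasDerivAt (0 : ℂ) hM).clm_apply ih'
    have hcoord : ∀ t, coord (trans D ((n + 1 : ℕ) : ℤ) (u t) * γ t) =
        mulV d c k (coord (rho (D.M (u t n)) : LieG d c k)) (coord (trans D n (u t) * γ t)) := by
      intro t
      rw [Nat.cast_succ, add_comm, trans_one_add, mul_assoc, coord_mul]
    simp only [hcoord]
    refine hmul.congr_deriv ?_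
    have hzc := zero_curvature_jetV (k := k) D hc (u := shiftSeq n (u 0)) (fun l => hu _)
      (hF n (Nat.lt_succ_self n)) (hU n (Nat.le_succ n)) (by
        rw [shiftSeq_shiftSeq, add_comm]; exact_mod_cast hU (n + 1) le_rfl)
    have e0 : shiftSeq n (u 0) 0 = u 0 n := by simp [shiftSeq]
    rw [e0, shiftSeq_shiftSeq] at hzc
    have e1 : (1 : ℤ) + n = ((n + 1 : ℕ) : ℤ) := by push_cast; ring
    rw [e1] at hzc
    -- the term `M U` of the zero-curvature equation cancels the one from the factor `ih'`
    rw [hzc, map_sub, _root_.sub_apply, mulV_assoc, mulV_assoc]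
    simp only [Function.comp]
    rw [sub_add_cancel]

theorem hasDerivAt_zz (hc : ∀ p, c p ∈ D.lamDom) (hz : IsFunctionOn z Y) {γ : ℂ → LieG d c k}
    {u : ℂ → ℤ → ℂ} (hu : ∀ l, u 0 l ∈ D.uDom)
    (hγ : HasDerivAt (fun t => coord (γ t))
      (mulV d c k (jetV c k (D.U (win a b (u 0)))) (coord (γ 0))) 0) (n : ℕ)
    (hud : ∀ l : ℕ, l < n → HasDerivAt (fun t => u t l) (F.eval (shiftSeq l (u 0))) 0)
    (hF : ∀ l : ℕ, l < n → F.DefinedAt (shiftSeq l (u 0)))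
    (hU : ∀ l : ℕ, l ≤ n → win a b (shiftSeq l (u 0)) ∈ D.domU)
    (hY : ZDefinedAt D Y n (γ 0, u 0)) :
    HasDerivAt (fun t => zz D z n (γ t, u t))
      (totalDt D (pull z) ((shiftPt D ^ (n : ℤ)) (γ 0, u 0))) 0 := by
  have h1 := hasDerivAt_coord_trans D hc hu hγ n hud hF hU
  rw [zDefinedAt_iff] at hY
  have h2 := (hz.analytic _ hY).differentiableAt.hasFDerivAt.comp_hasDerivAt (0 : ℂ) h1
  rw [totalDt_pull, shiftPt_zpow]
  refine h2.congr_of_eventuallyEq (Filter.Eventually.of_forall fun t => ?_)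
  simp only [Function.comp]
  rw [rep_coord, zz_apply]

theorem LatticeFn.deriv_eval_update {p q : ℤ} {f : LatticeFn p q} {v : ℤ → ℂ}
    (hf : f.DefinedAt v) (l : Set.Icc p q) :
    deriv (fun x : ℂ => f.eval (Function.update v l x)) (v l) =
      fderiv ℂ f.toFun (win p q v) (Pi.single l 1) := by
  have h1 : HasDerivAt (fun x : ℂ => win p q (Function.update v l x)) (Pi.single l 1) (v l) := by
    rw [hasDerivAt_pi]
    intro i
    by_cases hi : i = l
    · subst hi
      simp only [win, Function.update_self, Pi.single_eq_same]
      exact hasDerivAt_id _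
    · have hi' : (i : ℤ) ≠ l := fun h => hi (Subtype.ext h)
      simp only [win, Function.update_of_ne hi', Pi.single_eq_of_ne hi]
      exact hasDerivAt_const _ _
  have h2 : HasFDerivAt f.toFun (fderiv ℂ f.toFun (win p q v))
      (win p q (Function.update v l (v l))) := by
    rw [Function.update_eq_self]
    exact (f.analytic _ hf).differentiableAt.hasFDerivAt
  exact (h2.comp_hasDerivAt (v l) h1).deriv

/-- The chain rule for functions of lattice variables. -/
theorem LatticeFn.fderiv_apply_eq_sum {p q : ℤ} {f : LatticeFn p q} {v : ℤ → ℂ}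
    (hf : f.DefinedAt v) (y : ℤ → ℂ) :
    fderiv ℂ f.toFun (win p q v) (win p q y) = ∑ l ∈ Finset.Icc p q,
      y l * deriv (fun x : ℂ => f.eval (Function.update v l x)) (v l) := by
  rw [Finset.sum_subtype (Finset.Icc p q) (p := fun l => l ∈ Set.Icc p q) (by simp)
    (fun l => y l * deriv (fun x : ℂ => f.eval (Function.update v l x)) (v l))]
  have h1 : win p q y = ∑ l : Set.Icc p q, y l • (Pi.single l 1 : Win p q) := by
    funext i
    simp [win, Finset.sum_apply, Pi.single_apply]
  rw [h1, map_sum]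
  refine Finset.sum_congr rfl fun l _ => ?_
  rw [map_smul, smul_eq_mul, LatticeFn.deriv_eval_update hf]

/-- Differentiating `f(z_0, …, z_r) = u` by virtue of the lattice equation. -/
theorem sum_totalDt_mul_deriv (hc : ∀ p, c p ∈ D.lamDom) (hz : IsFunctionOn z Y)
    {f : LatticeFn 0 r} {η : Pt d c k} (hη : η ∈ admissible D c k)
    (hF : ∀ l : ℕ, l ≤ r → F.DefinedAt (shiftSeq l η.2))
    (hU : ∀ l : ℕ, l ≤ r → win a b (shiftSeq l η.2) ∈ D.domU)
    (hY : ∀ l : ℕ, l ≤ r → ZDefinedAt D Y l η)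
    (hf : ∀ᶠ η' in 𝓝 η, f.DefinedAt (zSeq D z η') ∧ f.eval (zSeq D z η') = η'.2 0) :
    ∑ l ∈ Finset.Icc (0 : ℤ) r, totalDt D (pull z) ((shiftPt D ^ l) η) *
      deriv (fun x : ℂ => f.eval (Function.update (zSeq D z η) l x)) (zSeq D z η l) =
        F.eval η.2 := by
  -- Only finitely many `u_l` matter, so a curve with velocity `D_t` in the variables involved can be
  -- written down: the lattice equation itself need not be solvable.
  obtain ⟨g, u⟩ := η
  obtain ⟨γ, hγ0, hγ⟩ := exists_curve_group g
    (mulV d c k (jetV c k (D.U (win a b u))) (coord g))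
  let ut : ℂ → ℤ → ℂ := fun t l =>
    if l ∈ Set.Icc (0 : ℤ) r then u l + t * F.eval (shiftSeq l u) else u l
  have hut0 : ut 0 = u := by funext l; simp [ut]
  have hutd : ∀ l : ℕ, l ≤ r → HasDerivAt (fun t => ut t l) (F.eval (shiftSeq l u)) 0 := by
    intro l hl
    have hl' : (l : ℤ) ∈ Set.Icc (0 : ℤ) r := ⟨by omega, by omega⟩
    simp only [ut, if_pos hl']
    simpa using ((hasDerivAt_id (0 : ℂ)).mul_const (F.eval (shiftSeq l u))).const_add (u l)
  have hutc : Filter.Tendsto ut (𝓝 0) (𝓝 u) := by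
    have : Continuous ut := by
      refine continuous_pi fun l => ?_
      by_cases hl : l ∈ Set.Icc (0 : ℤ) r
      · simp only [ut, if_pos hl]; fun_prop
      · simp only [ut, if_neg hl]; fun_prop
    have h := this.tendsto 0
    rwa [hut0] at h
  have hγc : Filter.Tendsto γ (𝓝 0) (𝓝 g) := by
    rw [isOpenEmbedding_coord.isInducing.tendsto_nhds_iff]
    have := hγ.continuousAt.tendsto
    rwa [hγ0] at this
  subst hγ0
  have hcurve : Filter.Tendsto (fun t => ((γ t, ut t) : Pt d c k)) (𝓝 0) (𝓝 (γ 0, u)) :=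
    hγc.prodMk_nhds hutc
  have hzd : HasDerivAt (fun t => win 0 r (zSeq D z (γ t, ut t)))
      (win 0 r fun l => totalDt D (pull z) ((shiftPt D ^ l) (γ 0, u))) 0 := by
    rw [hasDerivAt_pi]
    intro l
    have hl1 := l.2.1
    have hl2 := l.2.2
    obtain ⟨j, hj⟩ : ∃ j : ℕ, (j : ℤ) = l := ⟨l.1.toNat, by omega⟩
    have hjr : j ≤ r := by omega
    have h1 := hasDerivAt_zz D hc hz (γ := γ) (u := ut) (by rw [hut0]; exact hη)
      (by rw [hut0]; exact hγ) j (fun i hi => by rw [hut0]; exact hutd i (by omega))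
      (fun i hi => by rw [hut0]; exact hF i (by omega))
      (fun i hi => by rw [hut0]; exact hU i (by omega)) (by rw [hut0]; exact hY j hjr)
    rw [hut0, hj] at h1
    exact h1
  have hdef := hf.self_of_nhds.1
  have h2 : HasFDerivAt f.toFun (fderiv ℂ f.toFun (win 0 r (zSeq D z (γ 0, u))))
      (win 0 r (zSeq D z (γ 0, ut 0))) := by
    rw [hut0]
    exact (f.analytic _ hdef).differentiableAt.hasFDerivAt
  have h3 := h2.comp_hasDerivAt (0 : ℂ) hzd
  have h4 : HasDerivAt (fun t => ut t 0) (F.eval u) 0 := by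
    have := hutd 0 (Nat.zero_le r)
    simpa [shiftSeq_zero] using this
  have h5 : (f.toFun ∘ fun t => win 0 r (zSeq D z (γ t, ut t))) =ᶠ[𝓝 0] fun t => ut t 0 := by
    filter_upwards [hcurve.eventually hf] with t ht
    exact ht.2
  rw [← LatticeFn.fderiv_apply_eq_sum hdef fun l => totalDt D (pull z) ((shiftPt D ^ l) (γ 0, u))]
  exact h3.unique (h4.congr_of_eventuallyEq h5)

theorem modArgs_win (f : LatticeFn 0 r) (v : ℤ → ℂ) :
    modArgs f (win (min a 0) (max (b + r) (r - 1)) v) =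
      (win 0 (r - 1) v, win a b fun j => f.eval (shiftSeq j v)) := by
  refine Prod.ext ?_ ?_
  · funext l
    change v (l.1 + 0) = v l.1
    rw [add_zero]
  · rfl

/-- `u = f(v_0, …, v_r)` is a Miura-type transformation near the values `v_j = z_j` at a point
along whose shifts the local expressions are valid. -/
theorem exists_isMiuraOn (hc : ∀ p, c p ∈ D.lamDom) (hz : IsFunctionOn z Y)
    (hinv : LeftInvariant D (r - 1) z Y) {Fz : AnalyticFn (Win 0 (r - 1) × ℂ)}
    {Q : AnalyticFn (Win 0 (r - 1) × Win a b)} {f : LatticeFn 0 r}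
    {ξ : Pt d c k} (hξ : ξ ∈ admissible D c k)
    (hexp : ∀ j : ℤ, |j| ≤ |α| + |β| + |a| + |b| + r →
      ExpressionsAt D z Y Fz Q f ((shiftPt D ^ j) ξ)) :
    ∃ 𝒱 : Set (ℤ → ℂ), IsOpen 𝒱 ∧ zSeq D z ξ ∈ 𝒱 ∧ IsMiuraOn (modified f Q) F f 𝒱 := by
  set N : ℤ := |α| + |β| + |a| + |b| + r with hNdef
  have hα := abs_nonneg α
  have hβ := abs_nonneg β
  have ha := abs_nonneg a
  have hb := abs_nonneg b
  have hα1 := neg_abs_le α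
  have hα2 := le_abs_self α
  have hβ1 := neg_abs_le β
  have hβ2 := le_abs_self β
  have ha1 := neg_abs_le a
  have ha2 := le_abs_self a
  have hb1 := neg_abs_le b
  have hb2 := le_abs_self b
  have hN : 0 ≤ N := by omega
  obtain ⟨η, hη, hlift⟩ := exists_lift D hc hz hinv hξ hN hexp
  have hshift : ∀ j : ℤ, Filter.Tendsto (fun v => (shiftPt D ^ j) (η v)) (𝓝 (zSeq D z ξ))
      (𝓝 ((shiftPt D ^ j) ξ)) := fun j =>
    (continuousAt_shiftPt_zpow D hc hξ j).tendsto.comp hη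
  have hjets : ∀ᶠ v in 𝓝 (zSeq D z ξ), ∀ j ∈ Set.Icc (-N) N,
      f.DefinedAt (shiftSeq j v) ∧ F.DefinedAt (shiftSeq j (η v).2) ∧
      win a b (shiftSeq j (η v).2) ∈ D.domU ∧ ZDefinedAt D Y j (η v) ∧
      (win 0 (r - 1) (zSeq D z ((shiftPt D ^ j) (η v))), win a b (shiftSeq j (η v).2)) ∈ Q.dom ∧
      totalDt D (pull z) ((shiftPt D ^ j) (η v)) = Q.toFun
        (win 0 (r - 1) (zSeq D z ((shiftPt D ^ j) (η v))), win a b (shiftSeq j (η v).2)) := by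
    rw [Filter.eventually_all_finite (Set.finite_Icc _ _)]
    intro j hj
    have he := hexp j (abs_le.2 hj)
    have h1 : Filter.Tendsto (shiftSeq j) (𝓝 (zSeq D z ξ))
        (𝓝 (zSeq D z ((shiftPt D ^ j) ξ))) := by
      rw [zSeq_zpow]; exact (continuous_shiftSeq j).tendsto _
    have h2 : Filter.Tendsto (fun v => shiftSeq j (η v).2) (𝓝 (zSeq D z ξ))
        (𝓝 ((shiftPt D ^ j) ξ).2) := by
      rw [shiftPt_zpow_snd]
      exact ((continuous_shiftSeq j).comp continuous_snd).continuousAt.tendsto.comp hη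
    have h3 := (LatticeFn.eventually_definedAt (SolvesAt.definedAt D he.shift he.solves).1)
    have h4 := (continuous_win a b).continuousAt.eventually (D.isOpen_domU.mem_nhds he.domU)
    have h5 : ZDefinedAt D Y j ξ := by
      by_cases hr : 0 < r
      · have := he.localCoords.1 ⟨0, hr⟩
        rw [zDefinedAt_zpow] at this
        simpa using this
      · have := he.zDefined
        rw [zDefinedAt_zpow] at this
        have hr0 : r = 0 := by omega
        simpa [hr0] using this
    filter_upwards [h1.eventually h3, h2.eventually (LatticeFn.eventually_definedAt he.eqnDefined),
      h2.eventually h4, hη.eventually (eventually_zDefinedAt D hc hz.isOpen hξ h5),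
      (hshift j).eventually he.deriv] with v e1 e2 e3 e4 e5
    rw [shiftPt_zpow_snd] at e5
    exact ⟨e1, e2, e3, e4, e5.1, e5.2⟩
  have hsolve : ∀ᶠ v in 𝓝 (zSeq D z ξ), ∀ᶠ η' in 𝓝 (η v),
      f.DefinedAt (zSeq D z η') ∧ f.eval (zSeq D z η') = η'.2 0 := by
    have he := hexp 0 (by rw [abs_zero]; exact hN)
    rw [_root_.zpow_zero] at he
    exact hη.eventually (SolvesAt.eventually_eval_zSeq D hc hz hinv hξ he.localCoords he.shift
      he.solves).eventually_nhds
  have hall : ∀ᶠ v in 𝓝 (zSeq D z ξ), f.DefinedAt v ∧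
      (∀ l ∈ Set.Icc (0 : ℤ) r, (modified f Q).DefinedAt (shiftSeq l v)) ∧
      (∀ i ∈ Set.Icc α β, f.DefinedAt (shiftSeq i v)) ∧
      F.DefinedAt (fun i => f.eval (shiftSeq i v)) ∧
      (modified f Q).totalDeriv f v = F.eval (fun i => f.eval (shiftSeq i v)) := by
    filter_upwards [hlift, hjets, hsolve] with v h1 h2 h3
    obtain ⟨hadm, hzv, huv⟩ := h1
    have h0 := h2 0 ⟨by omega, by omega⟩
    rw [shiftSeq_zero, shiftSeq_zero] at h0
    have hwin : win 0 r (zSeq D z (η v)) = win 0 r v := by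
      funext l
      have hl1 := l.2.1
      have hl2 := l.2.2
      exact hzv l (by omega) (by omega)
    have hFwin : win α β (fun i => f.eval (shiftSeq i v)) = win α β (η v).2 := by
      funext i
      have hi1 := i.2.1
      have hi2 := i.2.2
      exact (huv i (abs_le.2 ⟨by omega, by omega⟩)).symm
    -- the arguments of `Q` at the shifted values are those at the shifted point
    have hargs : ∀ l ∈ Set.Icc (0 : ℤ) r,
        modArgs f (win (min a 0) (max (b + r) (r - 1)) (shiftSeq l v)) =
          (win 0 (r - 1) (zSeq D z ((shiftPt D ^ l) (η v))), win a b (shiftSeq l (η v).2)) := by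
      intro l hl
      have hl1 := hl.1
      have hl2 := hl.2
      rw [modArgs_win]
      refine Prod.ext ?_ ?_
      · funext i
        have hi1 := i.2.1
        have hi2 := i.2.2
        simp only [win, zSeq_zpow, shiftSeq]
        exact (hzv _ (by omega) (by omega)).symm
      · funext i
        have hi1 := i.2.1
        have hi2 := i.2.2
        simp only [win, shiftSeq_shiftSeq]
        exact (huv _ (abs_le.2 ⟨by omega, by omega⟩)).symm
    refine ⟨h0.1, fun l hl => ⟨?_, ?_⟩, fun i hi => ?_, ?_, ?_⟩
    · intro j
      have hj1 := j.2.1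
      have hj2 := j.2.2
      have hl1 := hl.1
      have hl2 := hl.2
      have h4 := (h2 (j + l) ⟨by omega, by omega⟩).1
      rw [← shiftSeq_shiftSeq] at h4
      exact h4
    · have hl1 := hl.1
      have hl2 := hl.2
      change modArgs f (win _ _ (shiftSeq l v)) ∈ Q.dom
      rw [hargs l hl]
      exact (h2 l ⟨by omega, by omega⟩).2.2.2.2.1
    · have hi1 := hi.1
      have hi2 := hi.2
      exact (h2 i ⟨by omega, by omega⟩).1
    · exact h0.2.1.congr hFwin.symm
    · have hmain := sum_totalDt_mul_deriv D hc hz (f := f) hadm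
        (fun l hl => (h2 l ⟨by omega, by omega⟩).2.1)
        (fun l hl => (h2 l ⟨by omega, by omega⟩).2.2.1)
        (fun l hl => (h2 l ⟨by omega, by omega⟩).2.2.2.1) h3
      rw [LatticeFn.eval_congr F hFwin, ← hmain, LatticeFn.totalDeriv]
      refine Finset.sum_congr rfl fun l hl => ?_
      have hl' : l ∈ Set.Icc (0 : ℤ) r := Finset.mem_Icc.1 hl
      have hl1 := hl'.1
      have hl2 := hl'.2
      have e1 : (modified f Q).eval (shiftSeq l v) =
          totalDt D (pull z) ((shiftPt D ^ l) (η v)) := by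
        rw [(h2 l ⟨by omega, by omega⟩).2.2.2.2.2, ← hargs l hl']
        rfl
      rw [e1, LatticeFn.deriv_eval_update h0.1 ⟨l, hl'⟩,
        LatticeFn.deriv_eval_update (h0.1.congr hwin.symm) ⟨l, hl'⟩, hwin]
  obtain ⟨𝒱, h1, h2, h3⟩ := mem_nhds_iff.1 hall
  exact ⟨𝒱, h2, h3, fun v hv => h1 hv⟩

end Evolution

/-! ### Generic properties of points -/

section Generic

variable {d m : ℕ} {c : Fin m → ℂ} {k : Fin m → ℕ}
variable {α β : ℤ} {F : LatticeFn α β} {a b : ℤ} (D : DarbouxLax d F a b)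
variable {H : Subgroup (LieG d c k)} {z : LieG d c k ⧸ H → ℂ} {Y : Set (LieG d c k ⧸ H)} {r : ℕ}

/-- The space of points all of whose lattice variables belong to the domain of `u`. -/
abbrev AdmPt (c : Fin m → ℂ) (k : Fin m → ℕ) : Type := LieG d c k × (ℤ → D.uDom)

/-- The inclusion of the admissible points. -/
def AdmPt.toPt (x : AdmPt D c k) : Pt d c k := (x.1, fun l => x.2 l)

theorem AdmPt.toPt_mem (x : AdmPt D c k) : x.toPt D ∈ admissible D c k := fun l => (x.2 l).2

theorem AdmPt.continuous_toPt : Continuous (AdmPt.toPt D : AdmPt D c k → Pt d c k) :=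
  continuous_fst.prodMk (continuous_pi fun l =>
    continuous_subtype_val.comp ((continuous_apply l).comp continuous_snd))

theorem AdmPt.exists_toPt_eq {ξ : Pt d c k} (hξ : ξ ∈ admissible D c k) :
    ∃ x : AdmPt D c k, x.toPt D = ξ := ⟨(ξ.1, fun l => ⟨ξ.2 l, hξ l⟩), rfl⟩

/-- A property of points is generic if it holds on an open dense set of admissible points. -/
structure Generic (P : Pt d c k → Prop) : Prop where
  isOpen : IsOpen {x : AdmPt D c k | P (x.toPt D)}
  dense : Dense {x : AdmPt D c k | P (x.toPt D)}

variable {D}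

theorem Generic.and {P Q : Pt d c k → Prop} (hP : Generic D P) (hQ : Generic D Q) :
    Generic D fun ξ => P ξ ∧ Q ξ :=
  ⟨hP.isOpen.inter hQ.isOpen, hP.dense.inter_of_isOpen_left hQ.dense hP.isOpen⟩

theorem generic_true : Generic D fun _ : Pt d c k => True :=
  ⟨by simp, by simp⟩

theorem Generic.forall_mem {ι : Type*} {S : Set ι} (hS : S.Finite) {P : ι → Pt d c k → Prop}
    (hP : ∀ i ∈ S, Generic D (P i)) : Generic D fun ξ => ∀ i ∈ S, P i ξ := by
  induction S, hS using Set.Finite.induction_on with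
  | empty => simpa using generic_true
  | insert _ _ ih =>
    simp only [Set.forall_mem_insert]
    exact (hP _ (Set.mem_insert _ _)).and (ih fun i hi => hP i (Set.mem_insert_of_mem _ hi))

/-- To show that an open condition is generic, it is enough to refute that its negation holds
on an open set around a point of a given generic kind. -/
theorem Generic.of_isOpen {P Q : Pt d c k → Prop} (hQ : Generic D Q)
    (hP : IsOpen {x : AdmPt D c k | P (x.toPt D)})
    (h : ∀ x : AdmPt D c k, Q (x.toPt D) → ¬ ∀ᶠ y in 𝓝 x, ¬ P (y.toPt D)) : Generic D P := by
  refine ⟨hP, ?_⟩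
  rw [dense_iff_inter_open]
  intro O hO hne
  obtain ⟨x, hxO, hxQ⟩ := hQ.dense.inter_open_nonempty O hO hne
  by_contra hcon
  refine h x hxQ ?_
  filter_upwards [hO.mem_nhds hxO] with y hy hPy
  exact hcon ⟨y, hy, hPy⟩

variable (D)

/-- The shift on admissible points, a homeomorphism. -/
def shiftAdm (hc : ∀ p, c p ∈ D.lamDom) : AdmPt D c k ≃ₜ AdmPt D c k where
  toFun x := (rho (D.M (x.2 0)) * x.1, fun l => x.2 (l + 1))
  invFun x := ((rho (D.M (x.2 (-1))))⁻¹ * x.1, fun l => x.2 (l - 1))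
  left_inv := by
    rintro ⟨g, u⟩
    simp
  right_inv := by
    rintro ⟨g, u⟩
    simp
  continuous_toFun := by
    have h1 : Continuous fun s : D.uDom => (rho (D.M s) : LieG d c k) :=
      continuous_iff_continuousAt.2 fun s => ContinuousAt.comp (f := Subtype.val)
        (g := fun s => (rho (D.M s) : LieG d c k)) (continuousAt_rho_M D hc s.2)
        continuous_subtype_val.continuousAt
    exact ((h1.comp ((continuous_apply 0).comp continuous_snd)).mul continuous_fst).prodMk
      (continuous_pi fun l => (continuous_apply (l + 1)).comp continuous_snd)
  continuous_invFun := by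
    have h1 : Continuous fun s : D.uDom => (rho (D.M s) : LieG d c k) :=
      continuous_iff_continuousAt.2 fun s => ContinuousAt.comp (f := Subtype.val)
        (g := fun s => (rho (D.M s) : LieG d c k)) (continuousAt_rho_M D hc s.2)
        continuous_subtype_val.continuousAt
    exact ((h1.comp ((continuous_apply (-1)).comp continuous_snd)).inv.mul continuous_fst).prodMk
      (continuous_pi fun l => (continuous_apply (l - 1)).comp continuous_snd)

variable {D}

theorem Generic.preimage {P : Pt d c k → Prop} (hP : Generic D P) (e : AdmPt D c k ≃ₜ AdmPt D c k)
    {P' : Pt d c k → Prop} (h : ∀ x : AdmPt D c k, P' (x.toPt D) ↔ P ((e x).toPt D)) :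
    Generic D P' := by
  have e1 : {x : AdmPt D c k | P' (x.toPt D)} = e ⁻¹' {x | P (x.toPt D)} := by
    ext x; exact h x
  exact ⟨by rw [e1]; exact hP.isOpen.preimage e.continuous,
    by rw [e1]; exact hP.dense.preimage e.isOpenMap⟩

theorem Generic.shift (hc : ∀ p, c p ∈ D.lamDom) {P : Pt d c k → Prop} (hP : Generic D P) (j : ℤ) :
    Generic D fun ξ => P ((shiftPt D ^ j) ξ) := by
  induction j with
  | zero => simpa using hP
  | succ n ih =>
    refine ih.preimage (shiftAdm D hc) fun x => ?_
    rw [shiftPt_zpow_add, _root_.zpow_one]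
    rfl
  | pred n ih =>
    refine ih.preimage (shiftAdm D hc).symm fun x => ?_
    rw [sub_eq_add_neg, shiftPt_zpow_add, _root_.zpow_neg_one]
    rfl

theorem generic_mk_mem {𝒴 : Set (LieG d c k ⧸ H)} (ho : IsOpen 𝒴) (hd : Dense 𝒴) :
    Generic D fun ξ : Pt d c k => (ξ.1 : LieG d c k ⧸ H) ∈ 𝒴 := by
  have hmk : IsOpenMap (fun g : LieG d c k => (g : LieG d c k ⧸ H)) :=
    QuotientGroup.isOpenMap_coe
  exact ⟨ho.preimage (continuous_mk.comp continuous_fst),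
    hd.preimage (hmk.comp isOpenMap_fst)⟩

theorem generic_zDefinedAt (hc : ∀ p, c p ∈ D.lamDom) (hz : IsFunctionOn z Y) (j : ℤ) :
    Generic D (ZDefinedAt D Y j) :=
  (generic_mk_mem hz.isOpen hz.dense).shift hc j

theorem generic_win_mem {p q : ℤ} {O : Set (Win p q)} (hO : IsOpen O)
    (hd : {x : Win p q | ∀ l, x l ∈ D.uDom} ⊆ closure O) :
    Generic D fun ξ : Pt d c k => win p q ξ.2 ∈ O := by
  refine ⟨hO.preimage ((continuous_win p q).comp
    (continuous_snd.comp (AdmPt.continuous_toPt D))), ?_⟩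
  rintro ⟨g, u⟩
  -- only the variables `u_p, …, u_q` are moved
  have hV : IsOpen {x : Win p q | ∀ l, x l ∈ D.uDom} := by
    have e : {x : Win p q | ∀ l, x l ∈ D.uDom} = ⋂ l, (fun x : Win p q => x l) ⁻¹' D.uDom := by
      ext x; simp
    rw [e]
    exact isOpen_iInter_of_finite fun l => D.isOpen_uDom.preimage (continuous_apply l)
  let V := {x : Win p q // ∀ l, x l ∈ D.uDom}
  let T : V → AdmPt D c k := fun x => (g, fun l =>
    if h : l ∈ Set.Icc p q then ⟨x.1 ⟨l, h⟩, x.2 ⟨l, h⟩⟩ else u l)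
  have hT : Continuous T := by
    refine continuous_const.prodMk (continuous_pi fun l => ?_)
    by_cases h : l ∈ Set.Icc p q
    · simp only [dif_pos h]
      exact Continuous.subtype_mk ((continuous_apply _).comp continuous_subtype_val) _
    · simp only [dif_neg h]
      exact continuous_const
  let x₀ : V := ⟨fun l => u l, fun l => (u l).2⟩
  have hT0 : T x₀ = (g, u) := by
    refine Prod.ext rfl (funext fun l => ?_)
    simp only [T, x₀]
    split_ifs <;> rfl
  have hwin : ∀ x : V, win p q ((T x).toPt D).2 = x.1 := by
    intro x
    funext l
    simp only [win, AdmPt.toPt, T]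
    rw [dif_pos l.2]
  have hdense : x₀ ∈ closure {x : V | x.1 ∈ O} := by
    have h1 : x₀.1 ∈ closure O := hd x₀.2
    have hemb : IsOpenEmbedding (Subtype.val : V → Win p q) := hV.isOpenEmbedding_subtypeVal
    rw [mem_closure_iff_nhds] at h1 ⊢
    intro t ht
    have h2 : Subtype.val '' t ∈ 𝓝 x₀.1 := hemb.isOpenMap.image_mem_nhds ht
    obtain ⟨_, ⟨y, hy, rfl⟩, hyO⟩ := h1 _ h2
    exact ⟨y, hy, hyO⟩
  have := map_mem_closure (t := {x : AdmPt D c k | win p q (x.toPt D).2 ∈ O}) hT hdense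
    fun x hx => by
      change win p q ((T x).toPt D).2 ∈ O
      rw [hwin]
      exact hx
  rwa [hT0] at this

/-- Generically `z_0, …, z_{r-1}` are local coordinates on `G/H`. -/
theorem exists_generic_localCoordsAt (hc : ∀ p, c p ∈ D.lamDom) (hz : IsFunctionOn z Y)
    (hinv : LeftInvariant D (r - 1) z Y) (hcoord : LocalCoordsAE D z Y r) :
    ∃ P : Pt d c k → Prop, Generic D P ∧
      ∀ ξ ∈ admissible D c k, P ξ → LocalCoordsAt D z Y r ξ := by
  obtain ⟨𝒴, h1, h2, h3⟩ := hcoord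
  refine ⟨fun ξ => (ξ.1 : LieG d c k ⧸ H) ∈ 𝒴 ∧
    ∀ j ∈ (Set.univ : Set (Fin r)), ZDefinedAt D Y (j : ℕ) ξ, ?_, ?_⟩
  · exact (generic_mk_mem h1 h2).and (Generic.forall_mem Set.finite_univ
      fun j _ => generic_zDefinedAt hc hz _)
  rintro ⟨g, u⟩ hξ ⟨hg, hdef⟩
  obtain ⟨u', hu', hloc⟩ := h3 g hg
  refine ⟨fun j => hdef j trivial, ?_⟩
  -- the functions `z_j` at the given `u_l` and at those of the hypothesis agree near `g`
  have heq : ∀ j : Fin r, fderiv ℂ (rep fun g => zz D z (j : ℕ) (g, u)) (coord g) =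
      fderiv ℂ (rep fun g => zz D z (j : ℕ) (g, u')) (coord g) := by
    intro j
    refine Filter.EventuallyEq.fderiv_eq (rep_congr ?_)
    have hcont : ∀ u : ℤ → ℂ, Filter.Tendsto (fun g' : LieG d c k => ((g', u) : Pt d c k))
        (𝓝 g) (𝓝 (g, u)) := fun u => by
      have : Continuous fun g' : LieG d c k => ((g', u) : Pt d c k) := by fun_prop
      exact this.tendsto g
    filter_upwards [(hcont u).eventually (eventually_zDefinedAt D hc hz.isOpen hξ (hdef j trivial)),
      (hcont u').eventually (eventually_zDefinedAt D hc hz.isOpen (ξ := (g, u')) hu' (hloc.1 j))]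
      with g' e1 e2
    exact zz_eq_of_mk_eq D hc hinv j j.2 rfl (fun i _ => hξ i) (fun i _ => hu' i) e1 e2
  change LinearIndependent ℂ fun j : Fin r =>
    fderiv ℂ (rep fun g => zz D z (j : ℕ) (g, u)) (coord g)
  simp only [heq]
  exact hloc.2

end Generic

/-! ### Generic non-degeneracy of `∂z_r/∂u` -/

section Nondegenerate

variable {d m : ℕ} {c : Fin m → ℂ} {k : Fin m → ℕ}
variable {α β : ℤ} {F : LatticeFn α β} {a b : ℤ} (D : DarbouxLax d F a b)
variable {H : Subgroup (LieG d c k)} {z : LieG d c k ⧸ H → ℂ} {Y : Set (LieG d c k ⧸ H)} {r : ℕ}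

/-- The velocity `∂M/∂u · g` in coordinates. -/
def velM (s : ℂ) (w : Coord d k) : Coord d k := mulV d c k (jetV c k (derivM D s)) w

/-- The velocity `∂M/∂u · g` translated to the unit: `g⁻¹ M⁻¹ ∂M/∂u g`. -/
def logVelM (g : LieG d c k) (s : ℂ) : Coord d k :=
  mulV d c k (coord (rho (D.M s) * g)⁻¹) (velM (c := c) D s (coord g))

theorem mulV_logVelM (g : LieG d c k) (s : ℂ) :
    mulV d c k (coord (rho (D.M s) * g)) (logVelM D g s) = velM (c := c) D s (coord g) :=
  coord_mulV_inv _ _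

/-- The partial derivative of `z_{n+1}` in `u_0` is the derivative of `z_n` along `∂M/∂u · g`. -/
theorem hasDerivAt_zz_update (hc : ∀ p, c p ∈ D.lamDom) (hz : IsFunctionOn z Y) (n : ℕ)
    {g : LieG d c k} {u : ℤ → ℂ} (hu : u 0 ∈ D.uDom) (h : ZDefinedAt D Y (n + 1) (g, u)) :
    HasDerivAt (fun s : ℂ => zz D z (n + 1) (g, Function.update u 0 s))
      (fderiv ℂ (rep fun g' => zz D z n (g', shiftSeq 1 u)) (coord (rho (D.M (u 0)) * g))
        (velM (c := c) D (u 0) (coord g))) (u 0) := by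
  have h1 : ZDefinedAt D Y n (rho (D.M (u 0)) * g, shiftSeq 1 u) := by
    rw [zDefinedAt_iff, trans_add_one, mul_assoc] at h
    rwa [zDefinedAt_iff]
  have h2 : HasDerivAt (fun s => coord (rho (D.M s) * g)) (velM (c := c) D (u 0) (coord g))
      (u 0) := by
    have h3 := ((mulV d c k).flip (coord g)).hasFDerivAt.comp_hasDerivAt (u 0)
      (hasDerivAt_jetV_M (k := k) D hc hu)
    refine h3.congr_of_eventuallyEq (Filter.Eventually.of_forall fun s => ?_)
    simp only [Function.comp, ContinuousLinearMap.flip_apply]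
    rw [coord_mul, coord_rho]
  have h4 := (analyticAt_rep_zz D hz h1).differentiableAt.hasFDerivAt.comp_hasDerivAt (u 0) h2
  refine h4.congr_of_eventuallyEq (Filter.Eventually.of_forall fun s => ?_)
  simp only [Function.comp]
  rw [rep_coord, zz_apply, zz_apply, trans_update, mul_assoc]

/-- If `∂z_r/∂u ≠ 0`, then `∂M/∂u · g` is not tangent to the coset of `M g`. -/
theorem logVelM_notMem (hc : ∀ p, c p ∈ D.lamDom) (hr : 0 < r) (hz : IsFunctionOn z Y)
    {K : Submodule ℂ (Coord d k)} (hK : IsTangent H r K) {ξ : Pt d c k}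
    (hξ : ξ ∈ admissible D c k) (h : ZDefinedAt D Y r ξ) (hd : dzdu D z r ξ ≠ 0) :
    logVelM D ξ.1 (ξ.2 0) ∉ K := by
  obtain ⟨n, rfl⟩ := Nat.exists_eq_succ_of_ne_zero hr.ne'
  intro hmem
  apply hd
  rw [Nat.cast_succ] at h
  have h1 : ZDefinedAt D Y n (rho (D.M (ξ.2 0)) * ξ.1, shiftSeq 1 ξ.2) := by
    have h' : ZDefinedAt D Y (n + 1) (ξ.1, ξ.2) := h
    rw [zDefinedAt_iff, trans_add_one, mul_assoc] at h'
    rwa [zDefinedAt_iff]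
  rw [dzdu, Nat.cast_succ, (hasDerivAt_zz_update D hc hz n (hξ 0) h).deriv, ← mulV_logVelM]
  exact hK.fderiv_eq_zero _ (fun g h hh => zz_mul_of_mem D n _ g hh) _
    (analyticAt_rep_zz D hz h1).differentiableAt _ hmem

/-- Conversely, where `z_0, …, z_{r-1}` are local coordinates at the shifted point, `∂z_r/∂u` can
vanish only if `∂M/∂u · g` is tangent to the coset of `M g`: the derivatives of
`z_0, …, z_{r-2}` along it vanish, as `z_1, …, z_{r-1}` do not depend on `u`. -/
theorem dzdu_ne_zero (hc : ∀ p, c p ∈ D.lamDom) (hr : 0 < r) (hz : IsFunctionOn z Y)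
    (hinv : LeftInvariant D (r - 1) z Y) {K : Submodule ℂ (Coord d k)} (hK : IsTangent H r K)
    {ξ : Pt d c k} (hξ : ξ ∈ admissible D c k) (h : ZDefinedAt D Y r ξ)
    (hloc : LocalCoordsAt D z Y r ((shiftPt D ^ (1 : ℤ)) ξ))
    (hV : logVelM D ξ.1 (ξ.2 0) ∉ K) : dzdu D z r ξ ≠ 0 := by
  intro hd
  apply hV
  have hsh : (shiftPt D ^ (1 : ℤ)) ξ = (rho (D.M (ξ.2 0)) * ξ.1, shiftSeq 1 ξ.2) := by
    rw [_root_.zpow_one]; rfl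
  have hdef : ∀ l : Set.Icc (0 : ℤ) (r - 1), ZDefinedAt D Y (l + 1) ξ := fun l => by
    rw [← zDefinedAt_zpow]
    rw [hsh] at hloc ⊢
    exact LocalCoordsAt.zDefinedAt D hloc l
  rw [hsh] at hloc
  have hzero : fderiv ℂ (zVec D z r (shiftSeq 1 ξ.2)) (coord (rho (D.M (ξ.2 0)) * ξ.1))
      (velM (c := c) D (ξ.2 0) (coord ξ.1)) = 0 := by
    funext l
    rw [LocalCoordsAt.fderiv_apply D hz hloc]
    have hl1 := l.2.1
    have hl2 := l.2.2
    obtain ⟨j, hj⟩ : ∃ j : ℕ, (j : ℤ) = l := ⟨l.1.toNat, by omega⟩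
    have hdj := hdef l
    rw [← hj] at hdj ⊢
    rw [← (hasDerivAt_zz_update D hc hz j (hξ 0) hdj).deriv]
    by_cases hjr : j + 1 = r
    · rw [dzdu, ← hjr] at hd
      exact_mod_cast hd
    · have hconst : (fun s : ℂ => zz D z (j + 1) (ξ.1, Function.update ξ.2 0 s)) =ᶠ[𝓝 (ξ.2 0)]
          fun _ => zz D z (j + 1) ξ := by
        have hc2 : Filter.Tendsto (fun s : ℂ => ((ξ.1, Function.update ξ.2 0 s) : Pt d c k))
            (𝓝 (ξ.2 0)) (𝓝 ξ) := by
          have h := (continuous_update_snd (d := d) (c := c) (k := k) ξ.1 ξ.2 0).tendsto (ξ.2 0)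
          rwa [Function.update_eq_self] at h
        filter_upwards [hc2.eventually (eventually_zDefinedAt D hc hz.isOpen hξ hdj),
          D.isOpen_uDom.mem_nhds (hξ 0)] with s h1 h2
        refine zz_eq_of_mk_eq D hc hinv (j + 1) (by omega) rfl (fun i _ => ?_)
          (fun i _ => hξ i) (by exact_mod_cast h1) (by exact_mod_cast hdj)
        by_cases hi : (i : ℤ) = 0
        · rw [hi, Function.update_self]; exact h2
        · rw [Function.update_of_ne hi]; exact hξ i
      rw [hconst.deriv_eq, deriv_const]
      rfl
  obtain ⟨x, hx, hxv⟩ := LocalCoordsAt.mem_tangent D hz hK hloc hzero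
  have e : logVelM D ξ.1 (ξ.2 0) = x := by
    rw [logVelM, ← hxv, coord_inv_mulV]
  rwa [e]

variable {D}

theorem isOpenMap_coord_eval :
    IsOpenMap fun x : AdmPt D c k => (coord x.1, (x.2 0 : ℂ)) := by
  have h1 : IsOpenMap (fun u : ℤ → D.uDom => (u 0 : ℂ)) :=
    (D.isOpen_uDom.isOpenEmbedding_subtypeVal.isOpenMap).comp (isOpenMap_eval 0)
  exact isOpenEmbedding_coord.isOpenMap.prodMap h1

/-- As `G` and the domain of `u` are connected, `∂M/∂u · g` is generically not tangent to the
coset of `M g` as soon as this holds at one point. -/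
theorem generic_logVelM_notMem (hc : ∀ p, c p ∈ D.lamDom) (K : Submodule ℂ (Coord d k))
    {ξ₀ : Pt d c k} (hξ₀ : ξ₀ ∈ admissible D c k) (h₀ : logVelM D ξ₀.1 (ξ₀.2 0) ∉ K) :
    ∃ P : Pt d c k → Prop, Generic D P ∧
      ∀ ξ ∈ admissible D c k, P ξ → logVelM D ξ.1 (ξ.2 0) ∉ K := by
  obtain ⟨f, hf, hfK⟩ := Submodule.exists_le_ker_of_notMem h₀
  let fc : Coord d k →L[ℂ] ℂ := LinearMap.toContinuousLinearMap f
  set J : ℂ → Coord d k := fun s => jetV c k fun lam => (D.M s lam : Matrix (Fin d) (Fin d) ℂ)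
    with hJ
  -- `logVelM` in coordinates, followed by a functional vanishing on `K`
  let θ : Coord d k × ℂ → ℂ := fun x =>
    fc (mulV d c k (invV d c k (mulV d c k (J x.2) x.1)) (mulV d c k (deriv J x.2) x.1))
  have hθ : ∀ (g : LieG d c k) (s : ℂ), s ∈ D.uDom → θ (coord g, s) = f (logVelM D g s) := by
    intro g s hs
    have e1 : mulV d c k (J s) (coord g) = coord (rho (D.M s) * g) := by
      rw [coord_mul, coord_rho]
    have e2 : invV d c k (coord (rho (D.M s) * g)) = coord (rho (D.M s) * g)⁻¹ :=
      (coord_inv _).symm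
    simp only [θ]
    rw [e1, e2, (hasDerivAt_jetV_M D hc hs).deriv]
    rfl
  set Ω : Set (Coord d k × ℂ) := Set.range (coord : LieG d c k → Coord d k) ×ˢ D.uDom with hΩ
  have hana : AnalyticOnNhd ℂ θ Ω := by
    rintro ⟨w, s⟩ ⟨⟨g, rfl⟩, hs⟩
    have a1 : AnalyticAt ℂ (fun x : Coord d k × ℂ => mulV d c k (J x.2) x.1) (coord g, s) :=
      ((mulV d c k).analyticAt_bilinear _).comp₂
        (AnalyticAt.fun_comp (f := fun x : Coord d k × ℂ => x.2)
          (analyticAt_jetV_M D hc hs) analyticAt_snd) analyticAt_fst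
    have a2 : AnalyticAt ℂ (fun x : Coord d k × ℂ => mulV d c k (deriv J x.2) x.1)
        (coord g, s) :=
      ((mulV d c k).analyticAt_bilinear _).comp₂
        (AnalyticAt.fun_comp (f := fun x : Coord d k × ℂ => x.2)
          (analyticAt_jetV_M D hc hs).deriv analyticAt_snd) analyticAt_fst
    have a3 : AnalyticAt ℂ (fun x : Coord d k × ℂ => invV d c k (mulV d c k (J x.2) x.1))
        (coord g, s) := by
      refine AnalyticAt.fun_comp (g := invV d c k) ?_ a1
      have e1 : mulV d c k (J s) (coord g) = coord (rho (D.M s) * g) := by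
        rw [coord_mul, coord_rho]
      simp only
      rw [e1]
      exact analyticAt_invV _
    exact (fc.analyticAt _).fun_comp (((mulV d c k).analyticAt_bilinear _).comp₂ a3 a2)
  have hconn : IsPreconnected Ω :=
    isPreconnected_range_coord.prod D.isConnected_uDom.isPreconnected
  have hmem : ∀ x : AdmPt D c k, (coord x.1, (x.2 0 : ℂ)) ∈ Ω := fun x =>
    ⟨⟨x.1, rfl⟩, (x.2 0).2⟩
  have hcont : Continuous fun x : AdmPt D c k => (coord x.1, (x.2 0 : ℂ)) :=
    (continuous_coord.comp continuous_fst).prodMk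
      (continuous_subtype_val.comp ((continuous_apply 0).comp continuous_snd))
  refine ⟨fun ξ => θ (coord ξ.1, ξ.2 0) ≠ 0, generic_true.of_isOpen ?_ ?_, ?_⟩
  · have h1 : Continuous fun x : AdmPt D c k => θ (coord x.1, (x.2 0 : ℂ)) :=
      continuous_iff_continuousAt.2 fun x =>
        ContinuousAt.comp (f := fun x : AdmPt D c k => (coord x.1, (x.2 0 : ℂ)))
          (hana _ (hmem x)).continuousAt hcont.continuousAt
    exact isOpen_ne_fun h1 continuous_const
  · intro x _ hx
    have h2 : θ =ᶠ[𝓝 (coord x.1, (x.2 0 : ℂ))] 0 := by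
      have h3 := isOpenMap_coord_eval.image_mem_nhds hx
      filter_upwards [h3] with y hy
      obtain ⟨x', hx', rfl⟩ := hy
      exact not_not.1 hx'
    have h4 := hana.eqOn_zero_of_preconnected_of_eventuallyEq_zero hconn (hmem x) h2
    have h5 := h4 (show (coord ξ₀.1, ξ₀.2 0) ∈ Ω from ⟨⟨ξ₀.1, rfl⟩, hξ₀ 0⟩)
    rw [hθ _ _ (hξ₀ 0)] at h5
    exact hf h5
  · intro ξ hξ hne hK
    rw [hθ _ _ (hξ 0)] at hne
    exact hne (hfK hK)

/-- Generically `∂z_r/∂u ≠ 0`, as soon as this holds at one point. -/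
theorem exists_generic_dzdu_ne_zero (hc : ∀ p, c p ∈ D.lamDom) (hr : 0 < r) (hz : IsFunctionOn z Y)
    (hinv : LeftInvariant D (r - 1) z Y) (hcoord : LocalCoordsAE D z Y r)
    {K : Submodule ℂ (Coord d k)} (hK : IsTangent H r K)
    (hpdu : ∃ ξ ∈ admissible D c k, ZDefinedAt D Y r ξ ∧ dzdu D z r ξ ≠ 0) :
    ∃ P : Pt d c k → Prop, Generic D P ∧ ∀ ξ ∈ admissible D c k, P ξ → dzdu D z r ξ ≠ 0 := by
  obtain ⟨ξ₀, hξ₀, hY₀, hd₀⟩ := hpdu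
  obtain ⟨P, hP, hP'⟩ := exists_generic_localCoordsAt hc hz hinv hcoord
  obtain ⟨P₁, hP₁, hP₁'⟩ := generic_logVelM_notMem hc K hξ₀
    (logVelM_notMem D hc hr hz hK hξ₀ hY₀ hd₀)
  refine ⟨fun ξ => P₁ ξ ∧ P ((shiftPt D ^ (1 : ℤ)) ξ) ∧ ZDefinedAt D Y r ξ,
    hP₁.and ((hP.shift hc 1).and (generic_zDefinedAt hc hz r)), ?_⟩
  rintro ξ hξ ⟨h1, h2, h3⟩
  exact dzdu_ne_zero D hc hr hz hinv hK hξ h3 (hP' _ (admissible_zpow D hξ 1) h2) (hP₁' ξ hξ h1)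

/-! ### Generically the values `z_j` are distinct -/

theorem continuousAt_zz (hc : ∀ p, c p ∈ D.lamDom) (hz : IsFunctionOn z Y) {ξ : Pt d c k}
    (hξ : ξ ∈ admissible D c k) {j : ℤ} (h : ZDefinedAt D Y j ξ) :
    ContinuousAt (zz D z j) ξ := by
  have h1 : ContinuousAt (fun η => coord ((shiftPt D ^ j) η).1) ξ :=
    (continuous_coord.comp continuous_fst).continuousAt.comp (continuousAt_shiftPt_zpow D hc hξ j)
  have h2 := ContinuousAt.comp (f := fun η => coord ((shiftPt D ^ j) η).1)
    (g := rep fun g : LieG d c k => z (g : LieG d c k ⧸ H)) (hz.analytic _ h).continuousAt h1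
  refine h2.congr (Filter.Eventually.of_forall fun η => ?_)
  simp only [Function.comp]
  rw [rep_coord]
  rfl

/-- Generically `z_n ≠ z_0` for `n > 0`: if `n < r`, the two are members of a system of local
coordinates, and if `n ≥ r`, only the former depends on `u_{n-r}`. -/
theorem generic_zz_ne (hc : ∀ p, c p ∈ D.lamDom) (hr : 0 < r) (hz : IsFunctionOn z Y)
    (hinv : LeftInvariant D (r - 1) z Y) (hcoord : LocalCoordsAE D z Y r)
    {K : Submodule ℂ (Coord d k)} (hK : IsTangent H r K)
    (hpdu : ∃ ξ ∈ admissible D c k, ZDefinedAt D Y r ξ ∧ dzdu D z r ξ ≠ 0) (n : ℕ) (hn : 0 < n) :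
    Generic D fun ξ => (ZDefinedAt D Y 0 ξ ∧ ZDefinedAt D Y n ξ) ∧ zz D z n ξ ≠ zz D z 0 ξ := by
  obtain ⟨P, hP, hP'⟩ := exists_generic_localCoordsAt hc hz hinv hcoord
  obtain ⟨P₁, hP₁, hP₁'⟩ := exists_generic_dzdu_ne_zero hc hr hz hinv hcoord hK hpdu
  have hdef := (generic_zDefinedAt hc hz (D := D) 0).and (generic_zDefinedAt hc hz (D := D) n)
  refine Generic.of_isOpen ((hP.and (hP₁.shift hc (n - r))).and hdef) ?_ ?_
  · rw [isOpen_iff_mem_nhds]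
    intro x hx
    have h0 := (continuousAt_zz hc hz (x.toPt_mem D) hx.1.1).comp
      (AdmPt.continuous_toPt D).continuousAt
    have h1 := (continuousAt_zz hc hz (x.toPt_mem D) hx.1.2).comp
      (AdmPt.continuous_toPt D).continuousAt
    filter_upwards [hdef.isOpen.mem_nhds hx.1,
      (h1.sub h0).eventually_ne (sub_ne_zero.2 hx.2)] with y hy1 hy2
    exact ⟨hy1, sub_ne_zero.1 hy2⟩
  · rintro x ⟨⟨hx1, hx2⟩, hx3⟩ hev
    have hadm := x.toPt_mem D
    have hloc := hP' _ hadm hx1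
    have heq : ∀ᶠ y in 𝓝 x, zz D z n (y.toPt D) = zz D z 0 (y.toPt D) := by
      filter_upwards [hev, hdef.isOpen.mem_nhds hx3] with y hy1 hy2
      by_contra hne
      exact hy1 ⟨hy2, hne⟩
    by_cases hnr : n < r
    · -- `z_n = z_0` contradicts the independence of the differentials of `z_0, …, z_{r-1}`
      have h1 : (fun g' => zz D z n (g', (x.toPt D).2)) =ᶠ[𝓝 x.1]
          fun g' => zz D z 0 (g', (x.toPt D).2) := by
        have hc2 : Filter.Tendsto (fun g' : LieG d c k => ((g', x.2) : AdmPt D c k)) (𝓝 x.1)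
            (𝓝 x) := by
          have : Continuous fun g' : LieG d c k => ((g', x.2) : AdmPt D c k) := by fun_prop
          exact this.tendsto x.1
        exact hc2.eventually heq
      have h2 := (rep_congr h1).fderiv_eq (𝕜 := ℂ)
      have h3 := hloc.2.injective (a₁ := ⟨n, hnr⟩) (a₂ := ⟨0, hr⟩) h2
      have h4 := congrArg Fin.val h3
      simp only at h4
      omega
    · -- `z_n` depends on `u_{n-r}`, and `z_0` does not
      refine hP₁' _ (admissible_zpow D hadm (n - r)) hx2 ?_
      have hnr' : ((n - r : ℕ) : ℤ) = n - r := by omega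
      rw [dzdu, shiftPt_zpow]
      simp only
      have e0 : shiftSeq (n - r : ℤ) (x.toPt D).2 0 = x.2 (n - r : ℤ) := by
        simp [shiftSeq, AdmPt.toPt]
      rw [e0]
      have hconst : (fun s : ℂ => zz D z r (trans D (n - r : ℤ) (x.toPt D).2 * (x.toPt D).1,
          Function.update (shiftSeq (n - r : ℤ) (x.toPt D).2) 0 s)) =ᶠ[𝓝 (x.2 (n - r : ℤ) : ℂ)]
          fun _ => zz D z 0 (x.toPt D) := by
        have hc2 : Filter.Tendsto (fun s : D.uDom =>
            ((x.1, Function.update x.2 (n - r : ℤ) s) : AdmPt D c k)) (𝓝 (x.2 (n - r : ℤ)))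
            (𝓝 x) := by
          have : Continuous fun s : D.uDom =>
              ((x.1, Function.update x.2 (n - r : ℤ) s) : AdmPt D c k) :=
            continuous_const.prodMk (continuous_const.update _ continuous_id)
          have h := this.tendsto (x.2 (n - r : ℤ))
          rwa [Function.update_eq_self] at h
        have h5 := hc2.eventually heq
        rw [nhds_subtype_eq_comap, Filter.eventually_comap] at h5
        filter_upwards [h5, D.isOpen_uDom.mem_nhds (x.2 (n - r : ℤ)).2] with s h6 h7
        have h8 := h6 ⟨s, h7⟩ rfl
        have e1 : AdmPt.toPt D (x.1, Function.update x.2 (n - r : ℤ) ⟨s, h7⟩) =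
            (x.1, Function.update (x.toPt D).2 (n - r : ℤ) s) := by
          refine Prod.ext rfl (funext fun l => ?_)
          by_cases hl : l = n - r
          · subst hl; simp [AdmPt.toPt]
          · simp [AdmPt.toPt, Function.update_of_ne hl]
        rw [e1] at h8
        have e2 : zz D z 0 (x.1, Function.update (x.toPt D).2 (n - r : ℤ) s) =
            zz D z 0 (x.toPt D) := rfl
        have e3 : (n : ℤ) = r + (n - r) := by ring
        have e4 : (trans D (n - r : ℤ) (Function.update (x.toPt D).2 (n - r : ℤ) s) :
            LieG d c k) = trans D (n - r : ℤ) (x.toPt D).2 := by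
          rw [← hnr']
          refine trans_congr D _ fun i hi => ?_
          rw [Function.update_of_ne (by omega)]
        have e5 : shiftSeq (n - r : ℤ) (Function.update (x.toPt D).2 (n - r : ℤ) s) =
            Function.update (shiftSeq (n - r : ℤ) (x.toPt D).2) 0 s := by
          funext l
          by_cases hl : l = 0
          · subst hl; simp [shiftSeq]
          · rw [Function.update_of_ne hl, shiftSeq, shiftSeq, Function.update_of_ne (by omega)]
        rw [e2] at h8
        have e6 : zz D z n (x.1, Function.update (x.toPt D).2 (n - r : ℤ) s) =
            zz D z r ((shiftPt D ^ (n - r : ℤ))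
              (x.1, Function.update (x.toPt D).2 (n - r : ℤ) s)) := by
          rw [zz_zpow]
          congr 1
        rw [← h8, e6, shiftPt_zpow]
        simp only
        rw [e4, e5]
        rfl
      rw [hconst.deriv_eq, deriv_const]

end Nondegenerate

/-! ### Gluing local expressions -/

/-- Finitely many analytic functions can be glued along disjoint regions, which are cut out by the
values of a continuous function `p`. -/
theorem AnalyticFn.exists_glue {V : Type} [NormedAddCommGroup V] [NormedSpace ℂ V] {p : V → ℂ}
    (hp : Continuous p) {S : Set ℤ} (hS : S.Finite) {τ : ℤ → ℂ} (hτ : Set.InjOn τ S)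
    (A : ℤ → AnalyticFn V) :
    ∃ B : AnalyticFn V, ∀ j ∈ S, ∀ᶠ y in 𝓝 (τ j), ∀ x, p x = y → x ∈ (A j).dom →
      x ∈ B.dom ∧ B.toFun x = (A j).toFun x := by
  classical
  obtain ⟨O, hO, hdisj⟩ := (hS.image τ).t2_separation
  have huniq : ∀ i ∈ S, ∀ j ∈ S, ∀ y, y ∈ O (τ i) → y ∈ O (τ j) → i = j := by
    intro i hi j hj y h1 h2
    by_contra hne
    exact Set.disjoint_left.1 (hdisj (Set.mem_image_of_mem τ hi) (Set.mem_image_of_mem τ hj)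
      fun h => hne (hτ hi hj h)) h1 h2
  let B₀ : V → ℂ := fun x =>
    if h : ∃ j, j ∈ S ∧ p x ∈ O (τ j) then (A h.choose).toFun x else 0
  have hB₀ : ∀ j ∈ S, ∀ x, p x ∈ O (τ j) → B₀ x = (A j).toFun x := by
    intro j hj x hx
    have h : ∃ j, j ∈ S ∧ p x ∈ O (τ j) := ⟨j, hj, hx⟩
    simp only [B₀]
    rw [dif_pos h, huniq _ h.choose_spec.1 j hj (p x) h.choose_spec.2 hx]
  have hopen : ∀ j, IsOpen ((A j).dom ∩ p ⁻¹' O (τ j)) := fun j =>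
    (A j).isOpen_dom.inter ((hO _).2.preimage hp)
  refine ⟨⟨B₀, ⋃ j ∈ S, (A j).dom ∩ p ⁻¹' O (τ j), isOpen_biUnion fun j _ => hopen j, ?_⟩, ?_⟩
  · intro x hx
    obtain ⟨j, hj, hxj⟩ := Set.mem_iUnion₂.1 hx
    refine ((A j).analytic x hxj.1).congr ?_
    filter_upwards [(hopen j).mem_nhds hxj] with y hy
    exact (hB₀ j hj y hy.2).symm
  · intro j hj
    filter_upwards [(hO (τ j)).2.mem_nhds (hO (τ j)).1] with y hy x hx hxA
    subst hx
    exact ⟨Set.mem_iUnion₂.2 ⟨j, hj, hxA, hy⟩, hB₀ j hj x hy⟩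

section Density

variable {d m : ℕ} {c : Fin m → ℂ} {k : Fin m → ℕ}
variable {α β : ℤ} {F : LatticeFn α β} {a b : ℤ} {D : DarbouxLax d F a b}
variable {H : Subgroup (LieG d c k)} {z : LieG d c k ⧸ H → ℂ} {Y : Set (LieG d c k ⧸ H)} {r : ℕ}

/-- If the values of `z` at finitely many shifts of a point are distinct, then the local
expressions around these shifts can be glued, since they are expressions in `z` among others. -/
theorem exists_expressionsAt (hc : ∀ p, c p ∈ D.lamDom) (hr : 0 < r) (hz : IsFunctionOn z Y)
    (hinv : LeftInvariant D (r - 1) z Y) {K : Submodule ℂ (Coord d k)} (hK : IsTangent H r K)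
    {ξ : Pt d c k} (hξ : ξ ∈ admissible D c k) {S : Set ℤ} (hS : S.Finite)
    (hinj : Set.InjOn (zSeq D z ξ) S)
    (hloc : ∀ j ∈ S, LocalCoordsAt D z Y r ((shiftPt D ^ j) ξ))
    (hY : ∀ j ∈ S, ZDefinedAt D Y r ((shiftPt D ^ j) ξ))
    (hF : ∀ j ∈ S, F.DefinedAt ((shiftPt D ^ j) ξ).2)
    (hU : ∀ j ∈ S, win a b ((shiftPt D ^ j) ξ).2 ∈ D.domU)
    (hd : ∀ j ∈ S, dzdu D z r ((shiftPt D ^ j) ξ) ≠ 0) :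
    ∃ (Fz : AnalyticFn (Win 0 (r - 1) × ℂ)) (Q : AnalyticFn (Win 0 (r - 1) × Win a b))
      (f : LatticeFn 0 r), ∀ j ∈ S, ExpressionsAt D z Y Fz Q f ((shiftPt D ^ j) ξ) := by
  have hadm := fun j => admissible_zpow D hξ j
  have h0mem : (0 : ℤ) ∈ Set.Icc (0 : ℤ) (r - 1) := by
    simp only [Set.mem_Icc]
    omega
  have h0mem' : (0 : ℤ) ∈ Set.Icc (0 : ℤ) r := by
    simp only [Set.mem_Icc]
    omega
  have hval : ∀ j, zz D z 0 ((shiftPt D ^ j) ξ) = zSeq D z ξ j := fun j => by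
    rw [zz_zpow, zero_add]
    rfl
  have htend : ∀ j ∈ S, Filter.Tendsto (zz D z 0) (𝓝 ((shiftPt D ^ j) ξ))
      (𝓝 (zSeq D z ξ j)) := fun j hj => by
    rw [← hval j]
    exact continuousAt_zz hc hz (hadm j) ((hloc j hj).1 ⟨0, hr⟩)
  have h1 : ∀ j, ∃ A : AnalyticFn (Win 0 (r - 1) × ℂ), j ∈ S →
      ShiftGivenBy D z A ((shiftPt D ^ j) ξ) := by
    intro j
    by_cases hj : j ∈ S
    · obtain ⟨A, hA⟩ := exists_shiftGivenBy D hc hr hz hinv hK (hadm j) (hloc j hj) (hY j hj)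
      exact ⟨A, fun _ => hA⟩
    · exact ⟨AnalyticFn.ofFun 0, fun h => absurd h hj⟩
  choose A hA using h1
  have h2 : ∀ j, ∃ A : AnalyticFn (Win 0 (r - 1) × Win a b), j ∈ S →
      DerivGivenBy D z A ((shiftPt D ^ j) ξ) := by
    intro j
    by_cases hj : j ∈ S
    · obtain ⟨A, hA⟩ := exists_derivGivenBy D hc hr hz hinv hK (hadm j) (hloc j hj) (hU j hj)
      exact ⟨A, fun _ => hA⟩
    · exact ⟨AnalyticFn.ofFun 0, fun h => absurd h hj⟩
  choose A' hA' using h2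
  obtain ⟨Fz, hFz⟩ := AnalyticFn.exists_glue
    (p := fun x : Win 0 (r - 1) × ℂ => x.1 ⟨0, h0mem⟩) (by fun_prop) hS hinj A
  obtain ⟨Q, hQ⟩ := AnalyticFn.exists_glue
    (p := fun x : Win 0 (r - 1) × Win a b => x.1 ⟨0, h0mem⟩) (by fun_prop) hS hinj A'
  have hshift : ∀ j ∈ S, ShiftGivenBy D z Fz ((shiftPt D ^ j) ξ) := by
    intro j hj
    filter_upwards [hA j hj, (htend j hj).eventually (hFz j hj)] with η e1 e2
    obtain ⟨e3, e4⟩ := e2 _ rfl e1.1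
    exact ⟨e3, e1.2.trans e4.symm⟩
  have hderiv : ∀ j ∈ S, DerivGivenBy D z Q ((shiftPt D ^ j) ξ) := by
    intro j hj
    filter_upwards [hA' j hj, (htend j hj).eventually (hQ j hj)] with η e1 e2
    obtain ⟨e3, e4⟩ := e2 _ rfl e1.1
    exact ⟨e3, e1.2.trans e4.symm⟩
  have h3 : ∀ j, ∃ A : LatticeFn 0 r, j ∈ S → SolvesAt D z Fz A ((shiftPt D ^ j) ξ) := by
    intro j
    by_cases hj : j ∈ S
    · obtain ⟨A, hA⟩ := exists_solvesAt D hc hz hinv (hadm j) (hloc j hj) (hd j hj) (hshift j hj)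
      exact ⟨A, fun _ => hA⟩
    · exact ⟨AnalyticFn.ofFun 0, fun h => absurd h hj⟩
  choose A'' hA'' using h3
  obtain ⟨f, hf⟩ := AnalyticFn.exists_glue
    (p := fun x : Win 0 r => x ⟨0, h0mem'⟩) (continuous_apply _) hS hinj A''
  refine ⟨Fz, Q, f, fun j hj => ⟨hloc j hj, hY j hj, hF j hj, hU j hj, hshift j hj, hderiv j hj,
    ?_⟩⟩
  have h4 : Filter.Tendsto (fun x : (ℤ → ℂ) × ℂ => x.1 0)
      (𝓝 (zSeq D z ((shiftPt D ^ j) ξ), ((shiftPt D ^ j) ξ).2 0)) (𝓝 (zSeq D z ξ j)) := by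
    rw [← hval j]
    exact ((continuous_apply (0 : ℤ)).comp continuous_fst).continuousAt
  filter_upwards [hA'' j hj, h4.eventually (hf j hj)] with x e1 e2
  have e5 : win 0 r (Function.update x.1 r (Fz.toFun (win 0 (r - 1) x.1, x.2))) ⟨0, h0mem'⟩ =
      x.1 0 := by
    rw [win, Function.update_of_ne (by simp only; omega)]
  obtain ⟨e3, e4⟩ := e2 _ e5 e1.1
  exact ⟨e3, e4.trans e1.2⟩

/-- The points with local expressions valid at all shifts in a given range are dense. -/
theorem admissible_subset_closure_expressionsAt (hc : ∀ p, c p ∈ D.lamDom) (hr : 0 < r)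
    (hz : IsFunctionOn z Y) (hinv : LeftInvariant D (r - 1) z Y)
    (hcoord : LocalCoordsAE D z Y r) {K : Submodule ℂ (Coord d k)} (hK : IsTangent H r K)
    (hpdu : ∃ ξ ∈ admissible D c k, ZDefinedAt D Y r ξ ∧ dzdu D z r ξ ≠ 0) (R : ℕ) :
    admissible D c k ⊆ closure {ξ | ξ ∈ admissible D c k ∧
      ∃ (Fz : AnalyticFn (Win 0 (r - 1) × ℂ)) (Q : AnalyticFn (Win 0 (r - 1) × Win a b))
        (f : LatticeFn 0 r),
        ∀ j : ℤ, |j| ≤ R → ExpressionsAt D z Y Fz Q f ((shiftPt D ^ j) ξ)} := by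
  obtain ⟨P, hP, hP'⟩ := exists_generic_localCoordsAt hc hz hinv hcoord
  obtain ⟨P₁, hP₁, hP₁'⟩ := exists_generic_dzdu_ne_zero hc hr hz hinv hcoord hK hpdu
  let S : Set ℤ := {j | |j| ≤ (R : ℤ)}
  have hS : S.Finite := (Set.finite_Icc (-(R : ℤ)) R).subset fun j hj => abs_le.1 hj
  have hgen := Generic.forall_mem hS fun j _ =>
    (((hP.and (generic_zDefinedAt hc hz r)).and
      ((generic_win_mem (D := D) F.isOpen_dom D.dense_domF).and
        (generic_win_mem D.isOpen_domU D.dense_domU))).and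
      (hP₁.and (Generic.forall_mem (Set.finite_Icc 1 (2 * R)) fun n hn =>
        generic_zz_ne hc hr hz hinv hcoord hK hpdu n hn.1))).shift hc j
  intro ξ hξ
  obtain ⟨x, rfl⟩ := AdmPt.exists_toPt_eq D hξ
  refine map_mem_closure (AdmPt.continuous_toPt D) (hgen.dense x) fun y hy => ?_
  have hy' := y.toPt_mem D
  refine ⟨y.toPt_mem D, ?_⟩
  refine exists_expressionsAt (S := S) hc hr hz hinv hK hy' hS ?_
    (fun j hj => hP' _ (admissible_zpow D hy' j) (hy j hj).1.1.1)
    (fun j hj => (hy j hj).1.1.2) (fun j hj => (hy j hj).1.2.1) (fun j hj => (hy j hj).1.2.2)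
    (fun j hj => hP₁' _ (admissible_zpow D hy' j) (hy j hj).2.1)
  have hlt : ∀ i ∈ S, ∀ j ∈ S, i < j → zSeq D z (y.toPt D) i ≠ zSeq D z (y.toPt D) j := by
    intro i hi j hj hij
    have hi' : -(R : ℤ) ≤ i ∧ i ≤ R := abs_le.1 hi
    have hj' : -(R : ℤ) ≤ j ∧ j ≤ R := abs_le.1 hj
    obtain ⟨n, hn⟩ : ∃ n : ℕ, j = n + i := ⟨(j - i).toNat, by omega⟩
    have h1 := ((hy i hi).2.2 n ⟨by omega, by omega⟩).2
    rw [zz_zpow, zz_zpow, zero_add, ← hn] at h1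
    exact h1.symm
  intro i hi j hj hij
  rcases lt_trichotomy i j with h | h | h
  · exact absurd hij (hlt i hi j hj h)
  · exact h
  · exact absurd hij.symm (hlt j hj i hi h)

end Density

end Miura

end

theorem mainTheorem1 {d m : ℕ} {c : Fin m → ℂ} {k : Fin m → ℕ} {α β a b : ℤ}
    (hαβ : α ≤ β) (hab : a ≤ b)
    (F : Miura.LatticeFn α β) (D : Miura.DarbouxLax d F a b)
    (hc : ∀ p, c p ∈ D.lamDom)
    (r : ℕ) (hr : 0 < r)
    (H : Subgroup (Miura.LieG d c k)) (hH : Miura.IsClosedConnectedLieSubgroup H r)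
    (z : Miura.LieG d c k ⧸ H → ℂ) (Y : Set (Miura.LieG d c k ⧸ H))
    (hz : Miura.IsFunctionOn z Y)
    (hinv : Miura.LeftInvariant D (r - 1) z Y)
    (hcoord : Miura.LocalCoordsAE D z Y r)
    (hpdu : ∃ ξ ∈ Miura.admissible D c k, Miura.ZDefinedAt D Y r ξ ∧ Miura.dzdu D z r ξ ≠ 0) :
    -- `S^j(z)`, `j < r`, do not depend on the `u_l` and are functions on `G/H`
    (∀ j : ℕ, j < r → ∀ ξ ∈ Miura.admissible D c k, ∀ η ∈ Miura.admissible D c k,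
      (ξ.1 : Miura.LieG d c k ⧸ H) = (η.1 : Miura.LieG d c k ⧸ H) →
      Miura.ZDefinedAt D Y j ξ → Miura.ZDefinedAt D Y j η →
      Miura.zz D z j ξ = Miura.zz D z j η) ∧
    -- locally `S^r(z) = Fz(z_0, …, z_{r-1}, u)`
    (∀ ξ ∈ Miura.admissible D c k, Miura.LocalCoordsAt D z Y r ξ → Miura.ZDefinedAt D Y r ξ →
      ∃ Fz : Miura.AnalyticFn (Miura.Win 0 (r - 1) × ℂ), Miura.ShiftGivenBy D z Fz ξ) ∧
    -- locally `D_t(z) = Q(z_0, …, z_{r-1}, u_a, …, u_b)`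
    (∀ ξ ∈ Miura.admissible D c k, Miura.LocalCoordsAt D z Y r ξ → Miura.win a b ξ.2 ∈ D.domU →
      ∃ Q : Miura.AnalyticFn (Miura.Win 0 (r - 1) × Miura.Win a b), Miura.DerivGivenBy D z Q ξ) ∧
    -- where `∂/∂u (S^r(z)) ≠ 0`, the equation `z_r = Fz(z_0, …, z_{r-1}, u)` can be solved for `u`
    (∀ ξ ∈ Miura.admissible D c k, Miura.LocalCoordsAt D z Y r ξ → Miura.ZDefinedAt D Y r ξ →
      Miura.dzdu D z r ξ ≠ 0 →
      ∀ Fz : Miura.AnalyticFn (Miura.Win 0 (r - 1) × ℂ), Miura.ShiftGivenBy D z Fz ξ →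
      ∃ f : Miura.LatticeFn 0 r, Miura.SolvesAt D z Fz f ξ) ∧
    -- `u = f(v_0, …, v_r)` is a Miura-type transformation from `v_t = P` to `u_t = F`, around the
    -- values `v_j = z_j` at any point along whose shifts the expressions are valid
    (∀ (Fz : Miura.AnalyticFn (Miura.Win 0 (r - 1) × ℂ))
      (Q : Miura.AnalyticFn (Miura.Win 0 (r - 1) × Miura.Win a b)) (f : Miura.LatticeFn 0 r),
      ∀ ξ ∈ Miura.admissible D c k,
      (∀ j : ℤ, |j| ≤ |α| + |β| + |a| + |b| + r →
        Miura.ExpressionsAt D z Y Fz Q f ((Miura.shiftPt D ^ j) ξ)) →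
      ∃ 𝒱 : Set (ℤ → ℂ), IsOpen 𝒱 ∧ Miura.zSeq D z ξ ∈ 𝒱 ∧
        Miura.IsMiuraOn (Miura.modified f Q) F f 𝒱) ∧
    -- for every range of shifts, such points and expressions exist almost everywhere
    (∀ R : ℕ, Miura.admissible D c k ⊆ closure {ξ | ξ ∈ Miura.admissible D c k ∧
      ∃ (Fz : Miura.AnalyticFn (Miura.Win 0 (r - 1) × ℂ))
        (Q : Miura.AnalyticFn (Miura.Win 0 (r - 1) × Miura.Win a b)) (f : Miura.LatticeFn 0 r),
        ∀ j : ℤ, |j| ≤ R → Miura.ExpressionsAt D z Y Fz Q f ((Miura.shiftPt D ^ j) ξ)}) := by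
  obtain ⟨K, hK⟩ := hH.exists_isTangent
  refine ⟨?_, ?_, ?_, ?_, ?_, ?_⟩
  · exact fun j hj ξ hξ η hη h h1 h2 =>
      Miura.zz_eq_of_mk_eq D hc hinv j hj h (fun i _ => hξ i) (fun i _ => hη i) h1 h2
  · exact fun ξ hξ hloc h => Miura.exists_shiftGivenBy D hc hr hz hinv hK hξ hloc h
  · exact fun ξ hξ hloc h => Miura.exists_derivGivenBy D hc hr hz hinv hK hξ hloc h
  · exact fun ξ hξ hloc _ hd Fz hF => Miura.exists_solvesAt D hc hz hinv hξ hloc hd hF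
  · exact fun Fz Q f ξ hξ hexp => Miura.exists_isMiuraOn D hc hz hinv hξ hexp
  · exact Miura.admissible_subset_closure_expressionsAt hc hr hz hinv hcoord hK hpdu
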